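/- Let $k>0$, $R>0$ and $B_0>1$. There is a constant $\mathscr C>0$ depending only on $k,R,B_0$ such that the following holds in every dimension $n\ge 2$. Write $B_r=\{x\in\mathbb R^n:|x|<r\}$. Let $w^s\in H^2_{loc}(\mathbb R^n)$ be complex valued and satisfy $(\Delta+k^2)w^s=0$ in $\mathbb R^n\setminus\overline{B_R}$ and the Sommerfeld radiation condition $$|x|^{\frac{n-1}{2}}(\partial_r-ik)w^s(x)\to 0\quad\text{as } r=|x|\to\infty,\ \text{uniformly in } x/|x|.$$ Let $w^s_\infty:\mathbb S^{n-1}\to\mathbb C$ be its far-field pattern, that is, the function with $$w^s(r\theta)=\frac{e^{ikr}}{r^{(n-1)/2}}\,w^s_\infty(\theta)+\mathcal O\big(r^{-n/2}\big)\quad\text{as } r\to\infty,\ \text{uniformly in }\theta\in\mathbb S^{n-1}.$$ Let $\mathscr S\ge 0$ be such that $\|w^s\|_{L^2(B_{2R}\setminus B_R)}\le\mathscr S$ and let $\varepsilon=\|w^s_\infty\|_{L^2(\mathbb S^{n-1})}$. If $\varepsilon<\mathscr C^{-1}\mathscr S$, then $$\|w^s\|_{L^2(B_{2B_0R}\setminus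 B_{B_0R})}\le\mathscr C\,\mathscr S\,B_0^{-\frac12\sqrt{2ekR\ln(\mathscr S/\varepsilon)}},$$ where the right-hand side is read as $0$ when $\varepsilon=0$. If instead $\varepsilon\ge\mathscr C^{-1}\mathscr S$, then $\|w^s\|_{L^2(B_{2R}\setminus B_R)}\le\mathscr C\varepsilon$. -/

import Mathlib

open MeasureTheory Set Filter Topology
open scoped ContDiff InnerProductSpace

noncomputable section

namespace Scattering

/-- `ℝⁿ` with the Euclidean norm. -/
abbrev Eucl (n : ℕ) : Type := EuclideanSpace ℝ (Fin n)

/-- `f ∈ L²_loc(ℝⁿ)`. -/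
def MemL2loc {n : ℕ} (f : Eucl n → ℂ) : Prop :=
  ∀ r : ℝ, MemLp f 2 (volume.restrict (Metric.ball (0 : Eucl n) r))

/-- `g` is the weak partial derivative `∂ᵢ f` on `ℝⁿ` (used for locally integrable `f`, `g`). -/
def HasWeakPartial {n : ℕ} (i : Fin n) (f g : Eucl n → ℂ) : Prop :=
  ∀ φ : Eucl n → ℂ, ContDiff ℝ ∞ φ → HasCompactSupport φ →
    ∫ x, f x * fderiv ℝ φ x (EuclideanSpace.single i 1) = - ∫ x, g x * φ x

/-- `f ∈ H²_loc(ℝⁿ)`: `f` and its weak partial derivatives of first and second order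
are in `L²_loc(ℝⁿ)`. -/
def MemH2loc {n : ℕ} (f : Eucl n → ℂ) : Prop :=
  MemL2loc f ∧
    ∃ (g : Fin n → Eucl n → ℂ) (h : Fin n → Fin n → Eucl n → ℂ),
      (∀ i, MemL2loc (g i) ∧ HasWeakPartial i f (g i)) ∧
      (∀ i j, MemL2loc (h i j) ∧ HasWeakPartial j (g i) (h i j))

/-- `(Δ + k²) w = 0` in the open set `Ω`, in the sense of distributions. -/
def IsHelmholtzSolution {n : ℕ} (k : ℝ) (Ω : Set (Eucl n)) (w : Eucl n → ℂ) : Prop :=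
  ∀ φ : Eucl n → ℂ, ContDiff ℝ ∞ φ → HasCompactSupport φ → tsupport φ ⊆ Ω →
    ∫ x, w x * (Laplacian.laplacian φ x + (k : ℂ) ^ 2 * φ x) = 0

/-- The exterior domain `ℝⁿ ∖ closure B_R`. -/
def exterior (n : ℕ) (R : ℝ) : Set (Eucl n) := (Metric.closedBall (0 : Eucl n) R)ᶜ

/-- The annulus `B_b ∖ B_a`. -/
def annulus (n : ℕ) (a b : ℝ) : Set (Eucl n) :=
  Metric.ball (0 : Eucl n) b \ Metric.ball (0 : Eucl n) a

/-- The Sommerfeld radiation condition `|x|^((n-1)/2) (∂_r - i k) w → 0`, uniformly in the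
angular variable as `|x| → ∞`.  As `w` is only determined almost everywhere, the condition
is imposed on the continuously differentiable representative `v` of `w` in the exterior
domain (it is unique there). -/
def IsRadiating {n : ℕ} (k R : ℝ) (w : Eucl n → ℂ) : Prop :=
  ∃ v : Eucl n → ℂ, ContDiffOn ℝ 1 v (exterior n R) ∧
    w =ᵐ[volume.restrict (exterior n R)] v ∧
    Tendsto
      (fun x : Eucl n =>
        ((‖x‖ ^ (((n : ℝ) - 1) / 2) : ℝ) : ℂ) *
          (fderiv ℝ v x (‖x‖⁻¹ • x) - Complex.I * (k : ℂ) * v x))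
      (Bornology.cobounded (Eucl n)) (𝓝 0)

/-- `A : S^{n-1} → ℂ` is the far-field pattern of `w`:
`w(rθ) = e^{ikr} r^{-(n-1)/2} A(θ) + O(r^{-n/2})` as `r → ∞`, uniformly in `θ`, where `w` is
evaluated through its continuous representative in the exterior domain.  There is at most
one such `A`. -/
def IsFarFieldPattern {n : ℕ} (k R : ℝ) (w : Eucl n → ℂ)
    (A : Metric.sphere (0 : Eucl n) 1 → ℂ) : Prop :=
  ∃ v : Eucl n → ℂ, ContinuousOn v (exterior n R) ∧
    w =ᵐ[volume.restrict (exterior n R)] v ∧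
    ∃ M r₀ : ℝ, ∀ r : ℝ, r₀ ≤ r → ∀ θ : Metric.sphere (0 : Eucl n) 1,
      ‖v (r • (θ : Eucl n)) -
          Complex.exp (Complex.I * (k : ℂ) * (r : ℂ)) /
            ((r ^ (((n : ℝ) - 1) / 2) : ℝ) : ℂ) * A θ‖
        ≤ M * r ^ (-((n : ℝ) / 2))

/-- The norm `‖f‖_{L²(D)}`, with values in `[0, ∞]`. -/
def normL2 {n : ℕ} (D : Set (Eucl n)) (f : Eucl n → ℂ) : ENNReal :=
  eLpNorm f 2 (volume.restrict D)

/-- The norm `‖A‖_{L²(S^{n-1})}` for the surface measure, with values in `[0, ∞]`. -/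
def normL2Sphere {n : ℕ} (A : Metric.sphere (0 : Eucl n) 1 → ℂ) : ENNReal :=
  eLpNorm A 2 (volume : Measure (Eucl n)).toSphere

end Scattering

end

/-! Separation of variables turns the estimate into a statement about scalar functions. Put `b = l +
(n-1)/2`. Testing the Helmholtz equation against a solid harmonic of degree `l` shows that the
corresponding angular component of `r^((n-1)/2) w(rθ)` solves `G'' + (k² - b(b-1)/r²) G = 0` weakly.
By the radiation condition it equals `h_b(r)` times the same component of the far field, where `h_b`
is the solution normalised by `h_b(r) ~ e^{ikr}` (`IsRadiatingField.sphere_integral_eq`). Spherical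
harmonics are orthogonal and complete, so with `a_l ≥ 0` the squared norms of the far-field
components, `ε² = ∑ a_l` and the energy of `w` on the sphere of radius `r` is `∑ |h_b(r)|² a_l`
(`IsRadiatingField.exists_hasSum`).

Fix a threshold `N`. For `b ≤ N` a Laplace integral gives `|h_b(r)| ≤ (2 max(1, b/(2kr)))^b`
(`norm_outgoing_le`), so these modes cost at most a factor `M_N` of size about `(N/(kR))^(2N)` times
`ε²`. For `b ≥ N` the radii in play lie well below the turning point `kr ≈ b`, where `|h_b|²` decays
at least like `r^(-b)` up to an error controlled in `b` (`IsOutgoing.norm_sq_le`); passing from `r`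
to `B₀ r` therefore gains `B₀^(-N)` against the energy on `B_{2R} \ B_R`. Integrating over `R < r <
2R` bounds the squared norm on the outer annulus by `B₀ ((M_N + E) R ε² + B₀^(-N) S²)`, where `E`
depends only on `k`, `R`, `B₀`.

It remains to choose `N`. With `T = ½ √(2ekR ln(S/ε))` one has `ε² = S² exp(-4T²/(ekR))`, and `N =
2T + const` makes both terms at most a constant times `S² B₀^(-2T)`: the growth `N ln N` of `ln M_N`
is beaten by the Gaussian (`exists_forall_rpow_mul_exp_le`, `exists_energy_le`). The dimension
enters only through the values of `b`, and all radial bounds are uniform in `b`, so the constant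
does not depend on `n`. If `ε = 0` every mode vanishes, which is Rellich's lemma; the case of large
`ε` is immediate from the bound by `S`. -/

namespace Scattering

/-! ### Outgoing radial solutions -/

/-- The factor `(1 + i t / (2k)) ^ p` in the Laplace representation of Hankel functions. -/
noncomputable def hankelWeight (k p t : ℝ) : ℂ :=
  (1 + Complex.I * ((t / (2 * k) : ℝ) : ℂ)) ^ (p : ℂ)

/-- The Laplace transform of `t ^ (s - 1) * hankelWeight k p t`. -/
noncomputable def hankelLaplace (k p s r : ℝ) : ℂ :=
  ∫ t in Ioi (0 : ℝ), ((t ^ (s - 1) * Real.exp (-(r * t)) : ℝ) : ℂ) * hankelWeight k p t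

/-- The cubic Taylor polynomial of `exp` exceeds `1 + y²` by `y (1 - y/2 + y²/6)`, whose quadratic
factor has negative discriminant. -/
lemma one_add_sq_le_exp {y : ℝ} (hy : 0 ≤ y) : 1 + y ^ 2 ≤ Real.exp y := by
  have h := Real.sum_le_exp_of_nonneg hy 4
  simp only [Finset.sum_range_succ, Finset.sum_range_zero] at h
  norm_num [Nat.factorial] at h
  have h2 : 0 ≤ y * (y ^ 2 / 6 - y / 2 + 1) := mul_nonneg hy (by nlinarith [sq_nonneg (y - 3 / 2)])
  nlinarith

lemma hankelWeight_base_mem_slitPlane (x : ℝ) : 1 + Complex.I * (x : ℂ) ∈ Complex.slitPlane := by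
  left; simp

lemma continuous_hankelWeight (k p : ℝ) : Continuous (hankelWeight k p) := by
  unfold hankelWeight
  refine Continuous.cpow (by fun_prop) continuous_const
    fun t => hankelWeight_base_mem_slitPlane _

lemma norm_one_add_I_mul_sq (x : ℝ) : ‖1 + Complex.I * (x : ℂ)‖ ^ 2 = 1 + x ^ 2 := by
  rw [← Complex.normSq_eq_norm_sq, Complex.normSq_apply]; simp; ring

/-- Half of the decay `e^{-rt}` is spent to absorb the weight. With `x = t/(2k)` and `m ≥ 1`, `1 +
x² ≤ m² e^{x/m}`; the choice `m = max 1 (b/(2kr))` is the least one above `1` for which the `b`-th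
power of `e^{x/(2m)}` stays below `e^{rt/2}`. The exponent `b - 1`, which may be negative, is raised
to `b` because the base has modulus at least `1`. -/
lemma norm_hankelWeight_le {k b r t : ℝ} (hk : 0 < k) (hb : 0 < b) (hr : 0 < r) (ht : 0 ≤ t) :
    ‖hankelWeight k (b - 1) t‖ ≤ max 1 (b / (2 * k * r)) ^ b * Real.exp (r / 2 * t) := by
  set m := max 1 (b / (2 * k * r)) with hm
  have hm1 : 1 ≤ m := le_max_left _ _
  have hm2 : b ≤ m * (2 * k * r) := by
    have := le_max_right 1 (b / (2 * k * r))
    rwa [← hm, div_le_iff₀ (by positivity)] at this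
  have hx : 0 ≤ t / (2 * k) := by positivity
  set x := t / (2 * k) with hxd
  have htx : t = 2 * k * x := by rw [hxd]; field_simp
  rw [hankelWeight, Complex.norm_cpow_real, ← hxd]
  have hsq := norm_one_add_I_mul_sq x
  set z := ‖1 + Complex.I * (x : ℂ)‖ with hz
  have hz1 : 1 ≤ z := by
    have : 0 ≤ z := norm_nonneg _
    nlinarith [sq_nonneg x]
  have hzm : z ≤ m * Real.exp (x / m / 2) := by
    refine le_of_sq_le_sq ?_ (by positivity)
    rw [hsq, mul_pow, ← Real.exp_nat_mul]
    have h1 := one_add_sq_le_exp (y := x / m) (by positivity)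
    have h2 : ((2 : ℕ) : ℝ) * (x / m / 2) = x / m := by push_cast; ring
    rw [h2]
    calc 1 + x ^ 2 ≤ m ^ 2 * (1 + (x / m) ^ 2) := by
          have : m ^ 2 * (1 + (x / m) ^ 2) = m ^ 2 + x ^ 2 := by field_simp
          rw [this]; nlinarith
      _ ≤ m ^ 2 * Real.exp (x / m) := by gcongr
  calc z ^ (b - 1) ≤ z ^ b := Real.rpow_le_rpow_of_exponent_le hz1 (by linarith)
    _ ≤ (m * Real.exp (x / m / 2)) ^ b := Real.rpow_le_rpow (by linarith) hzm hb.le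
    _ = m ^ b * Real.exp (x / m / 2 * b) := by
        rw [Real.mul_rpow (by positivity) (by positivity), ← Real.exp_mul]
    _ ≤ m ^ b * Real.exp (r / 2 * t) := by
        have h : x / m / 2 * b ≤ r / 2 * t := by
          rw [htx, div_div, div_mul_eq_mul_div, div_le_iff₀ (by positivity)]
          nlinarith
        gcongr

lemma integrableOn_rpow_mul_exp {s r : ℝ} (hs : 0 < s) (hr : 0 < r) :
    IntegrableOn (fun t : ℝ => t ^ (s - 1) * Real.exp (-(r * t))) (Ioi 0) := by
  have := integrableOn_rpow_mul_exp_neg_mul_rpow (p := 1) (s := s - 1) (b := r)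
    (by linarith) one_pos hr
  simpa using this

lemma norm_hankel_integrand_le {k b s r t : ℝ} (hk : 0 < k) (hb : 0 < b) (hr : 0 < r)
    (ht : 0 < t) :
    ‖((t ^ (s - 1) * Real.exp (-(r * t)) : ℝ) : ℂ) * hankelWeight k (b - 1) t‖ ≤
      max 1 (b / (2 * k * r)) ^ b * (t ^ (s - 1) * Real.exp (-(r / 2 * t))) := by
  rw [norm_mul, Complex.norm_real, Real.norm_of_nonneg (by positivity)]
  calc _ ≤ (t ^ (s - 1) * Real.exp (-(r * t))) *
        (max 1 (b / (2 * k * r)) ^ b * Real.exp (r / 2 * t)) := by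
        gcongr; exact norm_hankelWeight_le hk hb hr ht.le
    _ = max 1 (b / (2 * k * r)) ^ b *
        (t ^ (s - 1) * (Real.exp (-(r * t)) * Real.exp (r / 2 * t))) := by ring
    _ = _ := by rw [← Real.exp_add]; congr 3; ring_nf

lemma aestronglyMeasurable_hankel_integrand (k p s r : ℝ) :
    AEStronglyMeasurable
      (fun t : ℝ => ((t ^ (s - 1) * Real.exp (-(r * t)) : ℝ) : ℂ) * hankelWeight k p t)
      (volume.restrict (Ioi 0)) := by
  refine Measurable.aestronglyMeasurable (Measurable.mul ?_ (continuous_hankelWeight k p).measurable)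
  exact Complex.measurable_ofReal.comp (by fun_prop)

lemma integrableOn_hankel_integrand {k b s r : ℝ} (hk : 0 < k) (hb : 0 < b) (hs : 0 < s)
    (hr : 0 < r) :
    IntegrableOn (fun t : ℝ =>
      ((t ^ (s - 1) * Real.exp (-(r * t)) : ℝ) : ℂ) * hankelWeight k (b - 1) t) (Ioi 0) := by
  refine Integrable.mono' ((integrableOn_rpow_mul_exp hs (half_pos hr)).const_mul
    (max 1 (b / (2 * k * r)) ^ b)) (aestronglyMeasurable_hankel_integrand _ _ _ _) ?_
  filter_upwards [ae_restrict_mem measurableSet_Ioi] with t ht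
  exact norm_hankel_integrand_le hk hb hr ht

lemma norm_hankelLaplace_le {k b s r : ℝ} (hk : 0 < k) (hb : 0 < b) (hs : 0 < s) (hr : 0 < r) :
    ‖hankelLaplace k (b - 1) s r‖ ≤
      max 1 (b / (2 * k * r)) ^ b * ((1 / (r / 2)) ^ s * Real.Gamma s) := by
  rw [← Real.integral_rpow_mul_exp_neg_mul_Ioi hs (half_pos hr), ← integral_const_mul]
  refine norm_integral_le_of_norm_le
    ((integrableOn_rpow_mul_exp hs (half_pos hr)).const_mul _) ?_
  filter_upwards [ae_restrict_mem measurableSet_Ioi] with t ht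
  exact norm_hankel_integrand_le hk hb hr ht

lemma hasDerivAt_hankelLaplace {k b s r : ℝ} (hk : 0 < k) (hb : 0 < b) (hs : 0 < s)
    (hr : 0 < r) :
    HasDerivAt (hankelLaplace k (b - 1) s) (-hankelLaplace k (b - 1) (s + 1) r) r := by
  have key := hasDerivAt_integral_of_dominated_loc_of_deriv_le (𝕜 := ℝ)
    (μ := volume.restrict (Ioi (0 : ℝ))) (x₀ := r) (s := Ioi (r / 2))
    (F := fun r t => ((t ^ (s - 1) * Real.exp (-(r * t)) : ℝ) : ℂ) * hankelWeight k (b - 1) t)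
    (F' := fun r t =>
      -(((t ^ (s + 1 - 1) * Real.exp (-(r * t)) : ℝ) : ℂ) * hankelWeight k (b - 1) t))
    (bound := fun t =>
      ‖((t ^ (s + 1 - 1) * Real.exp (-(r / 2 * t)) : ℝ) : ℂ) * hankelWeight k (b - 1) t‖)
    (Ioi_mem_nhds (by linarith))
    (Eventually.of_forall fun x => aestronglyMeasurable_hankel_integrand _ _ _ _)
    (integrableOn_hankel_integrand hk hb hs hr)
    (aestronglyMeasurable_hankel_integrand _ _ _ _).neg ?_
    (integrableOn_hankel_integrand hk hb (by linarith) (by linarith)).norm ?_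
  · have h := key.2
    rw [integral_neg] at h
    exact h
  · filter_upwards [ae_restrict_mem measurableSet_Ioi] with t ht x hx
    have ht' : (0 : ℝ) < t := ht
    have hx' : r / 2 < x := hx
    rw [norm_neg, norm_mul, norm_mul, Complex.norm_real, Complex.norm_real,
      Real.norm_of_nonneg (by positivity), Real.norm_of_nonneg (by positivity)]
    gcongr
  · filter_upwards [ae_restrict_mem measurableSet_Ioi] with t ht x hx
    have ht' : (0 : ℝ) < t := ht
    have h1 : HasDerivAt (fun x : ℝ => t ^ (s - 1) * Real.exp (-(x * t)))
        (t ^ (s - 1) * (Real.exp (-(x * t)) * (-(1 * t)))) x :=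
      (((hasDerivAt_id x).mul_const t).neg.exp).const_mul _
    refine (h1.ofReal_comp.mul_const (hankelWeight k (b - 1) t)).congr_deriv ?_
    have : t ^ (s + 1 - 1) = t ^ (s - 1) * t := by
      rw [← Real.rpow_add_one ht'.ne']; congr 1; ring
    rw [this]; push_cast; ring

/-- Integrate over `(0, ∞)` the derivative of `t^b e^{-rt} (1 + it/(2k))^b`, which vanishes at both
ends. This relation between three Laplace integrals is exactly what the radial equation for
`outgoing` reduces to. -/
lemma hankelLaplace_recurrence {k b r : ℝ} (hk : 0 < k) (hb : 0 < b) (hr : 0 < r) :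
    (r : ℂ) * (hankelLaplace k (b - 1) (b + 1) r +
        Complex.I / (2 * k) * hankelLaplace k (b - 1) (b + 2) r) =
      b * (hankelLaplace k (b - 1) b r +
        Complex.I / k * hankelLaplace k (b - 1) (b + 1) r) := by
  set E : ℝ → ℝ → ℂ := fun s t =>
    ((t ^ (s - 1) * Real.exp (-(r * t)) : ℝ) : ℂ) * hankelWeight k (b - 1) t with hE
  have hint : ∀ s, 0 < s → IntegrableOn (E s) (Ioi 0) := fun s hs =>
    integrableOn_hankel_integrand hk hb hs hr
  set Q : ℝ → ℂ := fun t => ((t ^ b * Real.exp (-(r * t)) : ℝ) : ℂ) * hankelWeight k b t with hQ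
  have hQE : ∀ t, 0 < t → Q t = E (b + 1) t + Complex.I / (2 * k) * E (b + 2) t := by
    intro t ht
    have e1 : t ^ (b + 2 - 1) = t ^ b * t := by
      rw [← Real.rpow_add_one ht.ne']; congr 1; ring
    have e2 : hankelWeight k b t =
        hankelWeight k (b - 1) t * (1 + Complex.I * ((t / (2 * k) : ℝ) : ℂ)) := by
      unfold hankelWeight
      have hne := Complex.slitPlane_ne_zero (hankelWeight_base_mem_slitPlane (t / (2 * k)))
      rw [show (b : ℂ) = ((b - 1 : ℝ) : ℂ) + 1 by push_cast; ring, Complex.cpow_add _ _ hne,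
        Complex.cpow_one]
    simp only [hQ, hE, e1, e2]
    rw [show b + 1 - 1 = b by ring]
    push_cast
    ring
  have hder : ∀ t ∈ Ioi (0 : ℝ), HasDerivAt Q
      (b * (E b t + Complex.I / k * E (b + 1) t) -
        r * (E (b + 1) t + Complex.I / (2 * k) * E (b + 2) t)) t := by
    intro t ht
    have ht : (0 : ℝ) < t := ht
    rw [← hQE t ht]
    have h1 : HasDerivAt (fun t : ℝ => t ^ b * Real.exp (-(r * t)))
        (b * t ^ (b - 1) * Real.exp (-(r * t)) +
          t ^ b * (Real.exp (-(r * t)) * (-(r * 1)))) t :=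
      (Real.hasDerivAt_rpow_const (Or.inl ht.ne')).mul
        (((hasDerivAt_id t).const_mul r).neg.exp)
    have h2 : HasDerivAt (fun t : ℝ => 1 + Complex.I * ((t / (2 * k) : ℝ) : ℂ))
        (Complex.I * ((1 / (2 * k) : ℝ) : ℂ)) t :=
      ((((hasDerivAt_id t).div_const (2 * k)).ofReal_comp).const_mul Complex.I).const_add 1
    have h3 : HasDerivAt (hankelWeight k b)
        ((b : ℂ) * hankelWeight k (b - 1) t * (Complex.I * ((1 / (2 * k) : ℝ) : ℂ))) t := by
      have := ((hasDerivAt_id (1 + Complex.I * ((t / (2 * k) : ℝ) : ℂ))).cpow_const (c := (b : ℂ))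
        (hankelWeight_base_mem_slitPlane _)).comp t h2
      refine this.congr_deriv ?_
      simp [hankelWeight]
    have h4 := h1.ofReal_comp.mul h3
    refine h4.congr_deriv ?_
    have e2 : hankelWeight k b t =
        hankelWeight k (b - 1) t * (1 + Complex.I * ((t / (2 * k) : ℝ) : ℂ)) := by
      unfold hankelWeight
      have hne := Complex.slitPlane_ne_zero (hankelWeight_base_mem_slitPlane (t / (2 * k)))
      rw [show (b : ℂ) = ((b - 1 : ℝ) : ℂ) + 1 by push_cast; ring, Complex.cpow_add _ _ hne,
        Complex.cpow_one]
    have e3 : t ^ b = t ^ (b - 1) * t := by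
      rw [← Real.rpow_add_one ht.ne']; congr 1; ring
    have hkc : (k : ℂ) ≠ 0 := by exact_mod_cast hk.ne'
    simp only [hQ, hE, e2, show b + 1 - 1 = b by ring, e3]
    push_cast
    field_simp
    ring
  have i1 := ((hint b hb).add ((hint (b + 1) (by linarith)).const_mul (Complex.I / k))).const_mul
    (b : ℂ)
  have i2 := ((hint (b + 1) (by linarith)).add
    ((hint (b + 2) (by linarith)).const_mul (Complex.I / (2 * k)))).const_mul (r : ℂ)
  have hzero := integral_Ioi_of_hasDerivAt_of_tendsto (f := Q) (m := 0) (a := 0) ?_ hder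
    (i1.sub i2) ?_
  · have hQ0 : Q 0 = 0 := by simp [hQ, Real.zero_rpow hb.ne']
    rw [hQ0, sub_zero] at hzero
    have h5 := integral_sub i1 i2
    have h6 : ∫ t in Ioi (0 : ℝ), (b : ℂ) * (E b t + Complex.I / k * E (b + 1) t) =
        b * (hankelLaplace k (b - 1) b r +
        Complex.I / k * hankelLaplace k (b - 1) (b + 1) r) := by
      rw [integral_const_mul, integral_add (hint b hb)
        ((hint (b + 1) (by linarith)).const_mul _), integral_const_mul]
      rfl
    have h7 : ∫ t in Ioi (0 : ℝ), (r : ℂ) * (E (b + 1) t + Complex.I / (2 * k) * E (b + 2) t) =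
        r * (hankelLaplace k (b - 1) (b + 1) r +
        Complex.I / (2 * k) * hankelLaplace k (b - 1) (b + 2) r) := by
      rw [integral_const_mul, integral_add (hint (b + 1) (by linarith))
        ((hint (b + 2) (by linarith)).const_mul _), integral_const_mul]
      rfl
    rw [← h6, ← h7]
    exact (sub_eq_zero.1 (h5.symm.trans hzero)).symm
  · refine Continuous.continuousWithinAt ?_
    refine Continuous.mul ?_ (continuous_hankelWeight k b)
    refine Complex.continuous_ofReal.comp ?_
    exact (Real.continuous_rpow_const hb.le).mul (by fun_prop)
  · have hlim : Tendsto (fun t : ℝ => max 1 ((b + 1) / (2 * k * r)) ^ (b + 1) *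
        (t ^ b * Real.exp (-(r / 2) * t))) atTop (𝓝 0) := by
      simpa using (tendsto_rpow_mul_exp_neg_mul_atTop_nhds_zero b (r / 2) (half_pos hr)).const_mul
        (max 1 ((b + 1) / (2 * k * r)) ^ (b + 1))
    refine squeeze_zero_norm' ?_ hlim
    filter_upwards [eventually_gt_atTop 0] with t ht
    have := norm_hankel_integrand_le (k := k) (b := b + 1) (s := b + 1) hk (by linarith) hr ht
    simpa [hQ] using this

/-- Leading order of Watson's lemma: after the substitution `u = rt` the weight tends to `1`
pointwise, and for `r ≥ 1` the bound of `norm_hankelWeight_le` gives a dominating function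
independent of `r`. -/
lemma tendsto_hankelLaplace {k b s : ℝ} (hk : 0 < k) (hb : 0 < b) (hs : 0 < s) :
    Tendsto (fun r : ℝ => ((r ^ s : ℝ) : ℂ) * hankelLaplace k (b - 1) s r) atTop
      (𝓝 (Real.Gamma s : ℂ)) := by
  have hscale : ∀ r : ℝ, 0 < r → ((r ^ s : ℝ) : ℂ) * hankelLaplace k (b - 1) s r =
      ∫ u in Ioi (0 : ℝ),
        ((u ^ (s - 1) * Real.exp (-(1 * u)) : ℝ) : ℂ) * hankelWeight k (b - 1) (u / r) := by
    intro r hr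
    have h := integral_comp_mul_left_Ioi (fun u : ℝ =>
      ((u ^ (s - 1) * Real.exp (-(1 * u)) : ℝ) : ℂ) * hankelWeight k (b - 1) (u / r)) 0 hr
    rw [mul_zero] at h
    have h2 : ∫ u in Ioi (0 : ℝ),
        ((u ^ (s - 1) * Real.exp (-(1 * u)) : ℝ) : ℂ) * hankelWeight k (b - 1) (u / r) =
        r • ∫ t in Ioi (0 : ℝ), (((r * t) ^ (s - 1) * Real.exp (-(1 * (r * t))) : ℝ) : ℂ) *
          hankelWeight k (b - 1) (r * t / r) := by
      rw [h, smul_inv_smul₀ hr.ne']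
    rw [h2, hankelLaplace, ← integral_const_mul, ← integral_smul]
    refine setIntegral_congr_fun measurableSet_Ioi fun t ht => ?_
    have ht : (0 : ℝ) < t := ht
    have e : r ^ s = r ^ (s - 1) * r := by
      rw [← Real.rpow_add_one hr.ne']; congr 1; ring
    simp only [Real.mul_rpow hr.le ht.le, mul_div_cancel_left₀ _ hr.ne', e, one_mul,
      Complex.real_smul]
    push_cast
    ring
  have hG : (Real.Gamma s : ℂ) = ∫ u in Ioi (0 : ℝ),
      ((u ^ (s - 1) * Real.exp (-(1 * u)) : ℝ) : ℂ) := by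
    rw [integral_complex_ofReal, Real.integral_rpow_mul_exp_neg_mul_Ioi hs one_pos]
    simp
  rw [hG]
  have : (fun r : ℝ => ((r ^ s : ℝ) : ℂ) * hankelLaplace k (b - 1) s r) =ᶠ[atTop]
      fun r => ∫ u in Ioi (0 : ℝ),
        ((u ^ (s - 1) * Real.exp (-(1 * u)) : ℝ) : ℂ) * hankelWeight k (b - 1) (u / r) := by
    filter_upwards [eventually_gt_atTop 0] with r hr using hscale r hr
  refine Tendsto.congr' this.symm ?_
  refine tendsto_integral_filter_of_dominated_convergence
    (fun u => max 1 (b / (2 * k)) ^ b * (u ^ (s - 1) * Real.exp (-(1 / 2 * u)))) ?_ ?_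
    ((integrableOn_rpow_mul_exp hs (by norm_num)).const_mul _) ?_
  · refine Eventually.of_forall fun r => Measurable.aestronglyMeasurable ?_
    refine Measurable.mul (Complex.measurable_ofReal.comp (by fun_prop)) ?_
    exact (continuous_hankelWeight k (b - 1)).measurable.comp (by fun_prop)
  · filter_upwards [eventually_ge_atTop 1] with r hr
    filter_upwards [ae_restrict_mem measurableSet_Ioi] with u hu
    have hu : (0 : ℝ) < u := hu
    have hr0 : 0 < r := by linarith
    have h1 := norm_hankelWeight_le (t := u / r) hk hb hr0 (by positivity)
    have h2 : r / 2 * (u / r) = u / 2 := by field_simp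
    rw [h2] at h1
    rw [norm_mul, Complex.norm_real, Real.norm_of_nonneg (by positivity)]
    have hm : b / (2 * k * r) ≤ b / (2 * k) := by
      apply div_le_div_of_nonneg_left hb.le (by positivity); nlinarith
    calc _ ≤ (u ^ (s - 1) * Real.exp (-(1 * u))) *
          (max 1 (b / (2 * k)) ^ b * Real.exp (u / 2)) := by
          gcongr
          refine h1.trans ?_
          gcongr
      _ = max 1 (b / (2 * k)) ^ b *
        (u ^ (s - 1) * (Real.exp (-(1 * u)) * Real.exp (u / 2))) := by ring
      _ = _ := by rw [← Real.exp_add]; congr 3; ring_nf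
  · refine Eventually.of_forall fun u => ?_
    have h1 : Tendsto (fun r : ℝ => hankelWeight k (b - 1) (u / r)) atTop
        (𝓝 (hankelWeight k (b - 1) 0)) :=
      ((continuous_hankelWeight k (b - 1)).tendsto 0).comp
        (tendsto_const_nhds.div_atTop tendsto_id)
    have h2 : hankelWeight k (b - 1) 0 = 1 := by simp [hankelWeight]
    rw [h2] at h1
    simpa using h1.const_mul (((u ^ (s - 1) * Real.exp (-(1 * u)) : ℝ) : ℂ))

/-- A pair `(h, h')` solving `h'' + (k² - b(b-1)/r²) h = 0` on `(0, ∞)`, with `h ~ e^{ikr}` at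
infinity. -/
structure IsOutgoing (k b : ℝ) (h h' : ℝ → ℂ) : Prop where
  hasDerivAt : ∀ r, 0 < r → HasDerivAt h (h' r) r
  hasDerivAt' : ∀ r, 0 < r →
    HasDerivAt h' (-(((k ^ 2 - b * (b - 1) / r ^ 2 : ℝ) : ℂ) * h r)) r
  tendsto : Tendsto (fun r : ℝ => Complex.exp (-(Complex.I * k * r)) * h r) atTop (𝓝 1)
  tendsto' : Tendsto (fun r : ℝ => h' r - Complex.I * k * h r) atTop (𝓝 0)

lemma norm_exp_I_mul_mul (k r : ℝ) : ‖Complex.exp (Complex.I * k * r)‖ = 1 := by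
  rw [show Complex.I * (k : ℂ) * r = ((k * r : ℝ) : ℂ) * Complex.I by push_cast; ring]
  exact Complex.norm_exp_ofReal_mul_I _

lemma hasDerivAt_exp_I_mul_mul (k r : ℝ) :
    HasDerivAt (fun r : ℝ => Complex.exp (Complex.I * k * r))
      (Complex.I * k * Complex.exp (Complex.I * k * r)) r := by
  have h : HasDerivAt (fun r : ℝ => Complex.I * (k : ℂ) * (r : ℂ)) (Complex.I * k * 1) r :=
    ((hasDerivAt_id r).ofReal_comp).const_mul _
  refine h.cexp.congr_deriv ?_
  ring

/-- The outgoing radial solution, a multiple of `√r H_{b - 1/2}(k r)`. -/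
noncomputable def outgoing (k b r : ℝ) : ℂ :=
  Complex.exp (Complex.I * k * r) * (((r ^ b : ℝ) : ℂ) * hankelLaplace k (b - 1) b r) /
    (Real.Gamma b : ℂ)

/-- The normalising factor `Γ(b)` cancels the Gamma integral exactly, so no Stirling estimate is
needed and the bound is uniform in `b`. The `2` comes from the halved exponential rate. -/
lemma norm_outgoing_le {k b r : ℝ} (hk : 0 < k) (hb : 0 < b) (hr : 0 < r) :
    ‖outgoing k b r‖ ≤ (2 * max 1 (b / (2 * k * r))) ^ b := by
  have hG : 0 < Real.Gamma b := Real.Gamma_pos_of_pos hb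
  rw [outgoing, norm_div, norm_mul, norm_exp_I_mul_mul, one_mul, norm_mul, Complex.norm_real,
    Complex.norm_real, Real.norm_of_nonneg hG.le, Real.norm_of_nonneg (by positivity),
    div_le_iff₀ hG]
  calc r ^ b * ‖hankelLaplace k (b - 1) b r‖
      ≤ r ^ b * (max 1 (b / (2 * k * r)) ^ b * ((1 / (r / 2)) ^ b * Real.Gamma b)) := by
        gcongr; exact norm_hankelLaplace_le hk hb hb hr
    _ = (r * (1 / (r / 2))) ^ b * max 1 (b / (2 * k * r)) ^ b * Real.Gamma b := by
        rw [Real.mul_rpow hr.le (by positivity)]; ring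
    _ = _ := by
        rw [Real.mul_rpow two_pos.le (by positivity)]
        congr 3
        field_simp

lemma hasDerivAt_ofReal_rpow {b r : ℝ} (hr : 0 < r) :
    HasDerivAt (fun r : ℝ => ((r ^ b : ℝ) : ℂ)) ((b * r ^ (b - 1) : ℝ) : ℂ) r :=
  (Real.hasDerivAt_rpow_const (Or.inl hr.ne')).ofReal_comp

lemma isOutgoing_outgoing {k b : ℝ} (hk : 0 < k) (hb : 0 < b) :
    IsOutgoing k b (outgoing k b) (fun r => Complex.I * k * outgoing k b r +
      Complex.exp (Complex.I * k * r) *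
        (((b * r ^ (b - 1) : ℝ) : ℂ) * hankelLaplace k (b - 1) b r -
          ((r ^ b : ℝ) : ℂ) * hankelLaplace k (b - 1) (b + 1) r) / (Real.Gamma b : ℂ)) := by
  have hG : 0 < Real.Gamma b := Real.Gamma_pos_of_pos hb
  have hGc : (Real.Gamma b : ℂ) ≠ 0 := by exact_mod_cast hG.ne'
  have hd : ∀ r, 0 < r → HasDerivAt (outgoing k b) (Complex.I * k * outgoing k b r +
      Complex.exp (Complex.I * k * r) *
        (((b * r ^ (b - 1) : ℝ) : ℂ) * hankelLaplace k (b - 1) b r -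
          ((r ^ b : ℝ) : ℂ) * hankelLaplace k (b - 1) (b + 1) r) / (Real.Gamma b : ℂ)) r := by
    intro r hr
    refine (((hasDerivAt_exp_I_mul_mul k r).mul ((hasDerivAt_ofReal_rpow (b := b) hr).mul
      (hasDerivAt_hankelLaplace hk hb hb hr))).div_const _).congr_deriv ?_
    rw [outgoing, Pi.mul_apply]
    ring
  have hpow : ∀ r : ℝ, 0 < r → r ^ b = r ^ (b - 1) * r := fun r hr => by
    rw [← Real.rpow_add_one hr.ne']; congr 1; ring
  refine ⟨hd, ?_, ?_, ?_⟩
  · intro r hr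
    have h1 := hasDerivAt_hankelLaplace hk hb hb hr
    have h2 := hasDerivAt_hankelLaplace (s := b + 1) hk hb (by linarith) hr
    have h3 : HasDerivAt (fun r : ℝ => ((b * r ^ (b - 1) : ℝ) : ℂ))
        ((b * ((b - 1) * r ^ (b - 1 - 1)) : ℝ) : ℂ) r :=
      ((Real.hasDerivAt_rpow_const (Or.inl hr.ne')).const_mul b).ofReal_comp
    have h4 := ((hd r hr).const_mul (Complex.I * k)).add
      (((hasDerivAt_exp_I_mul_mul k r).mul ((h3.mul h1).sub
        ((hasDerivAt_ofReal_rpow (b := b) hr).mul h2))).div_const (Real.Gamma b : ℂ))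
    refine h4.congr_deriv ?_
    -- After removal of the common factor `e^{ikr} r^(b-2) / Γ(b)`, the radial equation is this
    -- recurrence multiplied by `-ir`, together with `i² = -1`.
    have hrec := hankelLaplace_recurrence hk hb hr
    have e1 : b + 1 + 1 = b + 2 := by ring
    have e2 : r ^ (b - 1) = r ^ (b - 1 - 1) * r := by
      rw [← Real.rpow_add_one hr.ne']; congr 1; ring
    simp only [outgoing, Pi.mul_apply, Pi.sub_apply, hpow r hr, e2, e1]
    have hkc : (k : ℂ) ≠ 0 := by exact_mod_cast hk.ne'
    have hrc : (r : ℂ) ≠ 0 := by exact_mod_cast hr.ne'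
    field_simp at hrec
    have hw : (r : ℂ) ^ 2 * ((r : ℂ) ^ 2)⁻¹ = 1 := mul_inv_cancel₀ (pow_ne_zero 2 hrc)
    push_cast
    simp only [div_eq_mul_inv]
    generalize ((r : ℂ) ^ 2)⁻¹ = w at hw
    generalize (Real.Gamma b : ℂ)⁻¹ = g
    generalize Complex.exp (Complex.I * k * r) = E
    generalize ((r ^ (b - 1 - 1) : ℝ) : ℂ) = c
    generalize hankelLaplace k (b - 1) b r = K0 at *
    generalize hankelLaplace k (b - 1) (b + 1) r = K1 at *
    generalize hankelLaplace k (b - 1) (b + 2) r = K2 at *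
    have hI : Complex.I ^ 2 = -1 := Complex.I_sq
    linear_combination (E * g * c * (-Complex.I * r)) * hrec +
      E * g * c * (k ^ 2 * r ^ 2 * K0 + r ^ 2 * K2 - 2 * b * r * K1) * hI -
      E * g * c * (b * (b - 1) * K0) * hw
  · have h1 := (tendsto_hankelLaplace hk hb hb).div_const (Real.Gamma b : ℂ)
    rw [div_self hGc] at h1
    refine h1.congr fun r => ?_
    rw [outgoing, mul_div_assoc, mul_div_assoc, ← mul_assoc, ← Complex.exp_add]
    simp [mul_div_assoc]
  · have h1 := tendsto_hankelLaplace hk hb hb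
    have h2 := tendsto_hankelLaplace (s := b + 1) hk hb (by linarith)
    have h3 := ((((h1.const_mul (b : ℂ)).sub h2).div_const (Real.Gamma b : ℂ)).norm).mul
      tendsto_inv_atTop_zero
    rw [mul_zero] at h3
    refine squeeze_zero_norm' ?_ h3
    filter_upwards [eventually_gt_atTop 0] with r hr
    rw [add_sub_cancel_left, norm_div, norm_mul, norm_exp_I_mul_mul, one_mul, norm_div]
    have e : ((b * r ^ (b - 1) : ℝ) : ℂ) * hankelLaplace k (b - 1) b r -
          ((r ^ b : ℝ) : ℂ) * hankelLaplace k (b - 1) (b + 1) r =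
        ((b : ℂ) * (((r ^ b : ℝ) : ℂ) * hankelLaplace k (b - 1) b r) -
          ((r ^ (b + 1) : ℝ) : ℂ) * hankelLaplace k (b - 1) (b + 1) r) * ((r⁻¹ : ℝ) : ℂ) := by
      have hrc : (r : ℂ) ≠ 0 := by exact_mod_cast hr.ne'
      rw [Real.rpow_add_one hr.ne', hpow r hr]
      push_cast
      field_simp
    rw [e, norm_mul, Complex.norm_real, Real.norm_of_nonneg (by positivity)]
    apply le_of_eq; ring

/-! ### Decay of the radial solutions below the turning point -/

/-- A `C²` function that satisfies `D'' < 0` wherever it is negative is nonnegative on an interval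
if it is nonnegative at the end points. -/
lemma nonneg_of_second_deriv_neg {a b : ℝ} {D D' D'' : ℝ → ℝ}
    (h1 : ∀ x ∈ Icc a b, HasDerivAt D (D' x) x) (h2 : ∀ x ∈ Ioo a b, HasDerivAt D' (D'' x) x)
    (ha : 0 ≤ D a) (hb : 0 ≤ D b) (hneg : ∀ x ∈ Ioo a b, D x < 0 → D'' x < 0) :
    ∀ x ∈ Icc a b, 0 ≤ D x := by
  intro x hx
  by_contra! hlt
  obtain ⟨y, hy, hmin⟩ := isCompact_Icc.exists_isMinOn ⟨x, hx⟩
    (fun z hz => (h1 z hz).continuousAt.continuousWithinAt)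
  have hDy : D y < 0 := (hmin hx).trans_lt hlt
  have hya : y ≠ a := by rintro rfl; linarith
  have hyb : y ≠ b := by rintro rfl; linarith
  have hyI : y ∈ Ioo a b := ⟨lt_of_le_of_ne hy.1 hya.symm, lt_of_le_of_ne hy.2 hyb⟩
  have hloc : IsLocalMin D y := hmin.isLocalMin (Icc_mem_nhds hyI.1 hyI.2)
  have hD'y : D' y = 0 := hloc.hasDerivAt_eq_zero (h1 y hy)
  have hev : deriv D =ᶠ[𝓝 y] D' := by
    filter_upwards [Ioo_mem_nhds hyI.1 hyI.2] with z hz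
    exact (h1 z (Ioo_subset_Icc_self hz)).deriv
  have hdd : deriv (deriv D) y = D'' y := hev.deriv_eq.trans (h2 y hyI).deriv
  have hmax : IsLocalMax D y := isLocalMax_of_deriv_deriv_neg
    (hdd ▸ hneg y hyI hDy) (by rw [hev.eq_of_nhds, hD'y]) (h1 y hy).continuousAt
  -- At an interior negative minimum the second derivative test also yields a local maximum, so `D`
  -- is locally constant there and `D'' = 0`, a contradiction.
  have hconst : D =ᶠ[𝓝 y] fun _ => D y := by
    filter_upwards [hloc, hmax] with z hz1 hz2 using le_antisymm hz2 hz1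
  have h0 : deriv (deriv D) y = 0 := by
    have := hconst.deriv.deriv_eq
    simpa using this
  linarith [hneg y hyI hDy, hdd ▸ h0]

lemma IsOutgoing.hasDerivAt_norm_sq {k b : ℝ} {h h' : ℝ → ℂ} (H : IsOutgoing k b h h') {r : ℝ}
    (hr : 0 < r) : HasDerivAt (fun r => ‖h r‖ ^ 2) (2 * inner ℝ (h r) (h' r)) r :=
  (H.hasDerivAt r hr).norm_sq

lemma IsOutgoing.hasDerivAt_inner {k b : ℝ} {h h' : ℝ → ℂ} (H : IsOutgoing k b h h') {r : ℝ}
    (hr : 0 < r) : HasDerivAt (fun r => 2 * inner ℝ (h r) (h' r))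
      (2 * ‖h' r‖ ^ 2 - 2 * (k ^ 2 - b * (b - 1) / r ^ 2) * ‖h r‖ ^ 2) r := by
  refine (((H.hasDerivAt r hr).inner ℝ (H.hasDerivAt' r hr)).const_mul 2).congr_deriv ?_
  rw [← neg_mul, ← Complex.ofReal_neg, ← Complex.real_smul, inner_smul_right,
    real_inner_self_eq_norm_sq, real_inner_self_eq_norm_sq]
  ring

/-- Maximum principle for `P = |h|²`, which satisfies `x² P'' ≥ 2 (b(b-1) - (kx)²) P`. Where `2kx ≤
b` and `b ≥ 6`, the coefficient is at least `3b²/2 - 2b ≥ b(b+1)`. The barrier is a decaying power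
`x^(-b)`, for which `x² y'' = b(b+1) y`, plus a growing power `x^b`, for which `x² y'' = b(b-1) y`;
each matches `P` at one end of the interval. -/
lemma IsOutgoing.norm_sq_le {k b : ℝ} {h h' : ℝ → ℂ} (H : IsOutgoing k b h h') (hb : 6 ≤ b)
    {r s t : ℝ} (hk : 0 < k) (hr : 0 < r) (hrs : r ≤ s) (hst : s ≤ t) (ht : 2 * k * t ≤ b) :
    ‖h s‖ ^ 2 ≤ ‖h r‖ ^ 2 * (s / r) ^ (-b) + ‖h t‖ ^ 2 * (s / t) ^ b := by
  have hs : 0 < s := by linarith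
  have ht0 : 0 < t := by linarith
  have hpow : ∀ (c p x : ℝ), 0 < c → 0 < x →
      HasDerivAt (fun x : ℝ => (x / c) ^ p) (p * (x / c) ^ p / x) x := by
    intro c p x hc hx
    have h1 := ((hasDerivAt_id x).div_const c).rpow_const (p := p)
      (Or.inl (div_pos hx hc).ne')
    refine h1.congr_deriv ?_
    have e : (x / c) ^ p = (x / c) ^ (p - 1) * (x / c) := by
      rw [← Real.rpow_add_one (div_pos hx hc).ne']; congr 1; ring
    simp only [id, e]
    field_simp
  have hpow2 : ∀ (c p x : ℝ), 0 < c → 0 < x →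
      HasDerivAt (fun x : ℝ => p * (x / c) ^ p / x) (p * (p - 1) * (x / c) ^ p / x ^ 2) x := by
    intro c p x hc hx
    refine (((hpow c p x hc hx).const_mul p).div (hasDerivAt_id x) hx.ne').congr_deriv ?_
    simp only [id]
    field_simp
  have key := nonneg_of_second_deriv_neg (a := r) (b := t)
    (D := fun x => ‖h r‖ ^ 2 * (x / r) ^ (-b) + ‖h t‖ ^ 2 * (x / t) ^ b - ‖h x‖ ^ 2)
    (D' := fun x => ‖h r‖ ^ 2 * (-b * (x / r) ^ (-b) / x) + ‖h t‖ ^ 2 * (b * (x / t) ^ b / x)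
      - 2 * inner ℝ (h x) (h' x))
    (D'' := fun x => ‖h r‖ ^ 2 * (-b * (-b - 1) * (x / r) ^ (-b) / x ^ 2)
      + ‖h t‖ ^ 2 * (b * (b - 1) * (x / t) ^ b / x ^ 2)
      - (2 * ‖h' x‖ ^ 2 - 2 * (k ^ 2 - b * (b - 1) / x ^ 2) * ‖h x‖ ^ 2))
    ?_ ?_ ?_ ?_ ?_ s ⟨hrs, hst⟩
  · linarith
  · intro x hx
    have hx0 : 0 < x := hr.trans_le hx.1
    exact (((hpow r (-b) x hr hx0).const_mul _).add ((hpow t b x ht0 hx0).const_mul _)).sub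
      (H.hasDerivAt_norm_sq hx0)
  · intro x hx
    have hx0 : 0 < x := hr.trans hx.1
    exact (((hpow2 r (-b) x hr hx0).const_mul _).add ((hpow2 t b x ht0 hx0).const_mul _)).sub
      (H.hasDerivAt_inner hx0)
  · simp only [div_self hr.ne', Real.one_rpow]
    have : 0 ≤ ‖h t‖ ^ 2 * (r / t) ^ b := by positivity
    linarith
  · simp only [div_self ht0.ne', Real.one_rpow]
    have : 0 ≤ ‖h r‖ ^ 2 * (t / r) ^ (-b) := by positivity
    linarith
  · intro x hx hneg
    have hx0 : 0 < x := hr.trans hx.1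
    have hA : 0 ≤ ‖h r‖ ^ 2 * (x / r) ^ (-b) := by positivity
    have hB : 0 ≤ ‖h t‖ ^ 2 * (x / t) ^ b := by positivity
    set A := ‖h r‖ ^ 2 * (x / r) ^ (-b) with hAd
    set B := ‖h t‖ ^ 2 * (x / t) ^ b with hBd
    set P := ‖h x‖ ^ 2 with hP
    have e : ‖h r‖ ^ 2 * (-b * (-b - 1) * (x / r) ^ (-b) / x ^ 2)
      + ‖h t‖ ^ 2 * (b * (b - 1) * (x / t) ^ b / x ^ 2)
      - (2 * ‖h' x‖ ^ 2 - 2 * (k ^ 2 - b * (b - 1) / x ^ 2) * P) =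
      (b * (b + 1) * A + b * (b - 1) * B - 2 * (b * (b - 1) - (k * x) ^ 2) * P) / x ^ 2
        - 2 * ‖h' x‖ ^ 2 := by
      rw [hAd, hBd]
      field_simp
      ring
    rw [e]
    have hkx : k * x ≤ b / 2 := by nlinarith [hx.2]
    have hkx2 : (k * x) ^ 2 ≤ (b / 2) ^ 2 := pow_le_pow_left₀ (by positivity) hkx 2
    -- This is where `6 ≤ b` is used: `b²/2 ≥ 3b`.
    have hcoef : b * (b + 1) ≤ 2 * (b * (b - 1) - (k * x) ^ 2) := by nlinarith
    have hP0 : 0 ≤ P := by positivity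
    have hnum : b * (b + 1) * A + b * (b - 1) * B - 2 * (b * (b - 1) - (k * x) ^ 2) * P < 0 := by
      have h1 : b * (b + 1) * P ≤ 2 * (b * (b - 1) - (k * x) ^ 2) * P :=
        mul_le_mul_of_nonneg_right hcoef hP0
      have h2 : b * (b + 1) * (A + B - P) < 0 :=
        mul_neg_of_pos_of_neg (by positivity) hneg
      nlinarith
    have h3 := div_neg_of_neg_of_pos hnum (by positivity : 0 < x ^ 2)
    have h4 : 0 ≤ 2 * ‖h' x‖ ^ 2 := by positivity
    linarith

/-! ### The Wronskian and smoothness of the radial solutions -/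

/-- `f ~ c e^{ikr}` and `f' - i k f → 0` at infinity. -/
structure RadiatesTo (k : ℝ) (f f' : ℝ → ℂ) (c : ℂ) : Prop where
  tendsto : Tendsto (fun r : ℝ => Complex.exp (-(Complex.I * k * r)) * f r) atTop (𝓝 c)
  tendsto' : Tendsto (fun r : ℝ => f' r - Complex.I * k * f r) atTop (𝓝 0)

lemma IsOutgoing.radiatesTo {k b : ℝ} {h h' : ℝ → ℂ} (H : IsOutgoing k b h h') :
    RadiatesTo k h h' 1 := ⟨H.tendsto, H.tendsto'⟩

lemma norm_exp_neg_I_mul_mul (k r : ℝ) : ‖Complex.exp (-(Complex.I * k * r))‖ = 1 := by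
  rw [Complex.exp_neg, norm_inv, norm_exp_I_mul_mul, inv_one]

lemma exp_neg_mul_conj (k r : ℝ) : Complex.exp (-(Complex.I * k * r)) *
    starRingEnd ℂ (Complex.exp (-(Complex.I * k * r))) = 1 := by
  rw [Complex.mul_conj, Complex.normSq_eq_norm_sq, norm_exp_neg_I_mul_mul]; simp

lemma RadiatesTo.isBoundedUnder {k : ℝ} {f f' : ℝ → ℂ} {c : ℂ} (hf : RadiatesTo k f f' c) :
    IsBoundedUnder (· ≤ ·) atTop (fun r => ‖f r‖) := by
  have h := hf.tendsto.norm.isBoundedUnder_le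
  simpa [norm_mul, norm_exp_neg_I_mul_mul] using h

/-- Replacing `g'` by `g' - ikg` and `f'` by `f' - ikf` does not change `f g' - f' g`, and these
differences tend to `0` against bounded factors. -/
lemma RadiatesTo.tendsto_wronskian {k : ℝ} {f f' g g' : ℝ → ℂ} {c d : ℂ}
    (hf : RadiatesTo k f f' c) (hg : RadiatesTo k g g' d) :
    Tendsto (fun r => f r * g' r - f' r * g r) atTop (𝓝 0) := by
  have h1 := hg.tendsto'.zero_mul_isBoundedUnder_le hf.isBoundedUnder
  have h2 := hf.tendsto'.zero_mul_isBoundedUnder_le hg.isBoundedUnder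
  have h3 := h1.sub h2
  rw [sub_zero] at h3
  refine h3.congr fun r => ?_
  ring

/-- Here the two terms containing `ik` add up instead of cancelling and leave `-2ik f \bar g`, whose
limit records the product of the amplitudes. -/
lemma RadiatesTo.tendsto_wronskian_conj {k : ℝ} {f f' g g' : ℝ → ℂ} {c d : ℂ}
    (hf : RadiatesTo k f f' c) (hg : RadiatesTo k g g' d) :
    Tendsto (fun r => f r * starRingEnd ℂ (g' r) - f' r * starRingEnd ℂ (g r)) atTop
      (𝓝 (-2 * Complex.I * k * (c * starRingEnd ℂ d))) := by
  have hc := fun {u : ℝ → ℂ} {z : ℂ} (hu : Tendsto u atTop (𝓝 z)) =>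
    (Complex.continuous_conj.tendsto z).comp hu
  have h0 := hc hg.tendsto'
  rw [map_zero] at h0
  have h1 := h0.zero_mul_isBoundedUnder_le hf.isBoundedUnder
  have hgb : IsBoundedUnder (· ≤ ·) atTop (fun r => ‖starRingEnd ℂ (g r)‖) := by
    simpa using hg.isBoundedUnder
  have h2 := hf.tendsto'.zero_mul_isBoundedUnder_le hgb
  have h3 := (h1.sub h2).add ((hf.tendsto.mul (hc hg.tendsto)).const_mul (-2 * Complex.I * k))
  rw [sub_zero, zero_add] at h3
  refine h3.congr fun r => ?_
  have he := exp_neg_mul_conj k r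
  simp only [Function.comp, map_mul, map_sub, Complex.conj_I, Complex.conj_ofReal] at he ⊢
  linear_combination (-2 * Complex.I * k * f r * starRingEnd ℂ (g r)) * he

lemma hasDerivAt_conj {f : ℝ → ℂ} {f' : ℂ} {x : ℝ} (hf : HasDerivAt f f' x) :
    HasDerivAt (fun x => starRingEnd ℂ (f x)) (starRingEnd ℂ f') x := hf.star

/-- Constancy follows from the equation having a real potential; the value is read off at infinity.
Since it is nonzero, `h` and its conjugate are independent solutions. -/
lemma IsOutgoing.wronskian {k b : ℝ} {h h' : ℝ → ℂ} (H : IsOutgoing k b h h') {r : ℝ}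
    (hr : 0 < r) :
    h r * starRingEnd ℂ (h' r) - h' r * starRingEnd ℂ (h r) = -2 * Complex.I * k := by
  set W : ℝ → ℂ := fun r => h r * starRingEnd ℂ (h' r) - h' r * starRingEnd ℂ (h r) with hW
  have hder : ∀ x ∈ Ioi (0 : ℝ), HasDerivAt W 0 x := by
    intro x hx
    have h1 := H.hasDerivAt x hx
    have h2 := H.hasDerivAt' x hx
    refine ((h1.mul (hasDerivAt_conj h2)).sub (h2.mul (hasDerivAt_conj h1))).congr_deriv ?_
    simp only [map_neg, map_mul, Complex.conj_ofReal]
    ring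
  have hconst : ∀ x ∈ Ioi (0 : ℝ), W x = W r := fun x hx =>
    isOpen_Ioi.is_const_of_deriv_eq_zero isPreconnected_Ioi
      (fun y hy => (hder y hy).differentiableAt.differentiableWithinAt)
      (fun y hy => (hder y hy).deriv) hx hr
  have hlim := H.radiatesTo.tendsto_wronskian_conj H.radiatesTo
  have hlim2 : Tendsto W atTop (𝓝 (W r)) :=
    tendsto_const_nhds.congr' (by
      filter_upwards [eventually_gt_atTop 0] with x hx using (hconst x hx).symm)
  have := tendsto_nhds_unique hlim2 hlim
  simpa using this

lemma IsOutgoing.contDiffOn {k b : ℝ} {h h' : ℝ → ℂ} (H : IsOutgoing k b h h') :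
    ContDiffOn ℝ ∞ h (Ioi 0) := by
  have key : ∀ n : ℕ, ContDiffOn ℝ n h (Ioi 0) ∧ ContDiffOn ℝ n h' (Ioi 0) := by
    intro n
    induction n with
    | zero =>
      simp only [Nat.cast_zero, contDiffOn_zero]
      exact ⟨fun x hx => (H.hasDerivAt x hx).continuousAt.continuousWithinAt,
        fun x hx => (H.hasDerivAt' x hx).continuousAt.continuousWithinAt⟩
    | succ n ih =>
      have step : ∀ f f' : ℝ → ℂ, (∀ x, 0 < x → HasDerivAt f (f' x) x) →
          ContDiffOn ℝ n f' (Ioi 0) → ContDiffOn ℝ (n + 1 : ℕ) f (Ioi 0) := by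
        intro f f' hf hf'
        push_cast
        rw [contDiffOn_succ_iff_deriv_of_isOpen isOpen_Ioi]
        refine ⟨fun x hx => (hf x hx).differentiableAt.differentiableWithinAt, by simp, ?_⟩
        exact hf'.congr fun x hx => (hf x hx).deriv
      refine ⟨step h h' H.hasDerivAt ih.2, step h' _ H.hasDerivAt' ?_⟩
      refine ContDiffOn.neg (ContDiffOn.mul ?_ ih.1)
      refine Complex.ofRealCLM.contDiff.comp_contDiffOn ?_
      refine contDiffOn_const.sub (contDiffOn_const.div (contDiffOn_id.pow 2) fun x hx => ?_)
      exact pow_ne_zero 2 (ne_of_gt hx)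
  exact contDiffOn_infty.2 fun n => (key n).1

/-! ### Weak formulations in one variable -/

/-- A compact subset of `(R, ∞)` lies in some `[a, b]` with `R < a < b`. -/
lemma exists_Icc_of_isCompact {R : ℝ} {K : Set ℝ} (hK : IsCompact K) (hKR : K ⊆ Ioi R) :
    ∃ a b, R < a ∧ a < b ∧ K ⊆ Icc a b := by
  rcases K.eq_empty_or_nonempty with rfl | hne
  · exact ⟨R + 1, R + 2, by linarith, by linarith, empty_subset _⟩
  · obtain ⟨a, ha⟩ := hK.exists_isLeast hne
    obtain ⟨b, hb⟩ := hK.exists_isGreatest hne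
    refine ⟨a, b + 1, hKR ha.1, ?_, fun x hx => ⟨ha.2 hx, by linarith [hb.2 hx]⟩⟩
    linarith [ha.2 hb.1]

lemma exists_primitive_hasCompactSupport {R : ℝ} {φ : ℝ → ℝ} (hφ : ContDiff ℝ ∞ φ)
    (hc : HasCompactSupport φ) (hR : tsupport φ ⊆ Ioi R) (h0 : ∫ x, φ x = 0) :
    ∃ Φ : ℝ → ℝ, ContDiff ℝ ∞ Φ ∧ HasCompactSupport Φ ∧ tsupport Φ ⊆ Ioi R ∧ deriv Φ = φ := by
  obtain ⟨a, b, hRa, hab, hK⟩ := exists_Icc_of_isCompact hc.isCompact hR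
  -- The base point lies strictly between `R` and the support, so the primitive vanishes to its
  -- left; to its right it vanishes because the total integral is zero.
  set a' := (R + a) / 2
  have ha' : R < a' ∧ a' < a := ⟨by simp only [a']; linarith, by simp only [a']; linarith⟩
  have hzero : ∀ x, x ∉ Icc a b → φ x = 0 := fun x hx =>
    image_eq_zero_of_notMem_tsupport fun h => hx (hK h)
  set Φ : ℝ → ℝ := fun x => ∫ t in a'..x, φ t with hΦ
  have hd : ∀ x, HasDerivAt Φ (φ x) x := fun x =>
    (hφ.continuous.integral_hasStrictDerivAt a' x).hasDerivAt
  have hderiv : deriv Φ = φ := funext fun x => (hd x).deriv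
  have hsub : Function.support Φ ⊆ Icc a b := by
    intro x hx
    by_contra hxI
    apply hx
    rcases lt_or_ge x a with h | h
    · have : ∀ t ∈ uIcc a' x, φ t = 0 := fun t ht => hzero t fun h' => by
        have := ht.2; have h2 : max a' x < a := max_lt ha'.2 h
        linarith [h'.1]
      simp only [hΦ]
      rw [intervalIntegral.integral_congr (g := fun _ => 0) this]; simp
    · have hbx : b < x := by
        by_contra hle; exact hxI ⟨h, not_lt.1 hle⟩
      simp only [hΦ]
      rw [intervalIntegral.integral_eq_integral_of_support_subset, h0]
      intro t ht
      have : t ∈ Icc a b := by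
        by_contra hnot; exact ht (hzero t hnot)
      exact ⟨by linarith [this.1], by linarith [this.2]⟩
  have hts : tsupport Φ ⊆ Icc a b := closure_minimal hsub isClosed_Icc
  refine ⟨Φ, ?_, ?_, fun x hx => hRa.trans_le (hts hx).1, hderiv⟩
  · rw [contDiff_infty_iff_deriv, hderiv]
    exact ⟨fun x => (hd x).differentiableAt, hφ⟩
  · exact HasCompactSupport.of_support_subset_isCompact isCompact_Icc hsub

lemma integrable_smul_of_tsupport {E : Type*} [NormedAddCommGroup E] [NormedSpace ℝ E]
    {U : Set ℝ} (hU : IsOpen U) {W : ℝ → E} (hW : ContinuousOn W U) {η : ℝ → ℝ}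
    (hη : Continuous η) (hc : HasCompactSupport η) (hs : tsupport η ⊆ U) :
    Integrable (fun x => η x • W x) := by
  have hts : tsupport (fun x => η x • W x) ⊆ tsupport η :=
    closure_mono (Function.support_smul_subset_left η W)
  refine Continuous.integrable_of_hasCompactSupport ?_ (hc.mono
    (Function.support_smul_subset_left η W))
  exact (hη.continuousOn.smul hW).continuous_of_tsupport_subset hU (hts.trans hs)

/-- The du Bois-Reymond lemma on a half line. -/
lemma exists_const_of_integral_deriv_smul_eq_zero {R : ℝ} {W : ℝ → ℂ}
    (hW : ContinuousOn W (Ioi R))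
    (h : ∀ η : ℝ → ℝ, ContDiff ℝ ∞ η → HasCompactSupport η → tsupport η ⊆ Ioi R →
      ∫ x, deriv η x • W x = 0) :
    ∃ c, ∀ x, R < x → W x = c := by
  -- A fixed bump `β` of integral one: `η - (∫ η) β` has integral zero, hence is the derivative of a
  -- test function. The constant is then `∫ β W`.
  let f : ContDiffBump (R + 2) := ⟨1 / 2, 1, by norm_num, by norm_num⟩
  set β : ℝ → ℝ := f.normed volume with hβ
  have hβs : tsupport β ⊆ Ioi R := by
    rw [hβ, f.tsupport_normed_eq]
    intro x hx
    rw [Metric.mem_closedBall, Real.dist_eq] at hx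
    have := (abs_le.1 hx).1
    have h1 : f.rOut = 1 := rfl
    rw [h1] at this
    simp only [mem_Ioi]; linarith
  have hβc : HasCompactSupport β := f.hasCompactSupport_normed
  have hβd : ContDiff ℝ ∞ β := f.contDiff_normed
  have hβi := integrable_smul_of_tsupport isOpen_Ioi hW hβd.continuous hβc hβs
  set c := ∫ x, β x • W x with hc
  refine ⟨c, ?_⟩
  have hae : ∀ᵐ x, x ∈ Ioi R → W x - c = 0 := by
    refine isOpen_Ioi.ae_eq_zero_of_integral_contDiff_smul_eq_zero
      ((hW.sub continuousOn_const).locallyIntegrableOn measurableSet_Ioi) ?_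
    intro η hη hηc hηs
    have hηi := integrable_smul_of_tsupport isOpen_Ioi hW hη.continuous hηc hηs
    set m := ∫ x, η x
    have hηI : Integrable η := hη.continuous.integrable_of_hasCompactSupport hηc
    have hβI : Integrable β := hβd.continuous.integrable_of_hasCompactSupport hβc
    obtain ⟨Φ, hΦ, hΦc, hΦs, hΦd⟩ := exists_primitive_hasCompactSupport (R := R)
      (φ := fun x => η x - m * β x) (hη.sub (contDiff_const.mul hβd))
      (hηc.sub (hβc.mul_left)) ((tsupport_sub _ _).trans
        (union_subset hηs ((tsupport_mul_subset_right).trans hβs))) (by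
        rw [integral_sub hηI (hβI.const_mul m), integral_const_mul, hβ, f.integral_normed]
        simp [m])
    have hz := h Φ hΦ hΦc hΦs
    rw [hΦd] at hz
    have e1 : ∫ x, (η x - m * β x) • W x = (∫ x, η x • W x) - m • c := by
      have hβm : Integrable (fun x => m • (β x • W x)) := hβi.smul m
      rw [hc, ← integral_smul, ← integral_sub hηi hβm]
      refine integral_congr_ae (Eventually.of_forall fun x => ?_)
      simp only [sub_smul, mul_smul]
    have e2 : ∫ x, η x • (W x - c) = (∫ x, η x • W x) - m • c := by
      rw [← integral_smul_const, ← integral_sub hηi (hηI.smul_const c)]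
      refine integral_congr_ae (Eventually.of_forall fun x => ?_)
      simp only [smul_sub]
    rw [e2, ← e1, hz]
  have heq : W =ᵐ[volume.restrict (Ioi R)] fun _ => c := by
    rw [EventuallyEq, ae_restrict_iff' measurableSet_Ioi]
    filter_upwards [hae] with x hx hxR using sub_eq_zero.1 (hx hxR)
  exact fun x hx => Measure.eqOn_open_of_ae_eq heq isOpen_Ioi hW continuousOn_const hx

/-- `G'' + q G = 0` on `(R, ∞)` in the sense of distributions. -/
def IsWeakODESolution (q : ℝ → ℝ) (R : ℝ) (G : ℝ → ℂ) : Prop :=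
  ∀ u : ℝ → ℂ, ContDiff ℝ ∞ u → HasCompactSupport u → tsupport u ⊆ Ioi R →
    ∫ r, G r * (deriv (deriv u) r + (q r : ℂ) * u r) = 0

/-- `G` is only `C¹` and solves its equation weakly, so the Wronskian cannot be differentiated
directly. Testing with `u = η h` shows that its distributional derivative vanishes, and the du
Bois-Reymond lemma applies. This avoids any regularity theory for `G`. -/
lemma exists_wronskian_eq_const {q : ℝ → ℝ} {R : ℝ} {G G' h h' : ℝ → ℂ}
    (hweak : IsWeakODESolution q R G) (hG : ∀ r, R < r → HasDerivAt G (G' r) r)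
    (hG' : ContinuousOn G' (Ioi R)) (hh : ∀ r, R < r → HasDerivAt h (h' r) r)
    (hh' : ∀ r, R < r → HasDerivAt h' (-((q r : ℂ) * h r)) r)
    (hsm : ContDiffOn ℝ ∞ h (Ioi R)) :
    ∃ c, ∀ r, R < r → G r * h' r - G' r * h r = c := by
  have cG : ContinuousOn G (Ioi R) := fun x hx => (hG x hx).continuousAt.continuousWithinAt
  have ch : ContinuousOn h (Ioi R) := fun x hx => (hh x hx).continuousAt.continuousWithinAt
  have ch' : ContinuousOn h' (Ioi R) := fun x hx => (hh' x hx).continuousAt.continuousWithinAt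
  refine exists_const_of_integral_deriv_smul_eq_zero ((cG.mul ch').sub (hG'.mul ch)) ?_
  intro η hη hηc hηs
  have hη1 : ContDiff ℝ ∞ (deriv η) := (contDiff_infty_iff_deriv.1 hη).2
  have hη2 : ContDiff ℝ ∞ (deriv (deriv η)) := (contDiff_infty_iff_deriv.1 hη1).2
  have hc1 : HasCompactSupport (deriv η) := hηc.deriv
  have hs1 : tsupport (deriv η) ⊆ Ioi R := Subset.trans tsupport_deriv_subset hηs
  have hc2 : HasCompactSupport (deriv (deriv η)) := hc1.deriv
  have hs2 : tsupport (deriv (deriv η)) ⊆ Ioi R := Subset.trans tsupport_deriv_subset hs1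
  set u : ℝ → ℂ := fun x => η x • h x with hu
  have hus : tsupport u ⊆ tsupport η := closure_mono (Function.support_smul_subset_left η h)
  have hd0 : ∀ x, HasDerivAt η (deriv η x) x := fun x =>
    (hη.differentiable (by simp) x).hasDerivAt
  have hd1 : ∀ x, HasDerivAt (deriv η) (deriv (deriv η) x) x := fun x =>
    (hη1.differentiable (by simp) x).hasDerivAt
  have hu1 : ∀ x, R < x → HasDerivAt u (η x • h' x + deriv η x • h x) x := fun x hx =>
    (hd0 x).smul (hh x hx)
  have hu2 : ∀ x, R < x → deriv (deriv u) x =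
      (η x • (-((q x : ℂ) * h x)) + deriv η x • h' x) +
        (deriv η x • h' x + deriv (deriv η) x • h x) := by
    intro x hx
    have hev : deriv u =ᶠ[𝓝 x] fun x => η x • h' x + deriv η x • h x := by
      filter_upwards [Ioi_mem_nhds hx] with y hy using (hu1 y hy).deriv
    rw [hev.deriv_eq]
    exact (((hd0 x).smul (hh' x hx)).add ((hd1 x).smul (hh x hx))).deriv
  have husm : ContDiff ℝ ∞ u := by
    refine contDiff_iff_contDiffAt.2 fun x => ?_
    by_cases hx : x ∈ tsupport η
    · exact hη.contDiffAt.smul (hsm.contDiffAt (Ioi_mem_nhds (hηs hx)))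
    · have : u =ᶠ[𝓝 x] fun _ => 0 := by
        filter_upwards [(isClosed_tsupport η).isOpen_compl.mem_nhds hx] with y hy
        simp [hu, image_eq_zero_of_notMem_tsupport hy]
      exact contDiffAt_const.congr_of_eventuallyEq this
  have hz := hweak u husm (hηc.mono (Function.support_smul_subset_left η h)) (hus.trans hηs)
  -- the difference of the two integrands is the derivative of `η' G h`
  set D : ℝ → ℂ := fun x => deriv η x • (G x * h' x + G' x * h x) +
    deriv (deriv η) x • (G x * h x) with hD
  have hDi : Integrable D :=
    (integrable_smul_of_tsupport isOpen_Ioi ((cG.mul ch').add (hG'.mul ch)) hη1.continuous hc1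
      hs1).add (integrable_smul_of_tsupport isOpen_Ioi (cG.mul ch) hη2.continuous hc2 hs2)
  have hD0 : ∫ x, D x = 0 := by
    refine integral_eq_zero_of_hasDerivAt_of_integrable
      (f := fun x => deriv η x • (G x * h x)) (fun x => ?_) hDi
      (integrable_smul_of_tsupport isOpen_Ioi (cG.mul ch) hη1.continuous hc1 hs1)
    by_cases hx : x ∈ tsupport η
    · refine ((hd1 x).smul ((hG x (hηs hx)).mul (hh x (hηs hx)))).congr_deriv ?_
      simp only [hD, Pi.mul_apply]
      congr 2
      ring
    · have hnot1 : x ∉ tsupport (deriv η) := fun h => hx (tsupport_deriv_subset h)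
      have hnot2 : x ∉ tsupport (deriv (deriv η)) := fun h => hnot1 (tsupport_deriv_subset h)
      have hDx : D x = 0 := by
        simp [hD, image_eq_zero_of_notMem_tsupport hnot1, image_eq_zero_of_notMem_tsupport hnot2]
      rw [hDx]
      refine (hasDerivAt_const x (0 : ℂ)).congr_of_eventuallyEq ?_
      filter_upwards [(isClosed_tsupport (deriv η)).isOpen_compl.mem_nhds hnot1] with y hy
      simp [image_eq_zero_of_notMem_tsupport hy]
  have hWi : Integrable (fun x => deriv η x • (G x * h' x - G' x * h x)) :=
    integrable_smul_of_tsupport isOpen_Ioi ((cG.mul ch').sub (hG'.mul ch)) hη1.continuous hc1 hs1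
  have hsum : ∫ x, (deriv η x • (G x * h' x - G' x * h x) + D x) = 0 := by
    rw [← hz]
    refine integral_congr_ae (Eventually.of_forall fun x => ?_)
    by_cases hx : x ∈ tsupport η
    · beta_reduce
      rw [hu2 x (hηs hx)]
      simp only [hD, hu, Complex.real_smul]
      ring
    · have hnot1 : x ∉ tsupport (deriv η) := fun h => hx (tsupport_deriv_subset h)
      have hnot2 : x ∉ tsupport (deriv (deriv η)) := fun h => hnot1 (tsupport_deriv_subset h)
      have hxu : x ∉ tsupport u := fun h => hx (hus h)
      have hxu2 : x ∉ tsupport (deriv (deriv u)) := fun h =>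
        hxu (tsupport_deriv_subset (tsupport_deriv_subset h))
      simp [hD, image_eq_zero_of_notMem_tsupport hnot1, image_eq_zero_of_notMem_tsupport hnot2,
        image_eq_zero_of_notMem_tsupport hxu, image_eq_zero_of_notMem_tsupport hxu2]
  rw [integral_add hWi hDi, hD0, add_zero] at hsum
  exact hsum

/-! ### Polar coordinates -/

section Polar

variable {E : Type*} [NormedAddCommGroup E] [NormedSpace ℝ E] [MeasurableSpace E] [BorelSpace E]
  [FiniteDimensional ℝ E] [Nontrivial E] (μ : Measure E) [μ.IsAddHaarMeasure]

theorem lintegral_polar {f : E → ENNReal} (hf : Measurable f) :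
    ∫⁻ x, f x ∂μ = ∫⁻ r in Ioi (0 : ℝ), ENNReal.ofReal (r ^ (Module.finrank ℝ E - 1)) *
      ∫⁻ θ : Metric.sphere (0 : E) 1, f (r • (θ : E)) ∂μ.toSphere := by
  have hmp := μ.measurePreserving_homeomorphUnitSphereProd
  have hem := (homeomorphUnitSphereProd E).measurableEmbedding
  set g : Metric.sphere (0 : E) 1 × Ioi (0 : ℝ) → ENNReal := fun p => f ((p.2 : ℝ) • (p.1 : E))
    with hg
  have hgm : Measurable g := hf.comp (by fun_prop)
  have h1 : ∫⁻ x, f x ∂μ = ∫⁻ p, g p ∂(μ.toSphere.prod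
      (Measure.volumeIoiPow (Module.finrank ℝ E - 1))) := by
    have hcomp : ∀ x, g (homeomorphUnitSphereProd E x) = f x.1 := by
      intro x
      simp only [hg]
      rw [← homeomorphUnitSphereProd_symm_apply_coe, Homeomorph.symm_apply_apply]
    rw [← hmp.lintegral_comp_emb hem]
    simp only [hcomp]
    rw [lintegral_subtype_comap (measurableSet_singleton _).compl, restrict_compl_singleton]
  rw [h1, lintegral_prod_symm _ hgm.aemeasurable, Measure.volumeIoiPow,
    lintegral_withDensity_eq_lintegral_mul _ (by fun_prop) hgm.lintegral_prod_left',
    ← lintegral_subtype_comap measurableSet_Ioi]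
  rfl

theorem integral_polar {F : Type*} [NormedAddCommGroup F] [NormedSpace ℝ F] {f : E → F}
    (hf : Integrable f μ) :
    ∫ x, f x ∂μ = ∫ r in Ioi (0 : ℝ), r ^ (Module.finrank ℝ E - 1) •
      ∫ θ : Metric.sphere (0 : E) 1, f (r • (θ : E)) ∂μ.toSphere := by
  have hmp := μ.measurePreserving_homeomorphUnitSphereProd
  have hem := (homeomorphUnitSphereProd E).measurableEmbedding
  set g : Metric.sphere (0 : E) 1 × Ioi (0 : ℝ) → F := fun p => f ((p.2 : ℝ) • (p.1 : E))
    with hg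
  have hcomp : g ∘ homeomorphUnitSphereProd E = fun x => f x.1 := by
    funext x
    simp only [hg, Function.comp]
    rw [← homeomorphUnitSphereProd_symm_apply_coe, Homeomorph.symm_apply_apply]
  have hgi : Integrable g (μ.toSphere.prod
      (Measure.volumeIoiPow (Module.finrank ℝ E - 1))) := by
    rw [← hmp.integrable_comp_emb hem, hcomp]
    have : IntegrableOn f ({0}ᶜ : Set E) μ := hf.integrableOn
    rwa [integrableOn_iff_comap_subtypeVal (measurableSet_singleton _).compl] at this
  have h1 : ∫ x, f x ∂μ = ∫ p, g p ∂(μ.toSphere.prod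
      (Measure.volumeIoiPow (Module.finrank ℝ E - 1))) := by
    rw [← hmp.integral_comp hem]
    have : ∀ x, g (homeomorphUnitSphereProd E x) = f x.1 := fun x => congrFun hcomp x
    simp only [this]
    rw [integral_subtype_comap (measurableSet_singleton _).compl,
      restrict_compl_singleton]
  rw [h1, integral_prod_symm _ hgi, Measure.volumeIoiPow]
  simp only [ENNReal.ofReal]
  rw [integral_withDensity_eq_integral_smul (by fun_prop),
    integral_subtype_comap measurableSet_Ioi fun a : ℝ =>
      Real.toNNReal (a ^ (Module.finrank ℝ E - 1)) •
        ∫ θ : Metric.sphere (0 : E) 1, f (a • (θ : E)) ∂μ.toSphere]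
  refine setIntegral_congr_fun measurableSet_Ioi fun x hx => ?_
  rw [NNReal.smul_def, Real.coe_toNNReal _ (pow_nonneg (le_of_lt hx) _)]

end Polar

/-! ### Directional derivatives and the Laplacian -/

variable {n : ℕ}

/-- The directional derivative. -/
noncomputable def dirDeriv (e : Eucl n) (f : Eucl n → ℂ) : Eucl n → ℂ := fun x => fderiv ℝ f x e

/-- The standard basis vectors. -/
noncomputable def basisVec (i : Fin n) : Eucl n := EuclideanSpace.single i 1

lemma contDiff_dirDeriv {e : Eucl n} {f : Eucl n → ℂ} (hf : ContDiff ℝ ∞ f) :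
    ContDiff ℝ ∞ (dirDeriv e f) :=
  (hf.fderiv_right (m := ∞) (by simp)).clm_apply contDiff_const

lemma dirDeriv_add {e : Eucl n} {f g : Eucl n → ℂ} (hf : ContDiff ℝ ∞ f) (hg : ContDiff ℝ ∞ g) :
    dirDeriv e (fun x => f x + g x) = fun x => dirDeriv e f x + dirDeriv e g x := by
  funext x
  simp only [dirDeriv]
  rw [fderiv_fun_add (hf.differentiable (by simp) x) (hg.differentiable (by simp) x)]
  rfl

lemma dirDeriv_mul {e : Eucl n} {f g : Eucl n → ℂ} (hf : ContDiff ℝ ∞ f) (hg : ContDiff ℝ ∞ g) :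
    dirDeriv e (fun x => f x * g x) = fun x => dirDeriv e f x * g x + f x * dirDeriv e g x := by
  funext x
  simp only [dirDeriv]
  rw [fderiv_fun_mul (hf.differentiable (by simp) x) (hg.differentiable (by simp) x)]
  simp only [add_apply, smul_apply, smul_eq_mul]
  ring

lemma dirDeriv_const (e : Eucl n) (c : ℂ) : dirDeriv e (fun _ => c) = fun _ => 0 := by
  funext x; simp [dirDeriv]

lemma dirDeriv_dirDeriv {f : Eucl n → ℂ} (hf : ContDiff ℝ ∞ f) (a b x : Eucl n) :
    dirDeriv a (dirDeriv b f) x = fderiv ℝ (fderiv ℝ f) x a b := by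
  have hd : DifferentiableAt ℝ (fderiv ℝ f) x :=
    (hf.fderiv_right (m := ∞) (by simp)).differentiable (by simp) x
  unfold dirDeriv
  rw [fderiv_clm_apply hd (differentiableAt_const b)]
  simp

lemma dirDeriv_comm {e v : Eucl n} {f : Eucl n → ℂ} (hf : ContDiff ℝ ∞ f) :
    dirDeriv e (dirDeriv v f) = dirDeriv v (dirDeriv e f) := by
  funext x
  rw [dirDeriv_dirDeriv hf, dirDeriv_dirDeriv hf]
  exact (hf.contDiffAt.isSymmSndFDerivAt (by
    simp only [minSmoothness_of_isRCLikeNormedField]; 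
    exact WithTop.coe_le_coe.2 (le_top (a := (2 : ℕ∞))))) e v

lemma laplacian_eq_sum_dirDeriv {f : Eucl n → ℂ} (hf : ContDiff ℝ ∞ f) (x : Eucl n) :
    Laplacian.laplacian f x = ∑ i, dirDeriv (basisVec i) (dirDeriv (basisVec i) f) x := by
  rw [InnerProductSpace.laplacian_eq_iteratedFDeriv_orthonormalBasis f
    (EuclideanSpace.basisFun (Fin n) ℝ)]
  refine Finset.sum_congr rfl fun i _ => ?_
  rw [iteratedFDeriv_two_apply, dirDeriv_dirDeriv hf]
  simp [basisVec]

lemma sum_inner_smul_dirDeriv (f : Eucl n → ℂ) (x y : Eucl n) :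
    ∑ i, ((inner ℝ y (basisVec i) : ℝ) : ℂ) * dirDeriv (basisVec i) f x = dirDeriv y f x := by
  have hy : y = ∑ i, (inner ℝ y (basisVec i) : ℝ) • (basisVec i : Eucl n) := by
    conv_lhs => rw [← (EuclideanSpace.basisFun (Fin n) ℝ).sum_repr' y]
    refine Finset.sum_congr rfl fun i _ => ?_
    rw [real_inner_comm]
    simp [basisVec]
  unfold dirDeriv
  conv_rhs => rw [hy, map_sum]
  refine Finset.sum_congr rfl fun i _ => ?_
  rw [map_smul, Complex.real_smul]

lemma sum_inner_basisVec_sq (x : Eucl n) : ∑ i, (inner ℝ x (basisVec i)) ^ 2 = ‖x‖ ^ 2 := by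
  rw [← (EuclideanSpace.basisFun (Fin n) ℝ).sum_sq_norm_inner_left x]
  refine Finset.sum_congr rfl fun i _ => ?_
  simp [basisVec]

lemma inner_basisVec_self (i : Fin n) : inner ℝ (basisVec i) (basisVec i : Eucl n) = 1 := by
  simp [basisVec]

/-- Radial factors are written as functions of `|x|²` rather than `|x|`, which keeps them smooth at
the origin. -/
lemma contDiff_comp_norm_sq {ψ : ℝ → ℂ} (hψ : ContDiff ℝ ∞ ψ) :
    ContDiff ℝ ∞ (fun x : Eucl n => ψ (‖x‖ ^ 2)) :=
  hψ.comp (contDiff_norm_sq ℝ)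

lemma dirDeriv_comp_norm_sq {ψ : ℝ → ℂ} (hψ : ContDiff ℝ ∞ ψ) (e : Eucl n) :
    dirDeriv e (fun x : Eucl n => ψ (‖x‖ ^ 2)) =
      fun x => (2 * (inner ℝ x e : ℝ) : ℂ) * deriv ψ (‖x‖ ^ 2) := by
  funext x
  have h := (hψ.differentiable (by simp) (‖x‖ ^ 2)).hasDerivAt.hasFDerivAt.comp x
    (hasStrictFDerivAt_norm_sq x).hasFDerivAt
  simp only [dirDeriv]
  have h2 : fderiv ℝ (fun x : Eucl n => ψ (‖x‖ ^ 2)) x = _ := h.fderiv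
  rw [h2]
  simp
  ring

lemma contDiff_inner_coe (e : Eucl n) :
    ContDiff ℝ ∞ (fun x : Eucl n => ((inner ℝ x e : ℝ) : ℂ)) :=
  Complex.ofRealCLM.contDiff.comp (contDiff_id.inner ℝ contDiff_const)

lemma dirDeriv_inner_coe (e v : Eucl n) :
    dirDeriv v (fun x : Eucl n => ((inner ℝ x e : ℝ) : ℂ)) =
      fun _ => ((inner ℝ v e : ℝ) : ℂ) := by
  funext x
  have h : HasFDerivAt (fun x : Eucl n => ((inner ℝ x e : ℝ) : ℂ))
      (Complex.ofRealCLM.comp (innerSL ℝ e)) x := by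
    have := (Complex.ofRealCLM.comp (innerSL ℝ e)).hasFDerivAt (x := x)
    refine this.congr_of_eventuallyEq (Eventually.of_forall fun y => ?_)
    simp [real_inner_comm]
  simp only [dirDeriv]
  rw [h.fderiv]
  simp [real_inner_comm]

theorem laplacian_comp_norm_sq_mul {ψ : ℝ → ℂ} (hψ : ContDiff ℝ ∞ ψ) {Y : Eucl n → ℂ}
    (hY : ContDiff ℝ ∞ Y) (x : Eucl n) :
    Laplacian.laplacian (fun x : Eucl n => ψ (‖x‖ ^ 2) * Y x) x =
      (4 * ‖x‖ ^ 2 * deriv (deriv ψ) (‖x‖ ^ 2) + 2 * n * deriv ψ (‖x‖ ^ 2)) * Y x +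
        4 * deriv ψ (‖x‖ ^ 2) * fderiv ℝ Y x x +
        ψ (‖x‖ ^ 2) * Laplacian.laplacian Y x := by
  have hψ1 : ContDiff ℝ ∞ (deriv ψ) := (contDiff_infty_iff_deriv.1 hψ).2
  have c0 := contDiff_comp_norm_sq (n := n) hψ
  have c1 := contDiff_comp_norm_sq (n := n) hψ1
  have h2 : ∀ e : Eucl n, dirDeriv e (dirDeriv e (fun x : Eucl n => ψ (‖x‖ ^ 2) * Y x)) x =
      2 * ((inner ℝ e e : ℝ) : ℂ) * deriv ψ (‖x‖ ^ 2) * Y x +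
      4 * (((inner ℝ x e) ^ 2 : ℝ) : ℂ) * deriv (deriv ψ) (‖x‖ ^ 2) * Y x +
      4 * deriv ψ (‖x‖ ^ 2) * (((inner ℝ x e : ℝ) : ℂ) * dirDeriv e Y x) +
      ψ (‖x‖ ^ 2) * dirDeriv e (dirDeriv e Y) x := by
    intro e
    have ce := contDiff_inner_coe e
    have c2e : ContDiff ℝ ∞ (fun x : Eucl n => (2 * (inner ℝ x e : ℝ) : ℂ)) :=
      contDiff_const.mul ce
    rw [dirDeriv_mul c0 hY, dirDeriv_comp_norm_sq hψ,
      dirDeriv_add ((c2e.mul c1).mul hY) (c0.mul (contDiff_dirDeriv hY)),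
      dirDeriv_mul (c2e.mul c1) hY, dirDeriv_mul c2e c1, dirDeriv_mul contDiff_const ce,
      dirDeriv_mul c0 (contDiff_dirDeriv hY), dirDeriv_comp_norm_sq hψ,
      dirDeriv_comp_norm_sq hψ1, dirDeriv_const, dirDeriv_inner_coe]
    push_cast
    ring
  rw [laplacian_eq_sum_dirDeriv (c0.mul hY), laplacian_eq_sum_dirDeriv hY,
    show fderiv ℝ Y x x = dirDeriv x Y x from rfl, ← sum_inner_smul_dirDeriv Y x x]
  simp only [h2, Finset.sum_add_distrib, ← Finset.mul_sum, ← Finset.sum_mul, inner_basisVec_self]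
  rw [← Complex.ofReal_sum, sum_inner_basisVec_sq]
  simp
  ring

/-! ### Solid harmonics and radial test functions -/

/-- Smooth harmonic functions on `ℝⁿ` that are homogeneous of degree `l`. -/
structure IsSolidHarmonic (l : ℕ) (Y : Eucl n → ℂ) : Prop where
  contDiff : ContDiff ℝ ∞ Y
  laplacian_eq_zero : ∀ x, Laplacian.laplacian Y x = 0
  homogeneous : ∀ (t : ℝ) (x : Eucl n), 0 < t → Y (t • x) = (t : ℂ) ^ l * Y x

/-- Euler's relation: differentiate the homogeneity at `t = 1`. -/
lemma IsSolidHarmonic.fderiv_self {l : ℕ} {Y : Eucl n → ℂ} (hY : IsSolidHarmonic l Y)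
    (x : Eucl n) : fderiv ℝ Y x x = l * Y x := by
  have h1 : HasDerivAt (fun t : ℝ => Y (t • x)) (fderiv ℝ Y x x) 1 := by
    have hg : HasDerivAt (fun t : ℝ => t • x) ((1 : ℝ) • x) 1 := (hasDerivAt_id 1).smul_const x
    have hf : HasFDerivAt Y (fderiv ℝ Y x) ((1 : ℝ) • x) := by
      rw [one_smul]; exact (hY.contDiff.differentiable (by simp) x).hasFDerivAt
    exact (hf.comp_hasDerivAt (1 : ℝ) hg).congr_deriv (by simp)
  have h2 : HasDerivAt (fun t : ℝ => (t : ℂ) ^ l * Y x) (l * Y x) 1 := by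
    have := (((hasDerivAt_id (1 : ℝ)).ofReal_comp).pow l).mul_const (Y x)
    simpa using this
  have h3 : (fun t : ℝ => Y (t • x)) =ᶠ[𝓝 1] fun t : ℝ => (t : ℂ) ^ l * Y x := by
    filter_upwards [Ioi_mem_nhds one_pos] with t ht using hY.homogeneous t x ht
  exact h1.unique (h2.congr_of_eventuallyEq h3)

lemma IsSolidHarmonic.laplacian_comp_norm_sq_mul {l : ℕ} {Y : Eucl n → ℂ}
    (hY : IsSolidHarmonic l Y) {ψ : ℝ → ℂ} (hψ : ContDiff ℝ ∞ ψ) (x : Eucl n) :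
    Laplacian.laplacian (fun x : Eucl n => ψ (‖x‖ ^ 2) * Y x) x =
      (4 * ‖x‖ ^ 2 * deriv (deriv ψ) (‖x‖ ^ 2) + (2 * n + 4 * l) * deriv ψ (‖x‖ ^ 2)) * Y x := by
  rw [Scattering.laplacian_comp_norm_sq_mul hψ hY.contDiff, hY.fderiv_self, hY.laplacian_eq_zero]
  ring

/-- The exponent `l + (n-1)/2` of the radial equation. -/
noncomputable def radialExponent (n l : ℕ) : ℝ := l + ((n : ℝ) - 1) / 2

/-- The profile `ψ` with `u r = r ^ b * ψ (r ^ 2)`. -/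
noncomputable def radialProfile (b : ℝ) (u : ℝ → ℂ) (t : ℝ) : ℂ :=
  ((t ^ (-b / 2) : ℝ) : ℂ) * u (√t)

lemma contDiff_radialProfile {R b : ℝ} (hR : 0 ≤ R) {u : ℝ → ℂ} (hu : ContDiff ℝ ∞ u)
    (hs : tsupport u ⊆ Ioi R) : ContDiff ℝ ∞ (radialProfile b u) := by
  refine contDiff_iff_contDiffAt.2 fun t => ?_
  -- For `t ≤ 0` the square root is `0`, and `u` vanishes near `0`, so the profile vanishes near `t`
  -- whatever the power of `t` is.
  rcases lt_or_ge 0 t with ht | ht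
  · refine ContDiffAt.mul ?_ (hu.contDiffAt.comp t (Real.contDiffAt_sqrt ht.ne'))
    exact Complex.ofRealCLM.contDiff.contDiffAt.comp t
      (Real.contDiffAt_rpow_const_of_ne ht.ne')
  · have h0 : (0 : ℝ) ∉ tsupport u := fun h => absurd (hs h) (not_lt.2 hR)
    have hev : u =ᶠ[𝓝 0] fun _ => 0 := by
      filter_upwards [(isClosed_tsupport u).isOpen_compl.mem_nhds h0] with y hy
      exact image_eq_zero_of_notMem_tsupport hy
    have hsq : Tendsto Real.sqrt (𝓝 t) (𝓝 0) := by
      have := Real.continuous_sqrt.tendsto t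
      rwa [Real.sqrt_eq_zero_of_nonpos ht] at this
    have : radialProfile b u =ᶠ[𝓝 t] fun _ => 0 := by
      filter_upwards [hsq.eventually hev] with y hy
      simp [radialProfile, hy]
    exact contDiffAt_const.congr_of_eventuallyEq this

lemma eq_rpow_mul_radialProfile {b r : ℝ} (hr : 0 < r) (u : ℝ → ℂ) :
    u r = ((r ^ b : ℝ) : ℂ) * radialProfile b u (r ^ 2) := by
  have e : (r ^ 2) ^ (-b / 2) = (r ^ b)⁻¹ := by
    rw [← Real.rpow_natCast, ← Real.rpow_mul hr.le, ← Real.rpow_neg hr.le]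
    congr 1
    push_cast
    ring
  have hne : ((r ^ b : ℝ) : ℂ) ≠ 0 := by exact_mod_cast (Real.rpow_pos_of_pos hr b).ne'
  rw [radialProfile, Real.sqrt_sq hr.le, e]
  push_cast at hne ⊢
  rw [mul_inv_cancel_left₀ hne]

lemma deriv_deriv_eq_radialProfile {R b r : ℝ} (hR : 0 ≤ R) (hr : 0 < r) {u : ℝ → ℂ}
    (hu : ContDiff ℝ ∞ u) (hs : tsupport u ⊆ Ioi R) :
    deriv (deriv u) r = ((r ^ b : ℝ) : ℂ) *
      (b * (b - 1) / r ^ 2 * radialProfile b u (r ^ 2) +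
        (4 * b + 2) * deriv (radialProfile b u) (r ^ 2) +
        4 * r ^ 2 * deriv (deriv (radialProfile b u)) (r ^ 2)) := by
  have hψ := contDiff_radialProfile (b := b) hR hu hs
  have hψ1 : ContDiff ℝ ∞ (deriv (radialProfile b u)) := (contDiff_infty_iff_deriv.1 hψ).2
  set ψ := radialProfile b u with hψd
  have hsq : ∀ x : ℝ, HasDerivAt (fun x : ℝ => x ^ 2) (2 * x) x := fun x => by
    simpa using hasDerivAt_pow 2 x
  have hc : ∀ {g : ℝ → ℂ}, ContDiff ℝ ∞ g → ∀ x : ℝ,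
      HasDerivAt (fun x : ℝ => g (x ^ 2)) ((2 * x : ℝ) • deriv g (x ^ 2)) x := fun hg x =>
    (hg.differentiable (by simp) (x ^ 2)).hasDerivAt.scomp x (hsq x)
  have hp : ∀ (c x : ℝ), 0 < x → HasDerivAt (fun x : ℝ => ((x ^ c : ℝ) : ℂ))
      (((x ^ c : ℝ) : ℂ) * (c / x)) x := fun c x hx => by
    refine (hasDerivAt_ofReal_rpow hx).congr_deriv ?_
    have hxc : (x : ℂ) ≠ 0 := by exact_mod_cast hx.ne'
    rw [Real.rpow_sub_one hx.ne']
    push_cast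
    field_simp
  have h1 : ∀ x, 0 < x → HasDerivAt u
      (((x ^ b : ℝ) : ℂ) * (b / x) * ψ (x ^ 2) +
        ((x ^ b : ℝ) : ℂ) * ((2 * x : ℝ) • deriv ψ (x ^ 2))) x := by
    intro x hx
    refine ((hp b x hx).mul (hc hψ x)).congr_of_eventuallyEq ?_
    filter_upwards [Ioi_mem_nhds hx] with y hy using eq_rpow_mul_radialProfile hy u
  have hev : deriv u =ᶠ[𝓝 r] fun x => ((x ^ b : ℝ) : ℂ) * (b / x) * ψ (x ^ 2) +
        ((x ^ b : ℝ) : ℂ) * ((2 * x : ℝ) • deriv ψ (x ^ 2)) := by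
    filter_upwards [Ioi_mem_nhds hr] with y hy using (h1 y hy).deriv
  have hdiv : HasDerivAt (fun x : ℝ => (b : ℂ) / (x : ℂ)) (-(b : ℂ) / r ^ 2) r := by
    have hrc : (r : ℂ) ≠ 0 := by exact_mod_cast hr.ne'
    have := (hasDerivAt_const r (b : ℂ)).div ((hasDerivAt_id r).ofReal_comp) hrc
    refine this.congr_deriv ?_
    simp
  have hlin : HasDerivAt (fun x : ℝ => (2 * x : ℝ)) 2 r := by
    simpa using (hasDerivAt_id r).const_mul (2 : ℝ)
  rw [hev.deriv_eq]
  have h2 := (((hp b r hr).mul hdiv).mul (hc hψ r)).add ((hp b r hr).mul (hlin.smul (hc hψ1 r)))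
  have hrc : (r : ℂ) ≠ 0 := by exact_mod_cast hr.ne'
  refine (h2.deriv).trans ?_
  simp only [Complex.real_smul, Pi.mul_apply, Pi.smul_apply']
  push_cast
  field_simp
  ring

lemma tsupport_laplacian_subset (φ : Eucl n → ℂ) :
    tsupport (Laplacian.laplacian φ) ⊆ tsupport φ := by
  refine closure_minimal (fun x hx => ?_) (isClosed_tsupport φ)
  by_contra hnot
  apply hx
  have hev : φ =ᶠ[𝓝 x] fun _ => (0 : ℂ) := by
    filter_upwards [(isClosed_tsupport φ).isOpen_compl.mem_nhds hnot] with y hy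
    exact image_eq_zero_of_notMem_tsupport hy
  rw [(InnerProductSpace.laplacian_congr_nhds hev).eq_of_nhds]
  simp

lemma continuous_laplacian {φ : Eucl n → ℂ} (hφ : ContDiff ℝ ∞ φ) :
    Continuous (Laplacian.laplacian φ) := by
  have : Laplacian.laplacian φ =
      fun x => ∑ i, dirDeriv (basisVec i) (dirDeriv (basisVec i) φ) x :=
    funext (laplacian_eq_sum_dirDeriv hφ)
  rw [this]
  exact continuous_finsetSum _ fun i _ => (contDiff_dirDeriv (contDiff_dirDeriv hφ)).continuous

/-- Testing a solution of the Helmholtz equation with `u(|x|) |x|^{-b} Y(x)` shows that its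
angular components solve the radial equation weakly. -/
theorem isWeakODESolution_sphere_integral (hn : 1 ≤ n) {k R : ℝ} (hR : 0 ≤ R) {l : ℕ}
    {Y v : Eucl n → ℂ} (hY : IsSolidHarmonic l Y) (hv : ContinuousOn v (exterior n R))
    (hsol : IsHelmholtzSolution k (exterior n R) v) :
    IsWeakODESolution
      (fun r => k ^ 2 - radialExponent n l * (radialExponent n l - 1) / r ^ 2) R
      (fun r => ((r ^ (((n : ℝ) - 1) / 2) : ℝ) : ℂ) *
        ∫ θ : Metric.sphere (0 : Eucl n) 1, v (r • (θ : Eucl n)) * Y θ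
          ∂(volume : Measure (Eucl n)).toSphere) := by
  intro u hu huc hus
  set b := radialExponent n l with hb
  have hψ := contDiff_radialProfile (b := b) hR hu hus
  set φ : Eucl n → ℂ := fun x => radialProfile b u (‖x‖ ^ 2) * Y x with hφd
  have hφ : ContDiff ℝ ∞ φ := (contDiff_comp_norm_sq hψ).mul hY.contDiff
  obtain ⟨a, d, hRa, had, hK⟩ := exists_Icc_of_isCompact huc.isCompact hus
  have hsupp : Function.support φ ⊆ {x | a ≤ ‖x‖ ∧ ‖x‖ ≤ d} := by
    intro x hx
    by_contra hnot
    apply hx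
    have : ‖x‖ ∉ tsupport u := fun h => hnot (hK h)
    simp only [hφd, radialProfile, Real.sqrt_sq (norm_nonneg x),
      image_eq_zero_of_notMem_tsupport this, mul_zero, zero_mul]
  have hclosed : IsClosed {x : Eucl n | a ≤ ‖x‖ ∧ ‖x‖ ≤ d} :=
    (isClosed_le continuous_const continuous_norm).inter
      (isClosed_le continuous_norm continuous_const)
  have hts : tsupport φ ⊆ {x | a ≤ ‖x‖ ∧ ‖x‖ ≤ d} := closure_minimal hsupp hclosed
  have hφc : HasCompactSupport φ := by
    refine HasCompactSupport.intro (isCompact_closedBall (0 : Eucl n) d) fun x hx => ?_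
    refine image_eq_zero_of_notMem_tsupport fun h => hx ?_
    simpa using (hts h).2
  have hφs : tsupport φ ⊆ exterior n R := by
    intro x hx
    have := (hts hx).1
    simp only [exterior, mem_compl_iff, Metric.mem_closedBall, dist_zero_right, not_le]
    linarith
  have hz := hsol φ hφ hφc hφs
  set g : Eucl n → ℂ := fun x => v x * (Laplacian.laplacian φ x + (k : ℂ) ^ 2 * φ x) with hg
  have hLs : tsupport (fun x => Laplacian.laplacian φ x + (k : ℂ) ^ 2 * φ x) ⊆ tsupport φ :=
    (tsupport_add _ _).trans (union_subset (tsupport_laplacian_subset φ)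
      tsupport_mul_subset_right)
  have hgs : tsupport g ⊆ tsupport φ := tsupport_mul_subset_right.trans hLs
  have hgc : Continuous g := by
    have hext : IsOpen (exterior n R) := Metric.isClosed_closedBall.isOpen_compl
    refine ContinuousOn.continuous_of_tsupport_subset (s := exterior n R) ?_ hext
      (hgs.trans hφs)
    exact hv.mul ((continuous_laplacian hφ).add
      (continuous_const.mul hφ.continuous)).continuousOn
  have hgi : Integrable g := hgc.integrable_of_hasCompactSupport
    (HasCompactSupport.of_support_subset_isCompact hφc.isCompact
      ((subset_tsupport g).trans hgs))
  have : Nonempty (Fin n) := ⟨⟨0, hn⟩⟩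
  have : Nontrivial (Eucl n) := inferInstance
  rw [integral_polar volume hgi, finrank_euclideanSpace_fin] at hz
  have hvan : ∀ r : ℝ, r ∉ Ioi (0 : ℝ) → r ∉ tsupport u := fun r hr h =>
    hr (hR.trans_lt (hus h))
  rw [← setIntegral_eq_integral_of_forall_compl_eq_zero (s := Ioi (0 : ℝ)), ← hz]
  · refine setIntegral_congr_fun measurableSet_Ioi fun r hr => ?_
    have hr : (0 : ℝ) < r := hr
    have hrc : (r : ℂ) ≠ 0 := by exact_mod_cast hr.ne'
    beta_reduce
    have hpt : ∀ θ : Metric.sphere (0 : Eucl n) 1, g (r • (θ : Eucl n)) =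
        ((r : ℂ) ^ l * (((r ^ b : ℝ) : ℂ)⁻¹ * (deriv (deriv u) r +
          ((k ^ 2 - b * (b - 1) / r ^ 2 : ℝ) : ℂ) * u r))) * (v (r • (θ : Eucl n)) * Y θ) := by
      intro θ
      have hnorm : ‖r • (θ : Eucl n)‖ = r := by
        rw [norm_smul, norm_eq_of_mem_sphere, mul_one, Real.norm_of_nonneg hr.le]
      have hne : ((r ^ b : ℝ) : ℂ) ≠ 0 := by exact_mod_cast (Real.rpow_pos_of_pos hr b).ne'
      simp only [hg, hφd]
      rw [hY.laplacian_comp_norm_sq_mul hψ, hnorm, hY.homogeneous r θ hr,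
        deriv_deriv_eq_radialProfile (b := b) hR hr hu hus, eq_rpow_mul_radialProfile (b := b) hr u]
      -- The exponent `b` is chosen for this coincidence: the first-order coefficient from the
      -- Laplacian agrees with the one from `u''`, so `Δφ = |x|^(-b) (u'' - b(b-1) u / r²) Y`.
      have hbn : (4 * b + 2 : ℂ) = 2 * n + 4 * l := by
        rw [hb, radialExponent]; push_cast; ring
      rw [hbn]
      push_cast at hne ⊢
      field_simp
      ring
    simp only [hpt]
    rw [integral_const_mul, Complex.real_smul]
    -- Power count: Jacobian `r^(n-1)`, homogeneity `r^l` and the factor `r^(-b)` combine to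
    -- `r^((n-1)/2)`.
    have hpow : ((r ^ (n - 1) : ℝ) : ℂ) * ((r : ℂ) ^ l * ((r ^ b : ℝ) : ℂ)⁻¹) =
        ((r ^ (((n : ℝ) - 1) / 2) : ℝ) : ℂ) := by
      rw [← Complex.ofReal_pow, ← Complex.ofReal_inv, ← Complex.ofReal_mul, ← Complex.ofReal_mul,
        ← Real.rpow_natCast r (n - 1), ← Real.rpow_natCast r l, ← Real.rpow_neg hr.le,
        ← Real.rpow_add hr, ← Real.rpow_add hr]
      congr 2
      rw [hb, radialExponent, Nat.cast_sub hn]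
      push_cast
      ring
    rw [← hpow]
    ring
  · intro r hr
    have h1 := hvan r hr
    have h2 : r ∉ tsupport (deriv (deriv u)) := fun h =>
      h1 (tsupport_deriv_subset (tsupport_deriv_subset h))
    rw [image_eq_zero_of_notMem_tsupport h1, image_eq_zero_of_notMem_tsupport h2]
    simp

/-! ### Integrals over compact spaces depending on a parameter -/

section Parametric

variable {S : Type*} [TopologicalSpace S] [CompactSpace S]
  [MeasurableSpace S] [BorelSpace S] {μ : Measure S} [IsFiniteMeasure μ]

lemma continuousOn_integral_of_compactSpace {U : Set ℝ} (hU : IsOpen U) {F : ℝ → S → ℂ}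
    (hF : ContinuousOn (Function.uncurry F) (U ×ˢ univ)) :
    ContinuousOn (fun r => ∫ θ, F r θ ∂μ) U := by
  rw [continuousOn_iff_continuous_domRestrict]
  have : LocallyCompactSpace U := hU.locallyCompactSpace
  have h : Continuous (Function.uncurry fun (r : U) θ => F r θ) := by
    refine hF.comp_continuous (f := fun p : U × S => ((p.1 : ℝ), p.2)) (by fun_prop) ?_
    exact fun p => ⟨p.1.2, mem_univ _⟩
  have h2 := continuous_parametric_integral_of_continuous (μ := μ) h isCompact_univ
  rw [Measure.restrict_univ] at h2
  exact h2

lemma hasDerivAt_integral_of_compactSpace {U : Set ℝ} (hU : IsOpen U) {F F' : ℝ → S → ℂ}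
    (hd : ∀ r ∈ U, ∀ θ, HasDerivAt (fun r => F r θ) (F' r θ) r)
    (hF : ∀ r ∈ U, Continuous (F r))
    (hF' : ContinuousOn (Function.uncurry F') (U ×ˢ univ)) {r : ℝ} (hr : r ∈ U) :
    HasDerivAt (fun r => ∫ θ, F r θ ∂μ) (∫ θ, F' r θ ∂μ) r := by
  obtain ⟨K, hK, hKr, hKU⟩ := exists_compact_subset hU hr
  obtain ⟨C, hC⟩ := (hK.prod isCompact_univ).exists_bound_of_continuousOn
    (hF'.mono (prod_mono hKU (subset_univ (univ : Set S))))
  have hint : ∀ {f : S → ℂ}, Continuous f → Integrable f μ := fun hf =>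
    hf.integrable_of_hasCompactSupport (HasCompactSupport.of_compactSpace _)
  have hF'c : Continuous (F' r) := hF'.comp_continuous
    (f := fun θ : S => (r, θ)) (by fun_prop) fun θ => ⟨hr, mem_univ _⟩
  refine (hasDerivAt_integral_of_dominated_loc_of_deriv_le (s := K) (bound := fun _ => C)
    (mem_interior_iff_mem_nhds.1 hKr) ?_ (hint (hF r hr)) hF'c.aestronglyMeasurable
    (Eventually.of_forall fun θ x hx => hC (x, θ) ⟨hx, mem_univ _⟩) (integrable_const C)
    (Eventually.of_forall fun θ x hx => hd x (hKU hx) θ)).2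
  filter_upwards [hU.mem_nhds hr] with x hx using (hF x hx).aestronglyMeasurable

lemma tendsto_integral_mul_of_tendstoUniformly {f : ℝ → S → ℂ} {A y : S → ℂ}
    (hf : ∀ᶠ r in atTop, Continuous (f r)) (hy : Continuous y)
    (h : TendstoUniformly f A atTop) :
    Tendsto (fun r => ∫ θ, f r θ * y θ ∂μ) atTop (𝓝 (∫ θ, A θ * y θ ∂μ)) := by
  have hA : Continuous A := h.continuous hf.frequently
  obtain ⟨C, hC⟩ := isCompact_univ.exists_bound_of_continuousOn hA.continuousOn
  refine tendsto_integral_filter_of_dominated_convergence (fun θ => (C + 1) * ‖y θ‖) ?_ ?_ ?_ ?_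
  · filter_upwards [hf] with r hr using (hr.mul hy).aestronglyMeasurable
  · filter_upwards [Metric.tendstoUniformly_iff.1 h 1 one_pos] with r hr
    refine Eventually.of_forall fun θ => ?_
    rw [norm_mul]
    gcongr
    have h1 := hr θ
    rw [dist_comm, dist_eq_norm] at h1
    calc ‖f r θ‖ = ‖(f r θ - A θ) + A θ‖ := by rw [sub_add_cancel]
      _ ≤ ‖f r θ - A θ‖ + ‖A θ‖ := norm_add_le _ _
      _ ≤ C + 1 := by linarith [hC θ (mem_univ θ)]
  · exact (continuous_const.mul hy.norm).integrable_of_hasCompactSupport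
      (HasCompactSupport.of_compactSpace _)
  · exact Eventually.of_forall fun θ => (h.tendsto_at θ).mul_const _

end Parametric

/-! ### The modes of a radiating field -/

/-- A continuously differentiable radiating solution of the Helmholtz equation outside `B_R`,
with far field pattern `A`. -/
structure IsRadiatingField (k R : ℝ) (v : Eucl n → ℂ)
    (A : Metric.sphere (0 : Eucl n) 1 → ℂ) : Prop where
  contDiffOn : ContDiffOn ℝ 1 v (exterior n R)
  isSolution : IsHelmholtzSolution k (exterior n R) v
  tendsto_sommerfeld : TendstoUniformly
    (fun (r : ℝ) (θ : Metric.sphere (0 : Eucl n) 1) => ((r ^ (((n : ℝ) - 1) / 2) : ℝ) : ℂ) *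
      (fderiv ℝ v (r • (θ : Eucl n)) θ - Complex.I * k * v (r • (θ : Eucl n)))) (fun _ => 0) atTop
  tendsto_farField : TendstoUniformly
    (fun (r : ℝ) (θ : Metric.sphere (0 : Eucl n) 1) => Complex.exp (-(Complex.I * k * r)) *
      (((r ^ (((n : ℝ) - 1) / 2) : ℝ) : ℂ) * v (r • (θ : Eucl n)))) A atTop

lemma isOpen_exterior (R : ℝ) : IsOpen (exterior n R) := Metric.isClosed_closedBall.isOpen_compl

lemma norm_smul_sphere {r : ℝ} (hr : 0 ≤ r) (θ : Metric.sphere (0 : Eucl n) 1) :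
    ‖r • (θ : Eucl n)‖ = r := by
  rw [norm_smul, norm_eq_of_mem_sphere, mul_one, Real.norm_of_nonneg hr]

lemma smul_sphere_mem_exterior {R r : ℝ} (hR : 0 ≤ R) (hr : R < r)
    (θ : Metric.sphere (0 : Eucl n) 1) : r • (θ : Eucl n) ∈ exterior n R := by
  simp only [exterior, mem_compl_iff, Metric.mem_closedBall, dist_zero_right, not_le]
  rwa [norm_smul_sphere (hR.trans hr.le)]

/-- The radiation condition and the far-field expansion each come with their own representative;
being continuous and equal almost everywhere, they agree on the open exterior. Multiplying the
remainder `O(r^(-n/2))` by `r^((n-1)/2)` leaves `O(r^(-1/2))`. -/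
theorem exists_isRadiatingField {k R : ℝ} (hR : 0 < R) {w : Eucl n → ℂ}
    {A : Metric.sphere (0 : Eucl n) 1 → ℂ} (hsol : IsHelmholtzSolution k (exterior n R) w)
    (hrad : IsRadiating k R w) (hA : IsFarFieldPattern k R w A) :
    ∃ v, IsRadiatingField k R v A ∧ w =ᵐ[volume.restrict (exterior n R)] v := by
  obtain ⟨v, hv, hwv, hlim⟩ := hrad
  obtain ⟨v', hv', hwv', M, r₀, hM⟩ := hA
  have heq : EqOn v v' (exterior n R) :=
    Measure.eqOn_open_of_ae_eq (hwv.symm.trans hwv') (isOpen_exterior R) hv.continuousOn hv'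
  refine ⟨v, ⟨hv, ?_, ?_, ?_⟩, hwv⟩
  · intro φ hφ hφc hφs
    rw [← hsol φ hφ hφc hφs]
    have hmeas : MeasurableSet (exterior n R) := (isOpen_exterior R).measurableSet
    have hwv2 := (ae_restrict_iff' hmeas).1 hwv
    refine integral_congr_ae ?_
    filter_upwards [hwv2] with x hx
    by_cases h : x ∈ tsupport φ
    · rw [hx (hφs h)]
    · have h2 : x ∉ tsupport (Laplacian.laplacian φ) := fun h' =>
        h (tsupport_laplacian_subset φ h')
      simp [image_eq_zero_of_notMem_tsupport h, image_eq_zero_of_notMem_tsupport h2]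
  · rw [Metric.tendstoUniformly_iff]
    intro ε hε
    have h1 := hlim.eventually (Metric.ball_mem_nhds 0 hε)
    rw [← comap_norm_atTop, eventually_comap] at h1
    filter_upwards [h1, eventually_gt_atTop 0] with r hr hr0 θ
    have hnorm := norm_smul_sphere hr0.le θ
    have h2 := hr (r • (θ : Eucl n)) hnorm
    rw [hnorm, smul_smul, inv_mul_cancel₀ hr0.ne', one_smul] at h2
    rwa [dist_comm]
  · rw [Metric.tendstoUniformly_iff]
    intro ε hε
    have hdecay : Tendsto (fun r : ℝ => M * r ^ (-(1 / 2 : ℝ))) atTop (𝓝 0) := by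
      simpa using (tendsto_rpow_neg_atTop (y := 1 / 2) (by norm_num)).const_mul M
    filter_upwards [hdecay.eventually (gt_mem_nhds hε), eventually_ge_atTop r₀,
      eventually_gt_atTop R] with r h1 h2 h3 θ
    have hr0 : 0 < r := hR.trans h3
    have h4 := hM r h2 θ
    rw [← heq (smul_sphere_mem_exterior hR.le h3 θ)] at h4
    set ρ := r ^ (((n : ℝ) - 1) / 2) with hρ
    have hρ0 : 0 < ρ := Real.rpow_pos_of_pos hr0 _
    have hρc : (ρ : ℂ) ≠ 0 := by exact_mod_cast hρ0.ne'
    have hee : Complex.exp (-(Complex.I * k * r)) * Complex.exp (Complex.I * k * r) = 1 := by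
      rw [← Complex.exp_add]; simp
    have e1 : Complex.exp (-(Complex.I * k * r)) * ((ρ : ℂ) * v (r • (θ : Eucl n))) - A θ =
        Complex.exp (-(Complex.I * k * r)) * (ρ : ℂ) * (v (r • (θ : Eucl n)) -
          Complex.exp (Complex.I * k * r) / (ρ : ℂ) * A θ) := by
      field_simp
      linear_combination (A θ) * hee
    rw [dist_comm, dist_eq_norm, e1, norm_mul, norm_mul, norm_exp_neg_I_mul_mul, one_mul,
      Complex.norm_real, Real.norm_of_nonneg hρ0.le]
    refine lt_of_le_of_lt ?_ h1
    calc ρ * ‖_‖ ≤ ρ * (M * r ^ (-((n : ℝ) / 2))) := by gcongr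
      _ = M * (ρ * r ^ (-((n : ℝ) / 2))) := by ring
      _ = M * r ^ (-(1 / 2 : ℝ)) := by
        rw [hρ, ← Real.rpow_add hr0]; congr 2; ring

lemma IsRadiatingField.continuous_slice {k R : ℝ} (hR : 0 ≤ R) {v : Eucl n → ℂ}
    {A : Metric.sphere (0 : Eucl n) 1 → ℂ} (H : IsRadiatingField k R v A) {r : ℝ} (hr : R < r) :
    Continuous fun θ : Metric.sphere (0 : Eucl n) 1 => v (r • (θ : Eucl n)) :=
  H.contDiffOn.continuousOn.comp_continuous (by fun_prop)
    fun θ => smul_sphere_mem_exterior hR hr θ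

lemma IsRadiatingField.continuous_farField {k R : ℝ} (hR : 0 ≤ R) {v : Eucl n → ℂ}
    {A : Metric.sphere (0 : Eucl n) 1 → ℂ} (H : IsRadiatingField k R v A) : Continuous A := by
  refine H.tendsto_farField.continuous (Eventually.frequently ?_)
  filter_upwards [eventually_gt_atTop R] with r hr
  exact continuous_const.mul (continuous_const.mul (H.continuous_slice hR hr))

/-- The angular components of a radiating field are multiples of the outgoing radial solution. -/
theorem IsRadiatingField.sphere_integral_eq (hn : 1 ≤ n) {k R : ℝ} (hk : 0 < k) (hR : 0 ≤ R)
    {v : Eucl n → ℂ} {A : Metric.sphere (0 : Eucl n) 1 → ℂ} (H : IsRadiatingField k R v A)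
    {l : ℕ} {Y : Eucl n → ℂ} (hY : IsSolidHarmonic l Y) {h h' : ℝ → ℂ}
    (Hh : IsOutgoing k (radialExponent n l) h h') {r : ℝ} (hr : R < r) :
    ((r ^ (((n : ℝ) - 1) / 2) : ℝ) : ℂ) *
        ∫ θ : Metric.sphere (0 : Eucl n) 1, v (r • (θ : Eucl n)) * Y θ
          ∂(volume : Measure (Eucl n)).toSphere =
      (∫ θ : Metric.sphere (0 : Eucl n) 1, A θ * Y θ ∂(volume : Measure (Eucl n)).toSphere) *
        h r := by
  set σ := (volume : Measure (Eucl n)).toSphere with hσ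
  set m : ℝ := ((n : ℝ) - 1) / 2 with hm
  have hYc : Continuous fun θ : Metric.sphere (0 : Eucl n) 1 => Y θ :=
    hY.contDiff.continuous.comp continuous_subtype_val
  have hvc := H.contDiffOn.continuousOn
  have hdv : ContinuousOn (fderiv ℝ v) (exterior n R) :=
    H.contDiffOn.continuousOn_fderiv_of_isOpen (isOpen_exterior R) le_rfl
  set g : ℝ → ℂ := fun r => ∫ θ, v (r • (θ : Eucl n)) * Y θ ∂σ with hg
  set g' : ℝ → ℂ := fun r => ∫ θ, fderiv ℝ v (r • (θ : Eucl n)) θ * Y θ ∂σ with hg'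
  have hF' : ContinuousOn (Function.uncurry fun (r : ℝ) (θ : Metric.sphere (0 : Eucl n) 1) =>
      fderiv ℝ v (r • (θ : Eucl n)) θ * Y θ) (Ioi R ×ˢ univ) := by
    refine ContinuousOn.mul ?_ (hYc.comp continuous_snd).continuousOn
    refine ContinuousOn.clm_apply ?_ (continuous_subtype_val.comp continuous_snd).continuousOn
    refine hdv.comp (f := fun p : ℝ × Metric.sphere (0 : Eucl n) 1 => p.1 • (p.2 : Eucl n))
      (by fun_prop) ?_
    exact fun p hp => smul_sphere_mem_exterior hR hp.1 p.2
  have hgd : ∀ r, R < r → HasDerivAt g (g' r) r := by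
    intro r hr
    refine hasDerivAt_integral_of_compactSpace isOpen_Ioi ?_ ?_ hF' hr
    · intro r hr θ
      have hx := smul_sphere_mem_exterior hR hr θ
      have h1 : HasFDerivAt v (fderiv ℝ v (r • (θ : Eucl n))) (r • (θ : Eucl n)) :=
        ((H.contDiffOn.differentiableOn one_ne_zero).differentiableAt
          ((isOpen_exterior R).mem_nhds hx)).hasFDerivAt
      have h2 : HasDerivAt (fun r : ℝ => r • (θ : Eucl n)) ((1 : ℝ) • (θ : Eucl n)) r :=
        (hasDerivAt_id r).smul_const _
      rw [one_smul] at h2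
      exact (h1.comp_hasDerivAt r h2).mul_const _
    · exact fun r hr => (H.continuous_slice hR hr).mul hYc
  have hgc' : ContinuousOn g' (Ioi R) := continuousOn_integral_of_compactSpace isOpen_Ioi hF'
  have hgc : ContinuousOn g (Ioi R) := fun x hx => (hgd x hx).continuousAt.continuousWithinAt
  set G : ℝ → ℂ := fun r => ((r ^ m : ℝ) : ℂ) * g r with hG
  set G' : ℝ → ℂ := fun r => ((m * r ^ (m - 1) : ℝ) : ℂ) * g r + ((r ^ m : ℝ) : ℂ) * g' r with hG'
  have hGd : ∀ r, R < r → HasDerivAt G (G' r) r := fun r hr =>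
    (hasDerivAt_ofReal_rpow (hR.trans_lt hr)).mul (hgd r hr)
  have hrpow : ∀ c : ℝ, ContinuousOn (fun r : ℝ => r ^ c) (Ioi R) := fun c =>
    continuousOn_id.rpow_const fun x hx => Or.inl (hR.trans_lt hx).ne'
  have hGc' : ContinuousOn G' (Ioi R) :=
    ((Complex.continuous_ofReal.comp_continuousOn (continuousOn_const.mul (hrpow _))).mul hgc).add
      ((Complex.continuous_ofReal.comp_continuousOn (hrpow _)).mul hgc')
  set c := ∫ θ, A θ * Y θ ∂σ with hc
  have hlim : Tendsto (fun r : ℝ => Complex.exp (-(Complex.I * k * r)) * G r) atTop (𝓝 c) := by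
    have hcont : ∀ᶠ r : ℝ in atTop, Continuous fun θ : Metric.sphere (0 : Eucl n) 1 =>
        Complex.exp (-(Complex.I * k * r)) * (((r ^ m : ℝ) : ℂ) * v (r • (θ : Eucl n))) := by
      filter_upwards [eventually_gt_atTop R] with r hr
      exact continuous_const.mul (continuous_const.mul (H.continuous_slice hR hr))
    refine (tendsto_integral_mul_of_tendstoUniformly (μ := σ) hcont hYc
      H.tendsto_farField).congr fun r => ?_
    simp only [hG, hg]
    rw [← mul_assoc, ← integral_const_mul]
    refine integral_congr_ae (Eventually.of_forall fun θ => ?_)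
    beta_reduce
    ring
  have hlim1 : Tendsto (fun r => G' r - Complex.I * k * G r) atTop (𝓝 0) := by
    have hcont : ∀ᶠ r : ℝ in atTop, Continuous fun θ : Metric.sphere (0 : Eucl n) 1 =>
        ((r ^ m : ℝ) : ℂ) * (fderiv ℝ v (r • (θ : Eucl n)) θ -
          Complex.I * k * v (r • (θ : Eucl n))) := by
      filter_upwards [eventually_gt_atTop R] with r hr
      refine continuous_const.mul (Continuous.sub ?_
        (continuous_const.mul (H.continuous_slice hR hr)))
      refine Continuous.clm_apply ?_ continuous_subtype_val
      exact hdv.comp_continuous (by fun_prop) fun θ => smul_sphere_mem_exterior hR hr θ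
    have h1 := tendsto_integral_mul_of_tendstoUniformly (μ := σ) hcont hYc H.tendsto_sommerfeld
    simp only [zero_mul, integral_zero] at h1
    -- Differentiating `r^m` adds the term `(m/r) G` to the radiation condition; it is negligible
    -- because `G` is bounded.
    have h2 : Tendsto (fun r : ℝ => ((m * r⁻¹ : ℝ) : ℂ)) atTop (𝓝 0) := by
      have := (tendsto_inv_atTop_zero (𝕜 := ℝ)).const_mul m
      rw [mul_zero] at this
      exact (Complex.continuous_ofReal.tendsto' 0 0 Complex.ofReal_zero).comp this
    have hGb : IsBoundedUnder (· ≤ ·) atTop (fun r => ‖G r‖) := by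
      have := hlim.norm.isBoundedUnder_le
      simpa [norm_mul, norm_exp_neg_I_mul_mul] using this
    have h3 := h1.add (h2.zero_mul_isBoundedUnder_le hGb)
    rw [add_zero] at h3
    refine h3.congr' ?_
    filter_upwards [eventually_gt_atTop R] with r hr
    have hr0 : 0 < r := hR.trans_lt hr
    have i1 : Integrable (fun θ : Metric.sphere (0 : Eucl n) 1 =>
        fderiv ℝ v (r • (θ : Eucl n)) θ * Y θ) σ := by
      refine Continuous.integrable_of_hasCompactSupport ?_ (HasCompactSupport.of_compactSpace _)
      refine Continuous.mul (Continuous.clm_apply ?_ continuous_subtype_val) hYc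
      exact hdv.comp_continuous (by fun_prop) fun θ => smul_sphere_mem_exterior hR hr θ
    have i2 : Integrable (fun θ : Metric.sphere (0 : Eucl n) 1 => v (r • (θ : Eucl n)) * Y θ) σ :=
      ((H.continuous_slice hR hr).mul hYc).integrable_of_hasCompactSupport
        (HasCompactSupport.of_compactSpace _)
    have e1 : ∫ θ : Metric.sphere (0 : Eucl n) 1, ((r ^ m : ℝ) : ℂ) *
        (fderiv ℝ v (r • (θ : Eucl n)) θ - Complex.I * k * v (r • (θ : Eucl n))) * Y θ ∂σ =
        ((r ^ m : ℝ) : ℂ) * (g' r - Complex.I * k * g r) := by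
      simp only [hg, hg']
      rw [← integral_const_mul, ← integral_sub i1 (i2.const_mul _), ← integral_const_mul]
      refine integral_congr_ae (Eventually.of_forall fun θ => ?_)
      beta_reduce
      ring
    rw [e1]
    simp only [hG, hG', Real.rpow_sub_one hr0.ne']
    push_cast
    ring
  have hGR : RadiatesTo k G G' c := ⟨hlim, hlim1⟩
  have hweak := isWeakODESolution_sphere_integral hn hR hY hvc H.isSolution
  have hpos : ∀ {x : ℝ}, R < x → 0 < x := fun hx => hR.trans_lt hx
  have hsm := Hh.contDiffOn.mono (Ioi_subset_Ioi hR)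
  obtain ⟨c1, hc1⟩ := exists_wronskian_eq_const hweak hGd hGc'
    (fun x hx => Hh.hasDerivAt x (hpos hx)) (fun x hx => Hh.hasDerivAt' x (hpos hx)) hsm
  obtain ⟨c2, hc2⟩ := exists_wronskian_eq_const (h := fun x => starRingEnd ℂ (h x))
    (h' := fun x => starRingEnd ℂ (h' x)) hweak hGd hGc'
    (fun x hx => hasDerivAt_conj (Hh.hasDerivAt x (hpos hx)))
    (fun x hx => (hasDerivAt_conj (Hh.hasDerivAt' x (hpos hx))).congr_deriv (by
      simp only [map_neg, map_mul, Complex.conj_ofReal]))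
    (Complex.conjCLE.contDiff.comp_contDiffOn hsm)
  have hev : ∀ {f : ℝ → ℂ} {a : ℂ}, (∀ x, R < x → f x = a) → Tendsto f atTop (𝓝 a) :=
    fun hf => tendsto_const_nhds.congr' (by
      filter_upwards [eventually_gt_atTop R] with x hx using (hf x hx).symm)
  have h10 : c1 = 0 := tendsto_nhds_unique (hev hc1) (hGR.tendsto_wronskian Hh.radiatesTo)
  have h20 : c2 = -2 * Complex.I * k * (c * starRingEnd ℂ 1) :=
    tendsto_nhds_unique (hev hc2) (hGR.tendsto_wronskian_conj Hh.radiatesTo)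
  have hw := Hh.wronskian (hpos hr)
  have w1 := hc1 r hr
  have w2 := hc2 r hr
  rw [h10] at w1
  rw [h20, map_one, mul_one] at w2
  have hne : (-2 * Complex.I * k : ℂ) ≠ 0 := by
    simp [hk.ne']
  -- The Wronskians of `G` with `h` and with its conjugate form a linear system for `G` and `G'`
  -- with determinant `±2ik`; eliminating `G'` gives `G = c h`.
  have hkey : (-2 * Complex.I * k : ℂ) * G r = (-2 * Complex.I * k : ℂ) * (c * h r) := by
    rw [← hw] at w2 ⊢
    linear_combination (h r) * w2 - (starRingEnd ℂ (h r)) * w1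
  exact mul_left_cancel₀ hne hkey

/-! ### Constructions of solid harmonics -/

lemma isSolidHarmonic_const (c : ℂ) : IsSolidHarmonic 0 (fun _ : Eucl n => c) := by
  refine ⟨contDiff_const, fun x => ?_, fun t x _ => by simp⟩
  simp [laplacian_eq_sum_dirDeriv contDiff_const, dirDeriv_const]

lemma IsSolidHarmonic.conj {l : ℕ} {Y : Eucl n → ℂ} (hY : IsSolidHarmonic l Y) :
    IsSolidHarmonic l (fun x => starRingEnd ℂ (Y x)) := by
  refine ⟨Complex.conjCLE.contDiff.comp hY.contDiff, fun x => ?_, fun t x ht => ?_⟩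
  · have := congrFun (InnerProductSpace.laplacian_CLE_comp_left (l := Complex.conjCLE) (f := Y)) x
    simp only [Function.comp_apply, hY.laplacian_eq_zero, map_zero] at this
    exact this
  · rw [hY.homogeneous t x ht, map_mul, map_pow, Complex.conj_ofReal]

/-- A function homogeneous of degree zero and continuous at the origin is constant. -/
lemma IsSolidHarmonic.dirDeriv_eq_zero {Y : Eucl n → ℂ} (hY : IsSolidHarmonic 0 Y) (e : Eucl n) :
    dirDeriv e Y = fun _ => 0 := by
  have hconst : Y = fun _ => Y 0 := by
    funext x
    have h1 : Tendsto (fun t : ℝ => Y (t • x)) (𝓝[>] 0) (𝓝 (Y ((0 : ℝ) • x))) :=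
      ((hY.contDiff.continuous.comp (continuous_id.smul continuous_const)).tendsto 0).mono_left
        nhdsWithin_le_nhds
    rw [zero_smul] at h1
    have h2 : Tendsto (fun t : ℝ => Y (t • x)) (𝓝[>] 0) (𝓝 (Y x)) := by
      refine tendsto_const_nhds.congr' ?_
      filter_upwards [self_mem_nhdsWithin] with t ht
      rw [hY.homogeneous t x ht]; simp
    exact tendsto_nhds_unique h2 h1
  rw [hconst, dirDeriv_const]

lemma dirDeriv_sum {ι : Type*} [Fintype ι] {e : Eucl n} {f : ι → Eucl n → ℂ}
    (hf : ∀ i, ContDiff ℝ ∞ (f i)) :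
    dirDeriv e (fun x => ∑ i, f i x) = fun x => ∑ i, dirDeriv e (f i) x := by
  funext x
  simp only [dirDeriv]
  rw [fderiv_fun_sum fun i _ => (hf i).differentiable (by simp) x, sum_apply]

/-- For `l = 0` the truncated degree `l - 1 = 0` is harmless, since the derivative is zero. -/
lemma IsSolidHarmonic.dirDeriv {l : ℕ} {Y : Eucl n → ℂ} (hY : IsSolidHarmonic l Y) (e : Eucl n) :
    IsSolidHarmonic (l - 1) (dirDeriv e Y) := by
  refine ⟨contDiff_dirDeriv hY.contDiff, fun x => ?_, fun t x ht => ?_⟩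
  · rw [laplacian_eq_sum_dirDeriv (contDiff_dirDeriv hY.contDiff)]
    have hsum : (fun x => ∑ i, Scattering.dirDeriv (basisVec i)
        (Scattering.dirDeriv (basisVec i) Y) x) = fun _ => 0 := by
      funext x
      rw [← laplacian_eq_sum_dirDeriv hY.contDiff, hY.laplacian_eq_zero]
    have hd : Scattering.dirDeriv e (fun x => ∑ i, Scattering.dirDeriv (basisVec i)
        (Scattering.dirDeriv (basisVec i) Y) x) x = 0 := by
      rw [hsum, dirDeriv_const]
    rw [← hd]
    rw [dirDeriv_sum fun i => contDiff_dirDeriv (contDiff_dirDeriv hY.contDiff)]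
    refine Finset.sum_congr rfl fun i _ => ?_
    rw [dirDeriv_comm (v := e) hY.contDiff, dirDeriv_comm (v := e) (contDiff_dirDeriv hY.contDiff)]
  · rcases Nat.eq_zero_or_pos l with rfl | hl
    · rw [hY.dirDeriv_eq_zero]; simp
    · have h1 : (fun x => Y (t • x)) = fun x => (t : ℂ) ^ l * Y x :=
        funext fun x => hY.homogeneous t x ht
      have h2 := fderiv_comp_smul (𝕜 := ℝ) (f := Y) (x := x) t
      rw [h1, fderiv_const_mul (hY.contDiff.differentiable (by simp) x)] at h2
      have h3 := congrArg (fun L : Eucl n →L[ℝ] ℂ => L e) h2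
      simp only [smul_apply, smul_eq_mul, Complex.real_smul] at h3
      have htc : (t : ℂ) ≠ 0 := by exact_mod_cast ht.ne'
      have hpow : (t : ℂ) ^ l = t * (t : ℂ) ^ (l - 1) := by
        rw [← pow_succ', Nat.sub_add_cancel hl]
      rw [hpow, mul_assoc] at h3
      exact (mul_left_cancel₀ htc h3).symm

lemma laplacian_inner_mul {f : Eucl n → ℂ} (hf : ContDiff ℝ ∞ f) (e x : Eucl n) :
    Laplacian.laplacian (fun x => ((inner ℝ x e : ℝ) : ℂ) * f x) x =
      2 * dirDeriv e f x + ((inner ℝ x e : ℝ) : ℂ) * Laplacian.laplacian f x := by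
  have ce := contDiff_inner_coe e
  rw [laplacian_eq_sum_dirDeriv (ce.mul hf), laplacian_eq_sum_dirDeriv hf,
    ← sum_inner_smul_dirDeriv f x e, Finset.mul_sum, Finset.mul_sum, ← Finset.sum_add_distrib]
  refine Finset.sum_congr rfl fun i _ => ?_
  rw [dirDeriv_mul ce hf, dirDeriv_inner_coe, dirDeriv_add (contDiff_const.mul hf)
    (ce.mul (contDiff_dirDeriv hf)), dirDeriv_mul contDiff_const hf,
    dirDeriv_mul ce (contDiff_dirDeriv hf), dirDeriv_inner_coe, dirDeriv_const]
  rw [real_inner_comm e]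
  ring

/-- The harmonic part of `⟨x, e⟩ Y(x)`. -/
lemma IsSolidHarmonic.inner_mul_sub {l : ℕ} {Y : Eucl n → ℂ}
    (hY : IsSolidHarmonic l Y) (e : Eucl n) (hnl : 2 < n + 2 * l ∨ l = 0) :
    IsSolidHarmonic (l + 1) (fun x => ((inner ℝ x e : ℝ) : ℂ) * Y x -
      ((((‖x‖ ^ 2 : ℝ) : ℂ)) * ((n + 2 * l - 2 : ℂ)⁻¹ * Scattering.dirDeriv e Y x))) := by
  have c1 : ContDiff ℝ ∞ (fun x : Eucl n => ((inner ℝ x e : ℝ) : ℂ) * Y x) :=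
    (contDiff_inner_coe e).mul hY.contDiff
  have hψ : ContDiff ℝ ∞ (fun t : ℝ => (t : ℂ) * (n + 2 * l - 2 : ℂ)⁻¹) :=
    Complex.ofRealCLM.contDiff.mul contDiff_const
  have hZ := hY.dirDeriv e
  have c2 : ContDiff ℝ ∞ (fun x : Eucl n => (((‖x‖ ^ 2 : ℝ) : ℂ)) *
      ((n + 2 * l - 2 : ℂ)⁻¹ * Scattering.dirDeriv e Y x)) := by
    have := (contDiff_comp_norm_sq (n := n) hψ).mul hZ.contDiff
    have e0 : (fun x : Eucl n => (((‖x‖ ^ 2 : ℝ) : ℂ)) * ((n + 2 * l - 2 : ℂ)⁻¹ *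
        Scattering.dirDeriv e Y x)) = fun x => (((‖x‖ ^ 2 : ℝ) : ℂ)) * (n + 2 * l - 2 : ℂ)⁻¹ *
        Scattering.dirDeriv e Y x := by
      funext x; ring
    rw [e0]
    exact this
  refine ⟨c1.sub c2, fun x => ?_, fun t x ht => ?_⟩
  · have h2 : ((2 : ℕ∞) : WithTop ℕ∞) ≤ ∞ := WithTop.coe_le_coe.2 le_top
    have hsub := ContDiffAt.laplacian_sub (c1.contDiffAt.of_le h2) (c2.contDiffAt.of_le h2) (x := x)
    refine hsub.trans ?_
    rw [laplacian_inner_mul hY.contDiff, hY.laplacian_eq_zero]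
    have e2 : (fun x : Eucl n => (((‖x‖ ^ 2 : ℝ) : ℂ)) *
        ((n + 2 * l - 2 : ℂ)⁻¹ * Scattering.dirDeriv e Y x)) =
        fun x => (fun t : ℝ => (t : ℂ) * (n + 2 * l - 2 : ℂ)⁻¹) (‖x‖ ^ 2) *
          Scattering.dirDeriv e Y x := by
      funext x; ring
    rw [e2, hZ.laplacian_comp_norm_sq_mul hψ]
    have hd1 : deriv (fun t : ℝ => (t : ℂ) * (n + 2 * l - 2 : ℂ)⁻¹) =
        fun _ => (n + 2 * l - 2 : ℂ)⁻¹ := by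
      funext t
      have := ((hasDerivAt_id t).ofReal_comp).mul_const (n + 2 * l - 2 : ℂ)⁻¹
      simpa using this.deriv
    rw [hd1]
    -- The denominator `n + 2l - 2` comes from `Δ(|x|² Z) = 2(n + 2l - 2) Z` for `Z` of degree `l -
    -- 1`. When `l = 0` it may vanish, but then `Z = 0` and the value of its inverse is irrelevant.
    rcases hnl with hnl | rfl
    · rcases Nat.eq_zero_or_pos l with rfl | hl
      · rw [hY.dirDeriv_eq_zero]; simp
      · have hne : (n + 2 * l - 2 : ℂ) ≠ 0 := by
          have : (0 : ℝ) < n + 2 * l - 2 := by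
            have : ((2 : ℕ) : ℝ) < ((n + 2 * l : ℕ) : ℝ) := by exact_mod_cast hnl
            push_cast at this; linarith
          exact_mod_cast this.ne'
        rw [Nat.cast_sub hl]
        simp only [deriv_const']
        field_simp
        push_cast
        ring
    · rw [hY.dirDeriv_eq_zero]; simp
  · have hin : (inner ℝ (t • x) e : ℝ) = t * inner ℝ x e := real_inner_smul_left _ _ _
    have hno : ‖t • x‖ ^ 2 = t ^ 2 * ‖x‖ ^ 2 := by
      rw [norm_smul, mul_pow, Real.norm_eq_abs, sq_abs]
    beta_reduce
    rw [hin, hno, hY.homogeneous t x ht]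
    rcases Nat.eq_zero_or_pos l with rfl | hl
    · rw [hY.dirDeriv_eq_zero]; push_cast; ring
    · rw [hZ.homogeneous t x ht]
      have hpow : (t : ℂ) ^ l = t * (t : ℂ) ^ (l - 1) := by
        rw [← pow_succ', Nat.sub_add_cancel hl]
      rw [pow_succ _ l, hpow]
      push_cast
      ring

/-! ### Orthogonality of solid harmonics on the sphere -/

lemma integral_mul_dirDeriv {f φ : Eucl n → ℂ} (hf : ContDiff ℝ ∞ f) (hφ : ContDiff ℝ ∞ φ)
    (hc : HasCompactSupport φ) (e : Eucl n) :
    ∫ x, f x * dirDeriv e φ x = -∫ x, dirDeriv e f x * φ x := by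
  refine integral_mul_fderiv_eq_neg_fderiv_mul_of_integrable ?_ ?_ ?_
    (fun x _ => hf.differentiable (by simp) x) (fun x _ => hφ.differentiable (by simp) x)
  · exact ((contDiff_dirDeriv hf).continuous.mul hφ.continuous).integrable_of_hasCompactSupport
      hc.mul_left
  · refine (hf.continuous.mul (contDiff_dirDeriv hφ).continuous).integrable_of_hasCompactSupport ?_
    exact (hc.fderiv_apply ℝ e).mul_left
  · exact (hf.continuous.mul hφ.continuous).integrable_of_hasCompactSupport hc.mul_left

/-- With wave number zero, a solid harmonic is itself a field to which
`isWeakODESolution_sphere_integral` applies; orthogonality on the sphere then follows without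
surface integration by parts. -/
lemma IsSolidHarmonic.isHelmholtzSolution {l : ℕ} {Y : Eucl n → ℂ} (hY : IsSolidHarmonic l Y)
    (Ω : Set (Eucl n)) : IsHelmholtzSolution 0 Ω Y := by
  intro φ hφ hc _
  have hcd : ∀ (e : Eucl n) {g : Eucl n → ℂ}, HasCompactSupport g →
      HasCompactSupport (Scattering.dirDeriv e g) := fun e g hg => hg.fderiv_apply ℝ e
  have hint : ∀ {f g : Eucl n → ℂ}, ContDiff ℝ ∞ f → ContDiff ℝ ∞ g → HasCompactSupport g →
      Integrable (fun x => f x * g x) := fun hf hg hgc =>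
    (hf.continuous.mul hg.continuous).integrable_of_hasCompactSupport hgc.mul_left
  have e1 : ∀ x, Y x * (Laplacian.laplacian φ x + ((0 : ℝ) : ℂ) ^ 2 * φ x) =
      ∑ i, Y x * Scattering.dirDeriv (basisVec i) (Scattering.dirDeriv (basisVec i) φ) x := by
    intro x
    rw [laplacian_eq_sum_dirDeriv hφ, ← Finset.mul_sum]
    simp
  simp only [e1]
  rw [integral_finsetSum _ fun i _ => hint hY.contDiff
    (contDiff_dirDeriv (contDiff_dirDeriv hφ)) (hcd _ (hcd _ hc))]
  have e2 : ∀ i : Fin n, ∫ x, Y x * Scattering.dirDeriv (basisVec i)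
      (Scattering.dirDeriv (basisVec i) φ) x =
      ∫ x, Scattering.dirDeriv (basisVec i) (Scattering.dirDeriv (basisVec i) Y) x * φ x := by
    intro i
    rw [integral_mul_dirDeriv hY.contDiff (contDiff_dirDeriv hφ) (hcd _ hc),
      integral_mul_dirDeriv (contDiff_dirDeriv hY.contDiff) hφ hc, neg_neg]
  simp only [e2]
  rw [← integral_finsetSum _ fun i _ => hint
    (contDiff_dirDeriv (contDiff_dirDeriv hY.contDiff)) hφ hc]
  simp only [← Finset.sum_mul, ← laplacian_eq_sum_dirDeriv hY.contDiff, hY.laplacian_eq_zero]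
  simp

/-- The radial component of `Y` against `Z` is `c r^β`, while `r^γ` solves the same radial equation,
with `β`, `γ` the exponents of degrees `a`, `b`. The Wronskian `(γ - β) c r^(β+γ-1)` must be
constant although its exponent is positive, hence `c = 0`. -/
theorem IsSolidHarmonic.integral_mul_eq_zero (hn : 2 ≤ n) {a b : ℕ} {Y Z : Eucl n → ℂ}
    (hY : IsSolidHarmonic a Y) (hZ : IsSolidHarmonic b Z) (hab : a ≠ b) :
    ∫ θ : Metric.sphere (0 : Eucl n) 1, Y θ * Z θ ∂(volume : Measure (Eucl n)).toSphere = 0 := by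
  set c := ∫ θ : Metric.sphere (0 : Eucl n) 1, Y θ * Z θ ∂(volume : Measure (Eucl n)).toSphere
    with hc
  have hweak := isWeakODESolution_sphere_integral (k := 0) (R := 0) (by omega) le_rfl hZ
    hY.contDiff.continuous.continuousOn (hY.isHelmholtzSolution _)
  set β := radialExponent n a with hβ
  set γ := radialExponent n b with hγ
  have hG : ∀ r : ℝ, 0 < r → ((r ^ (((n : ℝ) - 1) / 2) : ℝ) : ℂ) *
      ∫ θ : Metric.sphere (0 : Eucl n) 1, Y (r • (θ : Eucl n)) * Z θ
        ∂(volume : Measure (Eucl n)).toSphere = ((r ^ β : ℝ) : ℂ) * c := by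
    intro r hr
    simp only [hY.homogeneous r _ hr, mul_assoc]
    rw [integral_const_mul, ← hc, ← mul_assoc, ← Complex.ofReal_pow, ← Complex.ofReal_mul,
      ← Real.rpow_natCast, ← Real.rpow_add hr, hβ, radialExponent, add_comm]
  have hd : ∀ (s r : ℝ), 0 < r → HasDerivAt (fun r : ℝ => ((r ^ s : ℝ) : ℂ))
      ((s * r ^ (s - 1) : ℝ) : ℂ) r := fun s r hr => hasDerivAt_ofReal_rpow hr
  have g1 : ∀ r : ℝ, 0 < r → HasDerivAt (fun r : ℝ => ((r ^ (((n : ℝ) - 1) / 2) : ℝ) : ℂ) *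
      ∫ θ : Metric.sphere (0 : Eucl n) 1, Y (r • (θ : Eucl n)) * Z θ
        ∂(volume : Measure (Eucl n)).toSphere) (((β * r ^ (β - 1) : ℝ) : ℂ) * c) r := by
    intro r hr
    refine ((hd β r hr).mul_const c).congr_of_eventuallyEq ?_
    filter_upwards [Ioi_mem_nhds hr] with x hx using hG x hx
  have g2 : ContinuousOn (fun r : ℝ => ((β * r ^ (β - 1) : ℝ) : ℂ) * c) (Ioi 0) := by
    refine ContinuousOn.mul (Complex.continuous_ofReal.comp_continuousOn ?_) continuousOn_const
    exact continuousOn_const.mul (continuousOn_id.rpow_const fun x hx => Or.inl (ne_of_gt hx))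
  have g3 : ∀ r : ℝ, 0 < r → HasDerivAt (fun r : ℝ => ((γ * r ^ (γ - 1) : ℝ) : ℂ))
      (-(((0 ^ 2 - γ * (γ - 1) / r ^ 2 : ℝ) : ℂ) * ((r ^ γ : ℝ) : ℂ))) r := by
    intro r hr
    have := ((Real.hasDerivAt_rpow_const (p := γ - 1) (Or.inl hr.ne')).const_mul γ).ofReal_comp
    refine this.congr_deriv ?_
    rw [Real.rpow_sub_one hr.ne', Real.rpow_sub_one hr.ne']
    have hrc : (r : ℂ) ≠ 0 := by exact_mod_cast hr.ne'
    push_cast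
    field_simp
    ring
  have g4 : ContDiffOn ℝ ∞ (fun r : ℝ => ((r ^ γ : ℝ) : ℂ)) (Ioi 0) := by
    refine Complex.ofRealCLM.contDiff.comp_contDiffOn ?_
    exact fun x hx => (Real.contDiffAt_rpow_const_of_ne (ne_of_gt hx)).contDiffWithinAt
  obtain ⟨C, hC⟩ := exists_wronskian_eq_const hweak g1 g2 (hd γ) g3 g4
  have key : ∀ r : ℝ, 0 < r → ((r ^ (β + γ - 1) : ℝ) : ℂ) * ((γ - β) * c) = C := by
    intro r hr
    rw [← hC r hr]
    beta_reduce
    rw [hG r hr, show β + γ - 1 = β + (γ - 1) by ring, Real.rpow_add hr,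
      Real.rpow_sub_one hr.ne', Real.rpow_sub_one hr.ne']
    push_cast
    ring
  have hs : 0 < β + γ - 1 := by
    have h1 : (1 : ℝ) ≤ (a : ℝ) + b := by
      have : 1 ≤ a + b := by omega
      exact_mod_cast this
    have h2 : (2 : ℝ) ≤ n := by exact_mod_cast hn
    rw [hβ, hγ, radialExponent, radialExponent]
    linarith
  have k1 := key 1 one_pos
  have k2 := key 2 two_pos
  rw [Real.one_rpow, ← k2] at k1
  have hlt : (1 : ℝ) < (2 : ℝ) ^ (β + γ - 1) := Real.one_lt_rpow one_lt_two hs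
  have hne : (((2 : ℝ) ^ (β + γ - 1) : ℝ) : ℂ) - 1 ≠ 0 := by
    have : (2 : ℝ) ^ (β + γ - 1) - 1 ≠ 0 := by linarith
    exact_mod_cast this
  have hz : ((((2 : ℝ) ^ (β + γ - 1) : ℝ) : ℂ) - 1) * ((γ - β) * c) = 0 := by
    push_cast at k1 ⊢
    linear_combination -k1
  have hγβ : ((γ : ℂ) - β) ≠ 0 := by
    have : γ - β ≠ 0 := by
      rw [hβ, hγ, radialExponent, radialExponent]
      have : (a : ℝ) ≠ b := by exact_mod_cast hab
      intro h; apply this; linarith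
    exact_mod_cast this
  exact (mul_eq_zero.1 ((mul_eq_zero.1 hz).resolve_left hne)).resolve_left hγβ

/-! ### Decomposition of `L²` of the sphere into spherical harmonics -/

/-- The unit sphere. -/
abbrev USphere (n : ℕ) : Type := Metric.sphere (0 : Eucl n) 1

/-- The surface measure of the unit sphere. -/
noncomputable abbrev surfaceMeasure (n : ℕ) : Measure (USphere n) :=
  (volume : Measure (Eucl n)).toSphere

/-- The restriction of a continuous function to the unit sphere. -/
def sphereRestrict (Y : Eucl n → ℂ) (hY : Continuous Y) : C(USphere n, ℂ) :=
  ⟨fun θ => Y θ, hY.comp continuous_subtype_val⟩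

/-- The spherical harmonics of degree `l`. -/
def sphericalHarmonics (n l : ℕ) : Set C(USphere n, ℂ) :=
  {f | ∃ (Y : Eucl n → ℂ) (hY : IsSolidHarmonic l Y), f = sphereRestrict Y hY.contDiff.continuous}

/-- The span of all spherical harmonics. -/
noncomputable def harmonicSpan (n : ℕ) : Submodule ℂ C(USphere n, ℂ) :=
  Submodule.span ℂ (⋃ l, sphericalHarmonics n l)

/-- The coordinate functions on the sphere. -/
noncomputable def sphereCoord (e : Eucl n) : C(USphere n, ℂ) :=
  sphereRestrict (fun x => ((inner ℝ x e : ℝ) : ℂ)) (contDiff_inner_coe e).continuous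

lemma IsSolidHarmonic.mem_harmonicSpan {l : ℕ} {Y : Eucl n → ℂ} (hY : IsSolidHarmonic l Y) :
    sphereRestrict Y hY.contDiff.continuous ∈ harmonicSpan n :=
  Submodule.subset_span (mem_iUnion.2 ⟨l, Y, hY, rfl⟩)

/-- On the sphere `|x|² = 1`, so `⟨x, e⟩ Y` is the sum of its harmonic part of degree `l + 1` and a
multiple of the harmonic `∂_e Y`. -/
lemma sphereCoord_mul_mem (hn : 2 ≤ n) (e : Eucl n) {q : C(USphere n, ℂ)}
    (hq : q ∈ harmonicSpan n) : sphereCoord e * q ∈ harmonicSpan n := by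
  unfold harmonicSpan at hq
  induction hq using Submodule.span_induction with
  | mem x hx =>
    obtain ⟨l, Y, hY, rfl⟩ := mem_iUnion.1 hx
    have h1 := hY.inner_mul_sub e (by omega)
    have h2 := hY.dirDeriv e
    have e1 : sphereCoord e * sphereRestrict Y hY.contDiff.continuous =
        sphereRestrict _ h1.contDiff.continuous +
          (n + 2 * l - 2 : ℂ)⁻¹ • sphereRestrict _ h2.contDiff.continuous := by
      ext θ
      simp [sphereCoord, sphereRestrict, norm_eq_of_mem_sphere]
    rw [e1]
    exact Submodule.add_mem _ h1.mem_harmonicSpan (Submodule.smul_mem _ _ h2.mem_harmonicSpan)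
  | zero => rw [mul_zero]; exact Submodule.zero_mem _
  | add x y _ _ hx hy => rw [mul_add]; exact Submodule.add_mem _ hx hy
  | smul a x _ hx => rw [mul_smul_comm]; exact Submodule.smul_mem _ _ hx

/-- Stone–Weierstrass for the algebra generated by the coordinate functions. These are real, so the
generating set is closed under conjugation. -/
lemma dense_harmonicSpan (hn : 2 ≤ n) : Dense (harmonicSpan n : Set C(USphere n, ℂ)) := by
  set s : Set C(USphere n, ℂ) := range sphereCoord with hs
  have hstar : star s ⊆ s := by
    rintro f ⟨e, he⟩
    refine ⟨e, ?_⟩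
    rw [← star_star f, ← he]
    ext θ
    simp [sphereCoord, sphereRestrict]
  set 𝒜 := StarAlgebra.adjoin ℂ s with h𝒜
  have hle : ∀ p ∈ 𝒜, p ∈ harmonicSpan n := by
    intro p hp
    have hp' : p ∈ Algebra.adjoin ℂ s := by
      have : p ∈ 𝒜.toSubalgebra := hp
      rwa [h𝒜, StarAlgebra.adjoin_toSubalgebra, union_eq_self_of_subset_right hstar] at this
    clear hp
    -- The span is not known to be closed under products; the induction instead shows that
    -- multiplication by `p` preserves it, and `q = 1` finishes.
    have key : ∀ q ∈ harmonicSpan n, p * q ∈ harmonicSpan n := by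
      induction hp' using Algebra.adjoin_induction with
      | mem x hx =>
        obtain ⟨e, rfl⟩ := hx
        exact fun q hq => sphereCoord_mul_mem hn e hq
      | algebraMap c =>
        intro q hq
        rw [← Algebra.smul_def]
        exact Submodule.smul_mem _ _ hq
      | add x y _ _ hx hy =>
        intro q hq
        rw [add_mul]
        exact Submodule.add_mem _ (hx q hq) (hy q hq)
      | mul x y _ _ hx hy =>
        intro q hq
        rw [mul_assoc]
        exact hx _ (hy q hq)
    have h1 : (1 : C(USphere n, ℂ)) ∈ harmonicSpan n := by
      have := (isSolidHarmonic_const (n := n) 1).mem_harmonicSpan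
      rwa [show sphereRestrict (fun _ : Eucl n => (1 : ℂ)) _ = 1 from rfl] at this
    simpa using key 1 h1
  have hsep : 𝒜.SeparatesPoints := by
    intro θ φ hne
    have : (θ : Eucl n) ≠ (φ : Eucl n) := fun h => hne (Subtype.ext h)
    refine ⟨sphereCoord ((θ : Eucl n) - (φ : Eucl n)), ⟨_, StarAlgebra.subset_adjoin ℂ s ⟨_, rfl⟩, rfl⟩, ?_⟩
    intro heq
    simp only [sphereCoord, sphereRestrict, ContinuousMap.coe_mk, Complex.ofReal_inj] at heq
    rw [← sub_eq_zero, ← inner_sub_left, inner_self_eq_zero, sub_eq_zero] at heq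
    exact this heq
  have htop := ContinuousMap.starSubalgebra_topologicalClosure_eq_top_of_separatesPoints 𝒜 hsep
  have hd : Dense (𝒜 : Set C(USphere n, ℂ)) := by
    intro x
    have : x ∈ 𝒜.topologicalClosure := by rw [htop]; trivial
    exact this
  exact hd.mono hle

/-- `L²` of the unit sphere. -/
noncomputable abbrev SphereL2 (n : ℕ) : Type := Lp ℂ 2 (surfaceMeasure n)

/-- The inclusion of continuous functions in `L²`. -/
noncomputable abbrev sphereToL2 (n : ℕ) : C(USphere n, ℂ) →L[ℂ] SphereL2 n :=
  ContinuousMap.toLp 2 (surfaceMeasure n) ℂ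

/-- The closed subspace of `L²` spanned by the spherical harmonics of degree `l`. -/
noncomputable def harmonicSubspace (n l : ℕ) : Submodule ℂ (SphereL2 n) :=
  (Submodule.span ℂ (sphereToL2 n '' sphericalHarmonics n l)).topologicalClosure

instance (n l : ℕ) : CompleteSpace (harmonicSubspace n l) :=
  (Submodule.isClosed_topologicalClosure _).completeSpace_coe

theorem isHilbertSum_harmonicSubspace (hn : 2 ≤ n) :
    IsHilbertSum ℂ (fun l => harmonicSubspace n l)
      (fun l => (harmonicSubspace n l).subtypeₗᵢ) := by
  refine IsHilbertSum.mkInternal _ (OrthogonalFamily.of_pairwise fun a b hab => ?_) ?_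
  · have h : Submodule.span ℂ (sphereToL2 n '' sphericalHarmonics n a) ⟂
        Submodule.span ℂ (sphereToL2 n '' sphericalHarmonics n b) := by
      rw [Submodule.isOrtho_span]
      rintro _ ⟨_, ⟨Y, hY, rfl⟩, rfl⟩ _ ⟨_, ⟨Z, hZ, rfl⟩, rfl⟩
      rw [ContinuousMap.inner_toLp]
      have := IsSolidHarmonic.integral_mul_eq_zero hn hZ hY.conj hab.symm
      simpa [sphereRestrict] using this
    change harmonicSubspace n a ≤ (harmonicSubspace n b)ᗮ
    unfold harmonicSubspace
    rw [Submodule.orthogonal_closure]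
    exact Submodule.topologicalClosure_minimal _ h (Submodule.isClosed_orthogonal _)
  · have hdense : Dense (sphereToL2 n '' (harmonicSpan n : Set C(USphere n, ℂ))) :=
      (ContinuousMap.toLp_denseRange ℂ (surfaceMeasure n) ℂ (by simp)).dense_image
        (sphereToL2 n).continuous (dense_harmonicSpan hn)
    have hsub : sphereToL2 n '' (harmonicSpan n : Set C(USphere n, ℂ)) ⊆
        ((⨆ l, harmonicSubspace n l : Submodule ℂ (SphereL2 n)) : Set (SphereL2 n)) := by
      have hle : harmonicSpan n ≤
          (⨆ l, harmonicSubspace n l).comap (sphereToL2 n : C(USphere n, ℂ) →ₗ[ℂ] SphereL2 n) := by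
        refine Submodule.span_le.2 fun f hf => ?_
        obtain ⟨l, hl⟩ := mem_iUnion.1 hf
        refine Submodule.mem_iSup_of_mem l (Submodule.le_topologicalClosure _ ?_)
        exact Submodule.subset_span ⟨f, hl, rfl⟩
      rintro _ ⟨f, hf, rfl⟩
      exact hle hf
    have := hdense.mono hsub
    exact (Submodule.dense_iff_topologicalClosure_eq_top.1 this).ge

/-- If every spherical harmonic of degree `l` sees `f` as a multiple of `g`, then so do the
components of degree `l`. -/
lemma component_eq_smul (hn : 2 ≤ n) {l : ℕ} {f g : C(USphere n, ℂ)} {c : ℂ}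
    (h : ∀ Y : Eucl n → ℂ, IsSolidHarmonic l Y →
      ∫ θ, f θ * Y θ ∂(surfaceMeasure n) = c * ∫ θ, g θ * Y θ ∂(surfaceMeasure n)) :
    (isHilbertSum_harmonicSubspace hn).linearIsometryEquiv (sphereToL2 n f) l =
      c • (isHilbertSum_harmonicSubspace hn).linearIsometryEquiv (sphereToL2 n g) l := by
  set Φ := (isHilbertSum_harmonicSubspace hn).linearIsometryEquiv with hΦ
  set z : SphereL2 n := sphereToL2 n f - c • sphereToL2 n g with hz
  have hint : ∀ p q : C(USphere n, ℂ), Integrable (fun θ => p θ * q θ) (surfaceMeasure n) :=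
    fun p q => (p.continuous.mul q.continuous).integrable_of_hasCompactSupport
      (HasCompactSupport.of_compactSpace _)
  -- The inner product conjugates its first entry, so the hypothesis is used for the conjugate
  -- harmonic.
  have hzo : z ∈ (harmonicSubspace n l)ᗮ := by
    unfold harmonicSubspace
    rw [Submodule.orthogonal_closure, Submodule.mem_orthogonal]
    intro u hu
    induction hu using Submodule.span_induction with
    | mem x hx =>
      obtain ⟨_, ⟨Y, hY, rfl⟩, rfl⟩ := hx
      rw [hz, inner_sub_right, inner_smul_right, ContinuousMap.inner_toLp,
        ContinuousMap.inner_toLp]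
      have := h _ hY.conj
      simp only [sphereRestrict, ContinuousMap.coe_mk]
      rw [this, sub_self]
    | zero => exact inner_zero_left _
    | add x y _ _ hx hy => rw [inner_add_left, hx, hy, add_zero]
    | smul a x _ hx => rw [inner_smul_left, hx, mul_zero]
  have hcomp : ∀ y : harmonicSubspace n l, inner ℂ y (Φ z l) = 0 := by
    intro y
    rw [← lp.inner_single_left (G := fun l => harmonicSubspace n l) l y (Φ z),
      ← Φ.symm.inner_map_map, LinearIsometryEquiv.symm_apply_apply, hΦ,
      IsHilbertSum.linearIsometryEquiv_symm_apply_single]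
    exact hzo y y.2
  have h0 : Φ z l = 0 := inner_self_eq_zero.1 (hcomp (Φ z l))
  rw [hz, map_sub, map_smul] at h0
  exact sub_eq_zero.1 h0

lemma radialExponent_pos (hn : 2 ≤ n) (l : ℕ) : 0 < radialExponent n l := by
  have h2 : (2 : ℝ) ≤ n := by exact_mod_cast hn
  have : (0 : ℝ) ≤ l := Nat.cast_nonneg l
  unfold radialExponent
  linarith

/-- Parseval's identity for the angular components of a radiating field. -/
theorem IsRadiatingField.exists_hasSum (hn : 2 ≤ n) {k R : ℝ} (hk : 0 < k) (hR : 0 ≤ R)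
    {v : Eucl n → ℂ} {A : USphere n → ℂ} (H : IsRadiatingField k R v A) :
    ∃ a : ℕ → ℝ, (∀ l, 0 ≤ a l) ∧
      HasSum a (‖sphereToL2 n ⟨A, H.continuous_farField hR⟩‖ ^ 2) ∧
      ∀ (r : ℝ) (hr : R < r),
        HasSum (fun l => ‖outgoing k (radialExponent n l) r‖ ^ 2 * a l)
          (‖sphereToL2 n ((r ^ (((n : ℝ) - 1) / 2) : ℝ) •
            (⟨_, H.continuous_slice hR hr⟩ : C(USphere n, ℂ)))‖ ^ 2) := by
  set Φ := (isHilbertSum_harmonicSubspace hn).linearIsometryEquiv with hΦ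
  set fA : C(USphere n, ℂ) := ⟨A, H.continuous_farField hR⟩ with hfA
  have hsum : ∀ f : SphereL2 n, HasSum (fun l => ‖Φ f l‖ ^ 2) (‖f‖ ^ 2) := by
    intro f
    have := lp.hasSum_norm (E := fun l => harmonicSubspace n l) (p := 2) (by norm_num) (Φ f)
    simpa using this
  refine ⟨fun l => ‖Φ (sphereToL2 n fA) l‖ ^ 2, fun l => by positivity, hsum _, fun r hr => ?_⟩
  set f : C(USphere n, ℂ) := (r ^ (((n : ℝ) - 1) / 2) : ℝ) •
    (⟨_, H.continuous_slice hR hr⟩ : C(USphere n, ℂ)) with hf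
  have hcomp : ∀ l, Φ (sphereToL2 n f) l =
      outgoing k (radialExponent n l) r • Φ (sphereToL2 n fA) l := by
    intro l
    refine component_eq_smul hn fun Y hY => ?_
    have := H.sphere_integral_eq (by omega) hk hR hY
      (isOutgoing_outgoing hk (radialExponent_pos hn l)) hr
    rw [mul_comm (outgoing _ _ _)]
    refine Eq.trans ?_ this
    rw [← integral_const_mul]
    refine integral_congr_ae (Eventually.of_forall fun θ => ?_)
    simp only [hf, ContinuousMap.smul_apply, ContinuousMap.coe_mk, Complex.real_smul]
    ring
  have := hsum (sphereToL2 n f)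
  simp only [hcomp, norm_smul, mul_pow] at this
  exact this

/-! ### Uniform estimates for the radial solutions -/

/-- Low modes: the pointwise bound is monotone in `b` and antitone in `r`, so it may be evaluated at
`b = N`, `r = R`. -/
lemma norm_outgoing_sq_le_of_le {k b r : ℝ} (hk : 0 < k) (hb : 0 < b) {R N : ℝ} (hR : 0 < R)
    (hRr : R ≤ r) (hbN : b ≤ N) :
    ‖outgoing k b r‖ ^ 2 ≤ (2 * max 1 (N / (2 * k * R))) ^ (2 * N) := by
  have hr : 0 < r := hR.trans_le hRr
  have h1 := norm_outgoing_le hk hb hr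
  have hM : max 1 (b / (2 * k * r)) ≤ max 1 (N / (2 * k * R)) := by
    refine max_le_max le_rfl ?_
    have : 0 < N := hb.trans_le hbN
    gcongr
  have hM1 : (1 : ℝ) ≤ 2 * max 1 (N / (2 * k * R)) := by
    have := le_max_left 1 (N / (2 * k * R)); linarith
  have h2 : ‖outgoing k b r‖ ≤ (2 * max 1 (N / (2 * k * R))) ^ N :=
    calc _ ≤ (2 * max 1 (b / (2 * k * r))) ^ b := h1
      _ ≤ (2 * max 1 (N / (2 * k * R))) ^ b := by gcongr
      _ ≤ _ := Real.rpow_le_rpow_of_exponent_le hM1 hbN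
  calc ‖outgoing k b r‖ ^ 2 ≤ ((2 * max 1 (N / (2 * k * R))) ^ N) ^ 2 := by gcongr
    _ = _ := by
      rw [← Real.rpow_natCast, ← Real.rpow_mul (by positivity)]
      congr 1; push_cast; ring

lemma div_rpow_le_exp {c b : ℝ} (hc : 0 < c) (hb : 0 < b) : (c / b) ^ b ≤ Real.exp c := by
  rw [Real.rpow_def_of_pos (by positivity), Real.exp_le_exp]
  have := Real.log_le_sub_one_of_pos (x := c / b) (by positivity)
  calc Real.log (c / b) * b ≤ (c / b) * b := by gcongr; linarith
    _ = c := by field_simp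

/-- High modes: compare on the interval from `r` to `b/(2k)`, where the growing barrier at `Br` is
super-exponentially small in `b`. -/
lemma norm_outgoing_sq_le_of_ge {k b r R B N : ℝ} (hk : 0 < k) (hB : 1 < B) (hR : 0 < R)
    (hr : R ≤ r) (hr2 : r ≤ 2 * R) (hN : max 6 (4 * k * B * R) ≤ N) (hb : N ≤ b) :
    ‖outgoing k b (B * r)‖ ^ 2 ≤
      B ^ (-N) * (‖outgoing k b r‖ ^ 2 + Real.exp (16 * k * B ^ 2 * R)) := by
  have hB0 : 0 < B := by linarith
  have hr0 : 0 < r := hR.trans_le hr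
  have hb6 : 6 ≤ b := (le_max_left _ _).trans (hN.trans hb)
  have hb4 : 4 * k * B * R ≤ b := (le_max_right _ _).trans (hN.trans hb)
  have hb0 : 0 < b := by linarith
  -- The largest radius allowed in `IsOutgoing.norm_sq_le`; there `norm_outgoing_le` gives just
  -- `2^b`. The condition `4kBR ≤ b` ensures `Br ≤ t` for all `r ≤ 2R`.
  set t := b / (2 * k) with ht
  have ht0 : 0 < t := by positivity
  have hkt : 2 * k * t = b := by rw [ht]; field_simp
  have hBt : B * r ≤ t := by
    rw [ht, le_div_iff₀ (by positivity)]
    nlinarith [mul_pos hk hB0]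
  have h1 := (isOutgoing_outgoing hk hb0).norm_sq_le hb6 hk hr0 (by nlinarith : r ≤ B * r) hBt
    hkt.le
  have h2 : ‖outgoing k b t‖ ^ 2 ≤ 4 ^ b := by
    have h := norm_outgoing_le hk hb0 ht0
    rw [hkt, div_self hb0.ne', max_self, mul_one] at h
    calc ‖outgoing k b t‖ ^ 2 ≤ ((2 : ℝ) ^ b) ^ 2 := by gcongr
      _ = 4 ^ b := by
        rw [← Real.rpow_natCast, ← Real.rpow_mul two_pos.le, mul_comm, Real.rpow_mul two_pos.le]
        norm_num
  -- The base is `8kBr/b ≤ B⁻¹ · 16kB²R/b`; splitting off `B⁻¹` and using `(c/b)^b ≤ e^c` leaves a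
  -- factor independent of `b`.
  have h3 : (4 : ℝ) ^ b * (B * r / t) ^ b ≤ B ^ (-b) * Real.exp (16 * k * B ^ 2 * R) := by
    rw [← Real.mul_rpow (by positivity) (by positivity)]
    calc (4 * (B * r / t)) ^ b ≤ (B⁻¹ * (16 * k * B ^ 2 * R / b)) ^ b := by
          refine Real.rpow_le_rpow (by positivity) ?_ hb0.le
          have e : 4 * (B * r / t) = 8 * k * B * r / b := by
            rw [ht]; field_simp; ring
          have e2 : B⁻¹ * (16 * k * B ^ 2 * R / b) = 8 * k * B * (2 * R) / b := by
            field_simp; ring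
          rw [e, e2]
          gcongr
      _ = B ^ (-b) * (16 * k * B ^ 2 * R / b) ^ b := by
          rw [Real.mul_rpow (by positivity) (by positivity), Real.inv_rpow hB0.le,
            Real.rpow_neg hB0.le]
      _ ≤ _ := by
          gcongr
          exact div_rpow_le_exp (by positivity) hb0
  have h4 : (B : ℝ) ^ (-b) ≤ B ^ (-N) :=
    Real.rpow_le_rpow_of_exponent_le hB.le (by linarith)
  rw [mul_div_assoc, div_self hr0.ne', mul_one] at h1
  calc _ ≤ ‖outgoing k b r‖ ^ 2 * B ^ (-b) + ‖outgoing k b t‖ ^ 2 * (B * r / t) ^ b := h1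
    _ ≤ ‖outgoing k b r‖ ^ 2 * B ^ (-b) + 4 ^ b * (B * r / t) ^ b := by gcongr
    _ ≤ ‖outgoing k b r‖ ^ 2 * B ^ (-b) + B ^ (-b) * Real.exp (16 * k * B ^ 2 * R) := by gcongr
    _ = B ^ (-b) * (‖outgoing k b r‖ ^ 2 + Real.exp (16 * k * B ^ 2 * R)) := by ring
    _ ≤ _ := by gcongr

lemma norm_outgoing_sq_le {k b r R B N : ℝ} (hk : 0 < k) (hb : 0 < b) (hB : 1 < B) (hR : 0 < R)
    (hr : R ≤ r) (hr2 : r ≤ 2 * R) (hN : max 6 (4 * k * B * R) ≤ N) :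
    ‖outgoing k b (B * r)‖ ^ 2 ≤ ((2 * max 1 (N / (2 * k * R))) ^ (2 * N) +
      Real.exp (16 * k * B ^ 2 * R)) + B ^ (-N) * ‖outgoing k b r‖ ^ 2 := by
  have hB0 : 0 < B := by linarith
  have h0 : 0 ≤ B ^ (-N) * ‖outgoing k b r‖ ^ 2 := by positivity
  have h1 : (0 : ℝ) ≤ (2 * max 1 (N / (2 * k * R))) ^ (2 * N) := by positivity
  have h2 := Real.exp_pos (16 * k * B ^ 2 * R)
  rcases le_total b N with h | h
  · have := norm_outgoing_sq_le_of_le (r := B * r) hk hb hR (by nlinarith) h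
    linarith
  · have h3 := norm_outgoing_sq_le_of_ge hk hB hR hr hr2 hN h
    have hN0 : 0 ≤ N := by linarith [le_max_left 6 (4 * k * B * R)]
    have h4 : (B : ℝ) ^ (-N) ≤ 1 := Real.rpow_le_one_of_one_le_of_nonpos hB.le (by linarith)
    nlinarith

/-- The growth of the low modes is dominated by a Gaussian. -/
lemma exists_forall_rpow_mul_exp_le {k R B N₀ : ℝ} (hk : 0 < k) (hR : 0 < R) (hB : 1 < B)
    (hN₀ : 0 ≤ N₀) :
    ∃ C, 0 < C ∧ ∀ T : ℝ, 0 ≤ T →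
      (2 * max 1 ((2 * T + N₀) / (2 * k * R))) ^ (2 * (2 * T + N₀)) * B ^ (2 * T) *
        Real.exp (-(4 * T ^ 2 / (Real.exp 1 * k * R))) ≤ C := by
  set e := Real.exp 1 with he
  have he1 : 1 ≤ e := Real.one_le_exp zero_le_one
  have he0 : 0 < e := Real.exp_pos 1
  -- From `ln M ≤ M/K + ln K` and `M ≤ 2 + N/(kR)`, the quadratic part of `2N ln M` is `2N²/(KkR)`.
  -- With `K = 8e` its `T²` coefficient is `δ`, a quarter of the `4δ` in the Gaussian; the remaining
  -- `-3δT²` absorbs all linear terms.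
  set K := 8 * e with hK
  have hK0 : 0 < K := by positivity
  have hlK : 0 ≤ Real.log K := Real.log_nonneg (by linarith)
  set δ := 1 / (e * k * R) with hδ
  have hδ0 : 0 < δ := by positivity
  set a := 8 / K + δ * N₀ + 4 * Real.log K + 2 * Real.log B with ha
  set b := 4 * N₀ / K + δ * N₀ ^ 2 / 4 + 2 * N₀ * Real.log K with hb
  refine ⟨Real.exp (b + a ^ 2 / (12 * δ)), Real.exp_pos _, fun T hT => ?_⟩
  set N := 2 * T + N₀ with hN
  have hN0 : 0 ≤ N := by positivity
  set M := 2 * max 1 (N / (2 * k * R)) with hM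
  have hM0 : 0 < M := by positivity
  have hM2 : M ≤ 2 + N / (k * R) := by
    have h1 : N / (k * R) = 2 * (N / (2 * k * R)) := by field_simp
    have h2 : 0 ≤ N / (2 * k * R) := by positivity
    have h3 : max 1 (N / (2 * k * R)) ≤ 1 + N / (2 * k * R) := max_le (by linarith) (by linarith)
    rw [h1, hM]; linarith
  have hlog : Real.log M ≤ M / K + Real.log K := by
    have h1 := Real.log_le_sub_one_of_pos (x := M / K) (by positivity)
    rw [Real.log_div hM0.ne' hK0.ne'] at h1
    linarith
  rw [Real.rpow_def_of_pos hM0, Real.rpow_def_of_pos (by linarith : 0 < B), ← Real.exp_add,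
    ← Real.exp_add, Real.exp_le_exp]
  have h1 : Real.log M * (2 * N) ≤ ((2 + N / (k * R)) / K + Real.log K) * (2 * N) := by
    gcongr
    refine hlog.trans ?_
    gcongr
  have h2 : ((2 + N / (k * R)) / K + Real.log K) * (2 * N) =
      δ * T ^ 2 + (8 / K + δ * N₀ + 4 * Real.log K) * T + b := by
    rw [hb, hN, hδ, hK]
    field_simp
    ring
  have h3 : 4 * T ^ 2 / (e * k * R) = 4 * δ * T ^ 2 := by rw [hδ]; field_simp
  have h4 : a * T - 3 * δ * T ^ 2 ≤ a ^ 2 / (12 * δ) := by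
    rw [le_div_iff₀ (by positivity)]
    nlinarith [sq_nonneg (a - 6 * δ * T)]
  rw [h3]
  have h5 : Real.log B * (2 * T) = 2 * Real.log B * T := by ring
  rw [h5]
  have h6 : a * T = (8 / K + δ * N₀ + 4 * Real.log K) * T + 2 * Real.log B * T := by
    rw [ha]; ring
  linarith

/-! ### Energy of a field on spheres and annuli -/

/-- The square of the `L²` norm of `v` on the sphere of radius `r`. -/
noncomputable def sphereEnergy (v : Eucl n → ℂ) (r : ℝ) : ENNReal :=
  ENNReal.ofReal (r ^ (n - 1)) * ∫⁻ θ : USphere n, ‖v (r • (θ : Eucl n))‖ₑ ^ 2 ∂surfaceMeasure n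

lemma normL2_sq (D : Set (Eucl n)) (f : Eucl n → ℂ) :
    normL2 D f ^ 2 = ∫⁻ x in D, ‖f x‖ₑ ^ 2 := by
  have h := eLpNorm_nnreal_pow_eq_lintegral (μ := volume.restrict D) (f := f) (p := 2) two_ne_zero
  simpa [normL2] using h

lemma enorm_sphereToL2 (f : C(USphere n, ℂ)) :
    ‖sphereToL2 n f‖ₑ = eLpNorm f 2 (surfaceMeasure n) := by
  rw [Lp.enorm_def]
  exact eLpNorm_congr_ae (ContinuousMap.coeFn_toLp (p := 2) (surfaceMeasure n) (𝕜 := ℂ) f)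

lemma norm_sphereToL2_sq (f : C(USphere n, ℂ)) :
    ENNReal.ofReal (‖sphereToL2 n f‖ ^ 2) = ∫⁻ θ, ‖f θ‖ₑ ^ 2 ∂surfaceMeasure n := by
  rw [ENNReal.ofReal_pow (norm_nonneg _), ofReal_norm, enorm_sphereToL2]
  have h := eLpNorm_nnreal_pow_eq_lintegral (μ := surfaceMeasure n) (f := f) (p := 2) two_ne_zero
  simpa using h

lemma sphereEnergy_eq (hn : 1 ≤ n) {v : Eucl n → ℂ} {r : ℝ} (hr : 0 ≤ r)
    (hv : Continuous fun θ : USphere n => v (r • (θ : Eucl n))) :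
    sphereEnergy v r = ENNReal.ofReal
      (‖sphereToL2 n ((r ^ (((n:ℝ)-1)/2) : ℝ) • (⟨_, hv⟩ : C(USphere n,ℂ)))‖ ^ 2) := by
  rw [norm_sphereToL2_sq, sphereEnergy, ← lintegral_const_mul' _ _ ENNReal.ofReal_ne_top]
  refine lintegral_congr fun θ => ?_
  have h1 : r ^ (n - 1) = (r ^ (((n:ℝ)-1)/2)) ^ 2 := by
    rw [← Real.rpow_natCast, ← Real.rpow_natCast, ← Real.rpow_mul hr, Nat.cast_sub hn]
    congr 1; push_cast; ring
  have h2 : 0 ≤ r ^ (((n:ℝ)-1)/2) := by positivity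
  rw [ContinuousMap.smul_apply, enorm_smul, mul_pow, h1, ENNReal.ofReal_pow h2,
    Real.enorm_of_nonneg h2]
  rfl

theorem normL2_annulus_sq (hn : 1 ≤ n) {R a : ℝ} (hR : 0 < R) (ha : R ≤ a) (b : ℝ)
    {w v : Eucl n → ℂ} (hv : ContinuousOn v (exterior n R))
    (hwv : w =ᵐ[volume.restrict (exterior n R)] v) :
    normL2 (annulus n a b) w ^ 2 = ∫⁻ r in Ioo a b, sphereEnergy v r := by
  have : Nonempty (Fin n) := ⟨⟨0, hn⟩⟩
  have : Nontrivial (Eucl n) := inferInstance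
  have ha0 : 0 < a := hR.trans_le ha
  set D : Set (Eucl n) := {x | ‖x‖ ∈ Ioo a b} with hD
  have hDm : MeasurableSet D := measurableSet_Ioo.preimage measurable_norm
  have hDext : D ⊆ exterior n R := by
    intro x hx
    simp only [exterior, mem_compl_iff, Metric.mem_closedBall, dist_zero_right, not_le]
    exact ha.trans_lt hx.1
  -- The annulus contains its inner sphere, which for `a = R` lies outside the domain of `v`;
  -- discarding this null set leaves only exterior points.
  have hDa : annulus n a b =ᵐ[volume] D := by
    have h0 := Measure.addHaar_sphere (volume : Measure (Eucl n)) 0 a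
    have h1 : ∀ᵐ x : Eucl n, x ∉ Metric.sphere (0 : Eucl n) a := measure_eq_zero_iff_ae_notMem.1 h0
    refine eventuallyEq_set.2 ?_
    filter_upwards [h1] with x hx
    simp only [annulus, hD, Set.mem_sdiff, Metric.mem_ball, dist_zero_right, mem_sphere_iff_norm,
      sub_zero, not_lt, mem_ofPred_eq, mem_Ioo] at hx ⊢
    constructor
    · rintro ⟨h1, h2⟩; exact ⟨lt_of_le_of_ne h2 (Ne.symm hx), h1⟩
    · rintro ⟨h1, h2⟩; exact ⟨h2, h1.le⟩
  have hvm : Measurable (D.indicator fun x => ‖v x‖ₑ ^ 2) := by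
    classical
    rw [← piecewise_eq_indicator]
    have hc : ContinuousOn (fun x => ‖v x‖ₑ ^ 2) D :=
      (ENNReal.continuous_pow 2).comp_continuousOn (hv.mono hDext).enorm
    exact hc.measurable_piecewise continuousOn_const hDm
  calc normL2 (annulus n a b) w ^ 2 = ∫⁻ x in annulus n a b, ‖w x‖ₑ ^ 2 := normL2_sq _ _
    _ = ∫⁻ x in D, ‖w x‖ₑ ^ 2 := by rw [Measure.restrict_congr_set hDa]
    _ = ∫⁻ x in D, ‖v x‖ₑ ^ 2 := by
      refine lintegral_congr_ae ?_
      filter_upwards [ae_restrict_of_ae_restrict_of_subset hDext hwv] with x hx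
      rw [hx]
    _ = ∫⁻ x, D.indicator (fun x => ‖v x‖ₑ ^ 2) x := (lintegral_indicator hDm _).symm
    _ = ∫⁻ r in Ioi (0 : ℝ), (Ioo a b).indicator (sphereEnergy v) r := by
      rw [lintegral_polar volume hvm]
      refine setLIntegral_congr_fun measurableSet_Ioi fun r hr => ?_
      have hmem : ∀ θ : USphere n, r • (θ : Eucl n) ∈ D ↔ r ∈ Ioo a b := by
        intro θ
        simp only [hD, mem_ofPred_eq, norm_smul_sphere (le_of_lt hr) θ]
      by_cases h : r ∈ Ioo a b
      · simp only [h, indicator_of_mem, (hmem _).2 h, sphereEnergy, finrank_euclideanSpace_fin]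
      · simp only [h, indicator_of_notMem, mt (hmem _).1 h, not_false_eq_true, lintegral_zero,
          mul_zero]
    _ = ∫⁻ r in Ioo a b, sphereEnergy v r := by
      rw [setLIntegral_indicator measurableSet_Ioo,
        inter_eq_self_of_subset_left (Ioo_subset_Ioi_self.trans (Ioi_subset_Ioi ha0.le))]

lemma lintegral_Ioo_mul {B : ℝ} (hB : 0 < B) (a b : ℝ) (f : ℝ → ENNReal) :
    ∫⁻ s in Ioo (B * a) (B * b), f s = ENNReal.ofReal B * ∫⁻ r in Ioo a b, f (B * r) := by
  rw [← image_mul_left_Ioo hB, lintegral_image_eq_lintegral_abs_deriv_mul measurableSet_Ioo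
    (f := fun x => B * x) (fun x _ => ((hasDerivAt_id' x).const_mul B).hasDerivWithinAt)
    (fun x _ y _ h => mul_left_cancel₀ hB.ne' h)]
  simp only [mul_one, abs_of_pos hB]
  exact lintegral_const_mul' _ _ ENNReal.ofReal_ne_top

section Estimate

variable {k R : ℝ} {v : Eucl n → ℂ} {A : USphere n → ℂ}

/-- Rellich's lemma: a zero far field has only zero coefficients `a_l`, hence every mode of the
field vanishes. -/
lemma IsRadiatingField.sphereEnergy_eq_zero (hn : 2 ≤ n) (hk : 0 < k) (hR : 0 ≤ R)
    (H : IsRadiatingField k R v A) (hA : normL2Sphere A = 0) {r : ℝ} (hr : R < r) :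
    sphereEnergy v r = 0 := by
  obtain ⟨a, ha, hs, h⟩ := H.exists_hasSum hn hk hR
  have hz : ‖sphereToL2 n ⟨A, H.continuous_farField hR⟩‖ = 0 := by
    rw [← toReal_enorm, enorm_sphereToL2]
    change (normL2Sphere A).toReal = 0
    rw [hA, ENNReal.toReal_zero]
  rw [hz, zero_pow two_ne_zero, hasSum_zero_iff_of_nonneg ha] at hs
  have h1 := h r hr
  simp only [hs, Pi.zero_apply, mul_zero] at h1
  rw [sphereEnergy_eq (by omega) (hR.trans hr.le) (H.continuous_slice hR hr),
    h1.unique hasSum_zero, ENNReal.ofReal_zero]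

/-- The radial inequality of `norm_outgoing_sq_le` holds for every mode with the same constants, so
it can be summed against `a_l` term by term. -/
lemma IsRadiatingField.sphereEnergy_mul_le (hn : 2 ≤ n) (hk : 0 < k) (hR : 0 < R)
    (H : IsRadiatingField k R v A) {ε : ℝ} (hε : 0 ≤ ε) (hA : normL2Sphere A = ENNReal.ofReal ε)
    {B N r : ℝ} (hB : 1 < B) (hN : max 6 (4 * k * B * R) ≤ N) (hr : R < r) (hr2 : r ≤ 2 * R) :
    sphereEnergy v (B * r) ≤ ENNReal.ofReal
        (((2 * max 1 (N / (2 * k * R))) ^ (2 * N) + Real.exp (16 * k * B ^ 2 * R)) * ε ^ 2) +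
      ENNReal.ofReal (B ^ (-N)) * sphereEnergy v r := by
  obtain ⟨a, ha, hs, h⟩ := H.exists_hasSum hn hk hR.le
  have hz : ‖sphereToL2 n ⟨A, H.continuous_farField hR.le⟩‖ = ε := by
    rw [← toReal_enorm, enorm_sphereToL2]
    change (normL2Sphere A).toReal = ε
    rw [hA, ENNReal.toReal_ofReal hε]
  rw [hz] at hs
  have hBr : R < B * r := by nlinarith
  have hM : 0 ≤ (2 * max 1 (N / (2 * k * R))) ^ (2 * N) := by positivity
  rw [sphereEnergy_eq (by omega) (hR.le.trans hr.le) (H.continuous_slice hR.le hr),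
    sphereEnergy_eq (by omega) (hR.le.trans hBr.le) (H.continuous_slice hR.le hBr),
    ← ENNReal.ofReal_mul (by positivity), ← ENNReal.ofReal_add (by positivity) (by positivity)]
  refine ENNReal.ofReal_le_ofReal (hasSum_le (fun l => ?_) (h _ hBr)
    ((hs.mul_left _).add ((h r hr).mul_left _)))
  have := norm_outgoing_sq_le hk (radialExponent_pos hn l) hB hR hr.le hr2 hN
  calc _ ≤ _ := mul_le_mul_of_nonneg_right this (ha l)
    _ = _ := by ring

theorem IsRadiatingField.normL2_annulus_sq_le (hn : 2 ≤ n) (hk : 0 < k) (hR : 0 < R)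
    (H : IsRadiatingField k R v A) {w : Eucl n → ℂ}
    (hwv : w =ᵐ[volume.restrict (exterior n R)] v) {S ε : ℝ} (hS : 0 ≤ S) (hε : 0 ≤ ε)
    (hw : normL2 (annulus n R (2 * R)) w ≤ ENNReal.ofReal S)
    (hA : normL2Sphere A = ENNReal.ofReal ε) {B N : ℝ} (hB : 1 < B)
    (hN : max 6 (4 * k * B * R) ≤ N) :
    normL2 (annulus n (B * R) (2 * B * R)) w ^ 2 ≤ ENNReal.ofReal
      (B * (((2 * max 1 (N / (2 * k * R))) ^ (2 * N) + Real.exp (16 * k * B ^ 2 * R)) * ε ^ 2 * R +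
        B ^ (-N) * S ^ 2)) := by
  have hB0 : 0 < B := one_pos.trans hB
  have hM : 0 ≤ (2 * max 1 (N / (2 * k * R))) ^ (2 * N) := by positivity
  set M := ((2 * max 1 (N / (2 * k * R))) ^ (2 * N) + Real.exp (16 * k * B ^ 2 * R)) * ε ^ 2 with hMd
  have hM0 : 0 ≤ M := by positivity
  have hvc := H.contDiffOn.continuousOn
  rw [normL2_annulus_sq (by omega) hR (by nlinarith : R ≤ B * R) _ hvc hwv,
    show 2 * B * R = B * (2 * R) by ring, lintegral_Ioo_mul hB0, ENNReal.ofReal_mul hB0.le]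
  gcongr
  calc ∫⁻ r in Ioo R (2 * R), sphereEnergy v (B * r)
      ≤ ∫⁻ r in Ioo R (2 * R), (ENNReal.ofReal M + ENNReal.ofReal (B ^ (-N)) * sphereEnergy v r) :=
        setLIntegral_mono' measurableSet_Ioo fun r hr =>
          H.sphereEnergy_mul_le hn hk hR hε hA hB hN hr.1 hr.2.le
    _ = ENNReal.ofReal (M * R) +
        ENNReal.ofReal (B ^ (-N)) * normL2 (annulus n R (2 * R)) w ^ 2 := by
      rw [lintegral_add_left measurable_const, lintegral_const_mul' _ _ ENNReal.ofReal_ne_top,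
        ← normL2_annulus_sq (by omega) hR le_rfl _ hvc hwv, setLIntegral_const, Real.volume_Ioo,
        ENNReal.ofReal_mul hM0]
      congr 3; ring
    _ ≤ ENNReal.ofReal (M * R) + ENNReal.ofReal (B ^ (-N)) * ENNReal.ofReal S ^ 2 := by gcongr
    _ = _ := by
      rw [← ENNReal.ofReal_pow hS, ← ENNReal.ofReal_mul (by positivity),
        ← ENNReal.ofReal_add (by positivity) (by positivity)]

end Estimate

/-! ### Choice of the threshold and the final estimate -/

/-- `N` balances the amplified far field, `Φ ε²` with `Φ` the low-mode factor, against the tail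
`B^(-N) S²`. Everything depends on `k`, `R`, `B` and `S/ε` only, which keeps the constant free of
the dimension. -/
lemma exists_energy_le {k R B : ℝ} (hk : 0 < k) (hR : 0 < R) (hB : 1 < B) :
    ∃ C : ℝ, 1 ≤ C ∧ ∀ S ε : ℝ, 0 < ε → ε < S → ∃ N : ℝ, max 6 (4 * k * B * R) ≤ N ∧
      B * (((2 * max 1 (N / (2 * k * R))) ^ (2 * N) + Real.exp (16 * k * B ^ 2 * R)) * ε ^ 2 * R +
        B ^ (-N) * S ^ 2) ≤
      (C * S * B ^ (-(1 / 2) * Real.sqrt (2 * Real.exp 1 * k * R * Real.log (S / ε)))) ^ 2 := by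
  have hB0 : 0 < B := one_pos.trans hB
  set N₀ : ℝ := max 6 (4 * k * B * R) with hN₀d
  have hN₀ : 0 ≤ N₀ := by positivity
  obtain ⟨K, hK, h⟩ := exists_forall_rpow_mul_exp_le hk hR hB hN₀
  set E := Real.exp (16 * k * B ^ 2 * R) with hE
  have hE0 : 0 < E := Real.exp_pos _
  -- The final bound is `X S² q` with `X = B (RK(1+E) + 1)`; taking `C = 1 + X` gives both `C ≥ 1`
  -- and `X ≤ C²`.
  refine ⟨1 + B * (R * K * (1 + E) + 1), ?_, fun S ε hε hS => ?_⟩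
  · have : 0 ≤ B * (R * K * (1 + E) + 1) := by positivity
    linarith
  set C := 1 + B * (R * K * (1 + E) + 1) with hC
  have hS0 : 0 < S := hε.trans hS
  have hL : 0 ≤ Real.log (S / ε) := Real.log_nonneg ((one_le_div hε).2 hS.le)
  set T := (1 / 2) * Real.sqrt (2 * Real.exp 1 * k * R * Real.log (S / ε)) with hT
  have hT0 : 0 ≤ T := by positivity
  have hTsq : 4 * T ^ 2 = 2 * Real.exp 1 * k * R * Real.log (S / ε) := by
    rw [hT, mul_pow, Real.sq_sqrt (by positivity)]; ring
  have hεS : ε ^ 2 = S ^ 2 * Real.exp (-(4 * T ^ 2 / (Real.exp 1 * k * R))) := by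
    have h1 : 4 * T ^ 2 / (Real.exp 1 * k * R) = 2 * Real.log (S / ε) := by
      rw [hTsq]; field_simp
    rw [h1, Real.exp_neg, two_mul, Real.exp_add, Real.exp_log (by positivity)]
    field_simp
  -- `2T` because the bound is squared: the target `B^(-T)` becomes `B^(-2T)`. The shift `N₀` makes
  -- the threshold admissible also for small `T`.
  refine ⟨2 * T + N₀, by linarith, ?_⟩
  set Φ := (2 * max 1 ((2 * T + N₀) / (2 * k * R))) ^ (2 * (2 * T + N₀)) with hΦ
  have hΦ1 : 1 ≤ Φ := by
    refine Real.one_le_rpow ?_ (by positivity)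
    have := le_max_left 1 ((2 * T + N₀) / (2 * k * R)); linarith
  set q := B ^ (-(2 * T)) with hq
  have hq0 : 0 < q := by positivity
  have hqB : B ^ (2 * T) * q = 1 := by
    rw [hq, ← Real.rpow_add hB0]; simp
  have hΦε : Φ * ε ^ 2 ≤ K * S ^ 2 * q := by
    have h1 := mul_le_mul_of_nonneg_right (h T hT0) (by positivity : 0 ≤ S ^ 2 * q)
    calc Φ * ε ^ 2 = Φ * ε ^ 2 * (B ^ (2 * T) * q) := by rw [hqB, mul_one]
      _ = Φ * B ^ (2 * T) * Real.exp (-(4 * T ^ 2 / (Real.exp 1 * k * R))) * (S ^ 2 * q) := by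
        rw [hεS]; ring
      _ ≤ _ := h1
      _ = _ := by ring
  -- As `Φ ≥ 1`, the same bound holds for `ε²` alone, which handles the term with `E`.
  have hεq : ε ^ 2 ≤ K * S ^ 2 * q :=
    (le_mul_of_one_le_left (by positivity) hΦ1).trans hΦε
  have hNq : B ^ (-(2 * T + N₀)) ≤ q :=
    Real.rpow_le_rpow_of_exponent_le hB.le (by linarith)
  have hTq : (B ^ (-(1 / 2) * Real.sqrt (2 * Real.exp 1 * k * R * Real.log (S / ε)))) ^ 2 = q := by
    rw [← Real.rpow_natCast, ← Real.rpow_mul hB0.le, hq, hT]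
    congr 1; push_cast; ring
  have hC1 : B * (R * K * (1 + E) + 1) ≤ C ^ 2 := by
    have : 0 ≤ B * (R * K * (1 + E) + 1) := by positivity
    rw [hC]; nlinarith
  calc B * ((Φ + E) * ε ^ 2 * R + B ^ (-(2 * T + N₀)) * S ^ 2)
      = B * ((Φ * ε ^ 2 + E * ε ^ 2) * R + B ^ (-(2 * T + N₀)) * S ^ 2) := by ring
    _ ≤ B * ((K * S ^ 2 * q + E * (K * S ^ 2 * q)) * R + q * S ^ 2) := by gcongr
    _ = B * (R * K * (1 + E) + 1) * (S ^ 2 * q) := by ring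
    _ ≤ C ^ 2 * (S ^ 2 * q) := by gcongr
    _ = _ := by rw [mul_pow, mul_pow, hTq]; ring

end Scattering

theorem mainTheorem4 (k R B₀ : ℝ) (hk : 0 < k) (hR : 0 < R) (hB₀ : 1 < B₀) :
    ∃ C : ℝ, 0 < C ∧
      ∀ (n : ℕ), 2 ≤ n →
      ∀ (w : Scattering.Eucl n → ℂ) (A : Metric.sphere (0 : Scattering.Eucl n) 1 → ℂ)
        (S ε : ℝ), 0 ≤ S → 0 ≤ ε →
        Scattering.MemH2loc w →
        Scattering.IsHelmholtzSolution k (Scattering.exterior n R) w →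
        Scattering.IsRadiating k R w →
        Scattering.normL2 (Scattering.annulus n R (2 * R)) w ≤ ENNReal.ofReal S →
        Scattering.IsFarFieldPattern k R w A →
        Scattering.normL2Sphere A = ENNReal.ofReal ε →
        (ε < C⁻¹ * S →
          (0 < ε →
            Scattering.normL2 (Scattering.annulus n (B₀ * R) (2 * B₀ * R)) w ≤
              ENNReal.ofReal
                (C * S * B₀ ^ (-(1 / 2) *
                  Real.sqrt (2 * Real.exp 1 * k * R * Real.log (S / ε))))) ∧
          (ε = 0 →
            Scattering.normL2 (Scattering.annulus n (B₀ * R) (2 * B₀ * R)) w = 0)) ∧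
        (C⁻¹ * S ≤ ε →
          Scattering.normL2 (Scattering.annulus n R (2 * R)) w ≤ ENNReal.ofReal (C * ε)) := by
  obtain ⟨C, hC, hCE⟩ := Scattering.exists_energy_le hk hR hB₀
  have hC0 : 0 < C := one_pos.trans_le hC
  have hB0 : 0 < B₀ := one_pos.trans hB₀
  refine ⟨C, hC0, fun n hn w A S ε hS hε _ hsol hrad hw hfar hA => ⟨fun hlt => ⟨fun hε0 => ?_,
    fun hε0 => ?_⟩, fun hle => ?_⟩⟩
  · obtain ⟨v, hv, hwv⟩ := Scattering.exists_isRadiatingField hR hsol hrad hfar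
    -- Because `C ≥ 1`, the hypothesis `ε < C⁻¹ S` gives `ε < S`, so the logarithm is positive.
    have hεS : ε < S := hlt.trans_le (mul_le_of_le_one_left hS (inv_le_one_of_one_le₀ hC))
    obtain ⟨N, hN, hb⟩ := hCE S ε hε0 hεS
    have h1 := hv.normL2_annulus_sq_le hn hk hR hwv hS hε hw hA hB₀ hN
    rw [← ENNReal.pow_le_pow_left_iff two_ne_zero, ← ENNReal.ofReal_pow (by positivity)]
    exact h1.trans (ENNReal.ofReal_le_ofReal hb)
  · obtain ⟨v, hv, hwv⟩ := Scattering.exists_isRadiatingField hR hsol hrad hfar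
    have hRB : R ≤ B₀ * R := by nlinarith
    rw [← pow_eq_zero_iff two_ne_zero, Scattering.normL2_annulus_sq (by omega) hR hRB _
      hv.contDiffOn.continuousOn hwv]
    rw [hε0, ENNReal.ofReal_zero] at hA
    rw [setLIntegral_congr_fun measurableSet_Ioo fun r hr =>
      hv.sphereEnergy_eq_zero hn hk hR.le hA (hRB.trans_lt hr.1), lintegral_zero]
  · refine hw.trans (ENNReal.ofReal_le_ofReal ?_)
    rwa [inv_mul_le_iff₀ hC0] at hle
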